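/- Let $A\in\mathbb R^{s\times s}$ and $\mathbf b\in\mathbb R^s$ ($s\ge 1$) be the coefficients of a Runge–Kutta method, let $\mathbb 1=(1,\dots,1)^T$, and let $r(z)=1+z\,\mathbf b^T(I-zA)^{-1}\mathbb 1$ be its stability function. Assume that $A$ is invertible with all eigenvalues in the open right half-plane, that the method is A-stable ($|r(z)|\le 1$ for $\operatorname{Re}z\le 0$) with $|r(iy)|<1$ for all real $y\neq 0$, and that it is stiffly accurate, $\mathbf b^TA^{-1}=(0,\dots,0,1)$. Put $\Delta(\zeta)=\bigl(A+\tfrac{\zeta}{1-\zeta}\mathbb 1\mathbf b^T\bigr)^{-1}$. Let $D\in\{1,2,3\}$ and $x\in\mathbb R^D$, with $x\ne0$ if $D\in\{2,3\}$. The transfer operator of the free Schrödinger equation is, for $z\in\mathbb C\setminus(-\infty,0]$ and with $\sqrt{z/i}:=e^{-i\pi/4}\sqrt z$ (principal square root of $z$), $$K(z,x)=\begin{cases}\dfrac{1}{2\sqrt{z/i}}\,e^{-|x|\sqrt{z/i}}, & D=1,\\[1ex] \dfrac1{2\pi}K_0\bigl(\|x\|\sqrt{z/i}\bigr), & D=2,\\[1ex]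 \dfrac1{4\pi\|x\|}\,e^{-\|x\|\sqrt{z/i}}, & D=3,\end{cases}$$ where $K_0$ is the principal branch of the modified Bessel function of the second kind. For $\lambda>0$, $K(\lambda e^{\pm i\pi},x)$ denotes the boundary value of $K(\cdot,x)$ at $-\lambda$ from the upper ($+$), respectively lower ($-$), side of the cut, i.e. the value obtained with $\sqrt z=\sqrt\lambda\,e^{\pm i\pi/2}$. For a step size $h>0$, let $W_n(x)$ and $\mathbf E_n(z)$ (for $\operatorname{Re}z\le 0$) be the coefficients of the power expansions about $\zeta=0$ $$K\Bigl(\frac{\Delta(\zeta)}h,x\Bigr)=\sum_{n\ge0}W_n(x)\zeta^n,\qquad(\Delta(\zeta)-zI)^{-1}=\sum_{n\ge0}\mathbf E_n(z)\zeta^n,$$ and let the convolution quadrature weights $\boldsymbol\omega_n(x)$ and the row vectors $\mathbf e_n(z)$ be the last rows of $W_n(x)$ and $\mathbf E_n(z)$. (These expansions exist and converge for $\zeta$ near $0$.) Then for all $h>0$, $\xi>0$ and $n\ge1$, $$\boldsymbol\omega_n(x)=\frac h{2\pi i}\int_{\Gamma_+\cup\Gamma_-}K(z,x)\,\mathbf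 e_n(hz)\,dz+\frac h{2\pi i}\int_0^\xi G(\lambda,x)\,\mathbf e_n(-h\lambda)\,d\lambda,$$ with absolutely convergent integrals, where $\Gamma_\pm=\{-\xi\pm iy:y>0\}$ are both oriented in the direction of increasing imaginary part and $G(\lambda,x)=K(\lambda e^{-i\pi},x)-K(\lambda e^{i\pi},x)$. Moreover, for all $\lambda>0$, $$G(\lambda,x)=\begin{cases}\dfrac{i\,e^{i\pi/4}}{\sqrt\lambda}\cosh\bigl(|x|e^{i\pi/4}\sqrt\lambda\bigr), & D=1,\\[1ex] \dfrac i2\,J_0\bigl(e^{-i\pi/4}\sqrt\lambda\,\|x\|\bigr), & D=2,\\[1ex] \dfrac1{2\pi\|x\|}\sinh\bigl(\|x\|e^{i\pi/4}\sqrt\lambda\bigr), & D=3.\end{cases}$$ -/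

import Mathlib

open Filter Topology MeasureTheory Set
open scoped Matrix Nat

noncomputable section

namespace SchrodingerCQ

/-! ### Bessel functions of order zero (power series, principal logarithm) -/

/-- The Bessel function `J₀(z) = ∑ (-1)^k (z²/4)^k / (k!)²`. -/
def besselJ0 (z : ℂ) : ℂ :=
  ∑' k : ℕ, (-1 : ℂ) ^ k * (z ^ 2 / 4) ^ k / ((k ! : ℂ) ^ 2)

/-- The modified Bessel function of the first kind `I₀(z) = ∑ (z²/4)^k / (k!)²`. -/
def besselI0 (z : ℂ) : ℂ :=
  ∑' k : ℕ, (z ^ 2 / 4) ^ k / ((k ! : ℂ) ^ 2)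

/-- The principal branch, on `ℂ ∖ (-∞, 0]`, of the modified Bessel function of the second kind:
`K₀(z) = -(log (z/2) + γ) I₀(z) + ∑ H_k (z²/4)^k / (k!)²`, where `γ` is the Euler-Mascheroni
constant and `H_k` is the `k`-th harmonic number. -/
def besselK0 (z : ℂ) : ℂ :=
  -(Complex.log (z / 2) + (Real.eulerMascheroniConstant : ℂ)) * besselI0 z
    + ∑' k : ℕ, ((harmonic k : ℚ) : ℂ) * (z ^ 2 / 4) ^ k / ((k ! : ℂ) ^ 2)

/-! ### The transfer operator of the free Schrödinger equation in dimension `D = 1, 2, 3` -/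

/-- The transfer operator in dimension `D` at distance `d = ‖x‖`, as a function of a value `s`
of the square root of `z`; here `w = e^{-iπ/4} s` is the corresponding value of `√(z/i)`. -/
def transferOfRoot (D : ℕ) (d : ℝ) (s : ℂ) : ℂ :=
  let w : ℂ := Complex.exp (-(Real.pi / 4 : ℂ) * Complex.I) * s
  match D with
  | 1 => 1 / (2 * w) * Complex.exp (-(d : ℂ) * w)
  | 2 => 1 / (2 * (Real.pi : ℂ)) * besselK0 ((d : ℂ) * w)
  | 3 => 1 / (4 * (Real.pi : ℂ) * (d : ℂ)) * Complex.exp (-(d : ℂ) * w)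
  | _ => 0

/-- `K(z, x)` for `z` in the cut plane `ℂ ∖ (-∞, 0]`, with the principal square root of `z`. -/
def transferK (D : ℕ) (d : ℝ) (z : ℂ) : ℂ :=
  transferOfRoot D d (z ^ (1 / 2 : ℂ))

/-- `K(ρ e^{iθ}, x)` for `ρ > 0` and `-π ≤ θ ≤ π`, with the square root `√ρ e^{iθ/2}`. The angles
`θ = π` and `θ = -π` give the boundary values on the upper and the lower side of the cut. -/
def transferPolar (D : ℕ) (d : ℝ) (ρ θ : ℝ) : ℂ :=
  transferOfRoot D d ((Real.sqrt ρ : ℂ) * Complex.exp ((θ / 2 : ℂ) * Complex.I))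

/-- Off the cut, the two descriptions of `K` agree. -/
theorem transferPolar_eq_transferK (D : ℕ) (d : ℝ) {ρ θ : ℝ} (hρ : 0 < ρ)
    (h1 : -Real.pi < θ) (h2 : θ < Real.pi) :
    transferPolar D d ρ θ = transferK D d ((ρ : ℂ) * Complex.exp ((θ : ℂ) * Complex.I)) := by
  unfold transferPolar transferK
  congr 1
  have hne : ((ρ : ℂ) * Complex.exp ((θ : ℂ) * Complex.I)) ≠ 0 :=
    mul_ne_zero (by exact_mod_cast hρ.ne') (Complex.exp_ne_zero _)
  have hlog : Complex.log ((ρ : ℂ) * Complex.exp ((θ : ℂ) * Complex.I))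
      = (Real.log ρ : ℂ) + (θ : ℂ) * Complex.I := by
    rw [Complex.log_ofReal_mul hρ (Complex.exp_ne_zero _), Complex.log_exp]
    · simpa using h1
    · simpa using h2.le
  rw [Complex.cpow_def_of_ne_zero hne, hlog, Real.sqrt_eq_rpow, Real.rpow_def_of_pos hρ]
  push_cast
  rw [← Complex.exp_add]
  congr 1
  ring

/-- The jump `G(lam, x) = K(lam e^{-iπ}, x) - K(lam e^{iπ}, x)` across the cut. -/
def jumpG (D : ℕ) (d : ℝ) (lam : ℝ) : ℂ :=
  transferPolar D d lam (-Real.pi) - transferPolar D d lam Real.pi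

/-! ### Functions of matrices -/

/-- `N = f(M)`: `f` is analytic at the eigenvalues of `M`, and `N = p(M)` for a polynomial `p`
whose derivatives agree with those of `f` at each eigenvalue, up to its multiplicity. -/
def IsMatrixFunction {ι : Type*} [Fintype ι] [DecidableEq ι] (f : ℂ → ℂ)
    (M N : Matrix ι ι ℂ) : Prop :=
  (∀ μ ∈ spectrum ℂ M, AnalyticAt ℂ f μ) ∧
  ∃ p : Polynomial ℂ,
    (∀ μ : ℂ, ∀ j < M.charpoly.rootMultiplicity μ,
      (Polynomial.derivative^[j] p).eval μ = iteratedDeriv j f μ) ∧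
    N = Polynomial.aeval M p

open Classical in
/-- The matrix `f(M)` (and `0` if it is not defined). -/
def matrixFunction {ι : Type*} [Fintype ι] [DecidableEq ι] (f : ℂ → ℂ)
    (M : Matrix ι ι ℂ) : Matrix ι ι ℂ :=
  if h : ∃ N, IsMatrixFunction f M N then h.choose else 0

/-- The `n`-th coefficient of the power expansion at `0` of a matrix-valued function. -/
def powerCoeff {ι : Type*} (F : ℂ → Matrix ι ι ℂ) (n : ℕ) : Matrix ι ι ℂ :=
  Matrix.of fun i j => iteratedDeriv n (fun ζ => F ζ i j) 0 / (n ! : ℂ)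

/-! ### Runge-Kutta convolution quadrature -/

/-- The coefficients of a Runge-Kutta method with `m + 1` stages. -/
structure RKMethod (m : ℕ) where
  A : Matrix (Fin (m + 1)) (Fin (m + 1)) ℝ
  b : Fin (m + 1) → ℝ

namespace RKMethod

variable {m : ℕ} (M : RKMethod m)

/-- The coefficient matrix, with complex entries. -/
def AC : Matrix (Fin (m + 1)) (Fin (m + 1)) ℂ := M.A.map Complex.ofReal

/-- The weight vector, with complex entries. -/
def bC : Fin (m + 1) → ℂ := fun i => (M.b i : ℂ)

/-- The stability function `r(z) = 1 + z bᵀ (I - z A)⁻¹ 𝟙`. -/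
def r (z : ℂ) : ℂ := 1 + z * (M.bC ⬝ᵥ ((1 - z • M.AC)⁻¹ *ᵥ 1))

/-- The assumptions on the method: A-stability, with the eigenvalues of `A` in the open right
half-plane; strict stability on the imaginary axis away from `0`; invertibility of `A`; and stiff
accuracy `bᵀ A⁻¹ = (0, …, 0, 1)`. -/
structure Admissible : Prop where
  eigenvalues_pos : ∀ μ ∈ spectrum ℂ M.AC, 0 < μ.re
  aStable : ∀ z : ℂ, z.re ≤ 0 → ‖M.r z‖ ≤ 1
  strict : ∀ y : ℝ, y ≠ 0 → ‖M.r (Complex.I * y)‖ < 1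
  invertible : IsUnit M.A.det
  stifflyAccurate : M.b ᵥ* M.A⁻¹ = Pi.single (Fin.last m) 1

/-- The symbol `Δ(ζ) = (A + ζ/(1-ζ) 𝟙 bᵀ)⁻¹`. -/
def symbol (ζ : ℂ) : Matrix (Fin (m + 1)) (Fin (m + 1)) ℂ :=
  (M.AC + (ζ / (1 - ζ)) • Matrix.vecMulVec 1 M.bC)⁻¹

/-- The resolvent `(Δ(ζ) - z I)⁻¹` of the symbol. -/
def resolvent (z ζ : ℂ) : Matrix (Fin (m + 1)) (Fin (m + 1)) ℂ :=
  (M.symbol ζ - z • (1 : Matrix (Fin (m + 1)) (Fin (m + 1)) ℂ))⁻¹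

/-- `E_n(z)`: the coefficients of `(Δ(ζ) - z I)⁻¹ = ∑ E_n(z) ζ^n`. -/
def E (n : ℕ) (z : ℂ) : Matrix (Fin (m + 1)) (Fin (m + 1)) ℂ :=
  powerCoeff (M.resolvent z) n

/-- `e_n(z)`: the last row of `E_n(z)`. -/
def e (n : ℕ) (z : ℂ) : Fin (m + 1) → ℂ := M.E n z (Fin.last m)

/-- The matrix `K(Δ(ζ)/h)`. -/
def cqMatrix (K : ℂ → ℂ) (h : ℝ) (ζ : ℂ) : Matrix (Fin (m + 1)) (Fin (m + 1)) ℂ :=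
  matrixFunction K ((h : ℂ)⁻¹ • M.symbol ζ)

/-- The weight matrices `W_n`: the coefficients of `K(Δ(ζ)/h) = ∑ W_n ζ^n`. -/
def W (K : ℂ → ℂ) (h : ℝ) (n : ℕ) : Matrix (Fin (m + 1)) (Fin (m + 1)) ℂ :=
  powerCoeff (M.cqMatrix K h) n

/-- The convolution quadrature weights `ω_n`: the last row of `W_n`. -/
def omega (K : ℂ → ℂ) (h : ℝ) (n : ℕ) : Fin (m + 1) → ℂ := M.W K h n (Fin.last m)

end RKMethod

/-- The integral of `F` over `Γ₊ ∪ Γ₋`, `Γ± = {-ξ ± iy : y > 0}`, both half-lines being oriented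
upwards, so that `dz = i dy` on both when `Γ₋` is written as an integral over `y ∈ (0, ∞)`. -/
def verticalIntegral (ξ : ℝ) (F : ℂ → ℂ) : ℂ :=
  (∫ y in Ioi (0 : ℝ), F (-(ξ : ℂ) + Complex.I * (y : ℂ)) * Complex.I)
    + ∫ y in Ioi (0 : ℝ), F (-(ξ : ℂ) - Complex.I * (y : ℂ)) * Complex.I

end SchrodingerCQ

end

namespace SchrodingerCQ

/-! Stiff accuracy makes the symbol affine in `ζ`: with `u = A⁻¹𝟙` and `e_s` the last unit vector,
`Δ(ζ) = A⁻¹ - ζ u e_sᵀ` (`Admissible.symbol_eq`). By Sherman–Morrison the resolvent `(Δ(ζ) - z)⁻¹`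
is a geometric series in `ζ`, and for `n ≥ 1` the last row of its `n`-th coefficient is `stab(z)ⁿ`
times the last row of `R(z) = (A⁻¹ - z)⁻¹`, where `stab(z) = e_sᵀ R(z) u` is the stability function
(`resCoeff_last`). Both `stab` and `R` are `O(1/|z|)`, so for `n ≥ 1` the vector `e_n(hz)` is
`O(|z|⁻²)`.

The spectrum of `A⁻¹/h` lies in the open right half-plane, hence inside a circle of Apollonius `|z -
1| = ρ |z + 1|` with `ρ < 1`, the Cayley image of `|u| = ρ`. Cauchy's formula on this circle,
combined with Hermite interpolation (`isMatrixFunction_of_cauchy`), represents `K(Δ(ζ)/h)`;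
expanding in `ζ` gives `W_n = -h/(2πi) ∮ K(z) E_n(hz) dz` (`Admissible.W_eq`). The weight does not
know `ρ`, so `ρ` may tend to `1`, and the circle opens onto the imaginary axis
(`tendsto_integral_cayley`). Cauchy's theorem in the two half-strips between `Re z = -ξ` and `Re z =
0` (`integral_halfStrip`) then moves the integral to `Γ₊ ∪ Γ₋`, at the price of the integrals along
both sides of the cut; their difference is the integral of the jump `G`.

All limits rest on one majorant, a multiple of `(1 + |z|^(-1/2)) / (1 + |z|)²`, which requires
`|K(z)| ≤ C (1 + |z|^(-1/2))` for `Re z ≥ -ξ` (`exists_norm_transferOfRoot_le`). For exponentials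
this holds because `Re √(z/i) ≥ -√ξ` there. For `D = 2` it needs the growth of `K₀`, which the
defining series does not show. The series is therefore identified with `e^{-w} ∫ e^{-τ} τ^(-1/2) (τ
+ 2w)^(-1/2) dτ`: on the positive axis through a differential equation and the asymptotics at `0`
(where Euler's constant enters as `-Γ'(1)`), then on the slit plane by the identity theorem
(`besselLaplace_eq_besselK0`). -/

/-! ### Functions of matrices and Hermite interpolation -/

theorem IsMatrixFunction.unique {ι : Type*} [Fintype ι] [DecidableEq ι] {f : ℂ → ℂ}
    {M N N' : Matrix ι ι ℂ} (h : IsMatrixFunction f M N) (h' : IsMatrixFunction f M N') :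
    N = N' := by
  obtain ⟨-, p, hp, rfl⟩ := h
  obtain ⟨-, q, hq, rfl⟩ := h'
  by_cases hpq : p - q = 0
  · rw [sub_eq_zero.1 hpq]
  -- Two interpolants of the same Hermite data differ by a multiple of the characteristic
  -- polynomial, which Cayley–Hamilton annihilates.
  have hdvd : M.charpoly ∣ p - q := by
    have hs : M.charpoly = (M.charpoly.roots.map fun a => Polynomial.X - Polynomial.C a).prod :=
      (IsAlgClosed.splits M.charpoly).eq_prod_roots_of_monic M.charpoly_monic
    rw [hs, Multiset.prod_X_sub_C_dvd_iff_le_roots hpq, Multiset.le_iff_count]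
    intro μ
    rw [Polynomial.count_roots, Polynomial.count_roots]
    by_contra! hlt
    obtain ⟨j, hj⟩ : ∃ j, j + 1 = M.charpoly.rootMultiplicity μ :=
      ⟨_, Nat.sub_add_cancel (by omega)⟩
    have : j < (p - q).rootMultiplicity μ := by
      rw [Polynomial.lt_rootMultiplicity_iff_isRoot_iterate_derivative hpq]
      intro l hl
      rw [Polynomial.iterate_derivative_sub, Polynomial.IsRoot.def, Polynomial.eval_sub,
        hp μ l (by omega), hq μ l (by omega), sub_self]
    omega
  obtain ⟨g, hg⟩ := hdvd
  rw [← sub_eq_zero, ← map_sub, hg, map_mul, Matrix.aeval_self_charpoly, zero_mul]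

theorem IsMatrixFunction.matrixFunction_eq {ι : Type*} [Fintype ι] [DecidableEq ι] {f : ℂ → ℂ}
    {M N : Matrix ι ι ℂ} (h : IsMatrixFunction f M N) : matrixFunction f M = N := by
  have hex : ∃ N, IsMatrixFunction f M N := ⟨N, h⟩
  rw [matrixFunction, dif_pos hex]
  exact hex.choose_spec.unique h

theorem iteratedDeriv_div_factorial_of_hasSum {F : ℂ → ℂ} {c : ℕ → ℂ}
    (h : ∀ᶠ ζ in 𝓝 (0 : ℂ), HasSum (fun n => ζ ^ n * c n) (F ζ)) (n : ℕ) :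
    iteratedDeriv n F 0 / (n ! : ℂ) = c n := by
  have h1 : HasFPowerSeriesAt F (FormalMultilinearSeries.ofScalars ℂ c) 0 := by
    rw [hasFPowerSeriesAt_iff]
    simpa [FormalMultilinearSeries.coeff_ofScalars] using h
  have h2 := h1.analyticAt.hasFPowerSeriesAt
  have h3 := congrArg (fun p => p.coeff n) (h2.eq_formalMultilinearSeries h1)
  simpa [FormalMultilinearSeries.coeff_ofScalars] using h3

theorem powerCoeff_eq_of_hasSum {ι : Type*} {F : ℂ → Matrix ι ι ℂ} {c : ℕ → Matrix ι ι ℂ}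
    (h : ∀ᶠ ζ in 𝓝 (0 : ℂ), HasSum (fun n => ζ ^ n • c n) (F ζ)) : powerCoeff F = c := by
  ext n i j
  rw [powerCoeff, Matrix.of_apply]
  refine iteratedDeriv_div_factorial_of_hasSum (c := fun n => c n i j) ?_ n
  filter_upwards [h] with ζ hζ
  exact Pi.hasSum.1 (Pi.hasSum.1 hζ i) j

/-- Dividing out the exact order `k` of the zero leaves a factor `g` with `g μ ≠ 0`; if `k < n`, the
bound would force `g μ = 0`. This converts a size estimate for the interpolation error into
agreement of derivatives. -/
theorem iteratedDeriv_eq_zero_of_norm_le {f : ℂ → ℂ} {μ : ℂ} (hf : AnalyticAt ℂ f μ) {n : ℕ}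
    {C : ℝ} (h : ∀ᶠ w in 𝓝 μ, ‖f w‖ ≤ C * ‖w - μ‖ ^ n) : ∀ j < n, iteratedDeriv j f μ = 0 := by
  rw [← natCast_le_analyticOrderAt_iff_iteratedDeriv_eq_zero hf]
  by_contra! hlt
  obtain ⟨k, hk⟩ := ENat.ne_top_iff_exists.1 hlt.ne_top
  rw [← hk, Nat.cast_lt] at hlt
  obtain ⟨g, hg, hg0, hfg⟩ := (hf.analyticOrderAt_eq_natCast).1 hk.symm
  have h1 : ∀ᶠ w in 𝓝[≠] μ, ‖g w‖ ≤ C * ‖w - μ‖ ^ (n - k) := by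
    filter_upwards [h.filter_mono nhdsWithin_le_nhds, hfg.filter_mono nhdsWithin_le_nhds,
      self_mem_nhdsWithin] with w hw hw2 hw3
    have hpos : 0 < ‖w - μ‖ := norm_pos_iff.2 (sub_ne_zero.2 hw3)
    rw [hw2, smul_eq_mul, norm_mul, norm_pow] at hw
    have : ‖w - μ‖ ^ n = ‖w - μ‖ ^ k * ‖w - μ‖ ^ (n - k) := by
      rw [← pow_add]; congr 1; omega
    rw [this] at hw
    refine le_of_mul_le_mul_left ?_ (pow_pos hpos k)
    linarith
  have h2 : Tendsto (fun w => C * ‖w - μ‖ ^ (n - k)) (𝓝[≠] μ) (𝓝 0) := by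
    have : ContinuousAt (fun w => C * ‖w - μ‖ ^ (n - k)) μ := by fun_prop
    have h3 := this.tendsto
    simp only [sub_self, norm_zero] at h3
    rw [zero_pow (by omega), mul_zero] at h3
    exact h3.mono_left nhdsWithin_le_nhds
  have h3 : Tendsto (fun w => ‖g w‖) (𝓝[≠] μ) (𝓝 ‖g μ‖) :=
    hg.continuousAt.norm.tendsto.mono_left nhdsWithin_le_nhds
  have := le_of_tendsto_of_tendsto h3 h2 h1
  exact hg0 (norm_le_zero_iff.1 this)

/-- Hermite's interpolation formula: a Cauchy formula for `f` along a contour, with density `a`,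
gives the contour integral for `f(M)`. -/
theorem isMatrixFunction_of_cauchy {ι : Type*} [Fintype ι] [DecidableEq ι] {f : ℂ → ℂ}
    {M : Matrix ι ι ℂ} {a γ : ℝ → ℂ} (ha : Continuous a) (hγ : Continuous γ)
    (hfγ : Continuous fun θ => f (γ θ)) {V : Set ℂ} (hVo : IsOpen V) (hγV : ∀ θ, γ θ ∉ V)
    (hMV : spectrum ℂ M ⊆ V) (hfa : ∀ μ ∈ spectrum ℂ M, AnalyticAt ℂ f μ)
    (hcauchy : ∀ w ∈ V, ∫ θ in (0 : ℝ)..2 * Real.pi, a θ * (f (γ θ) / (γ θ - w)) = f w) :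
    IsMatrixFunction f M (Matrix.of fun i j =>
      ∫ θ in (0 : ℝ)..2 * Real.pi, a θ * (f (γ θ) * ((Matrix.scalar ι (γ θ) - M)⁻¹) i j)) := by
  classical
  refine ⟨hfa, ?_⟩
  set χ := M.charpoly with hχ
  have hroot : ∀ w, w ∉ V → χ.eval w ≠ 0 := fun w hw h0 =>
    hw (hMV (Matrix.mem_spectrum_of_isRoot_charpoly h0))
  set wt : ℝ → ℂ := fun θ => a θ * (f (γ θ) / χ.eval (γ θ)) with hwt
  have hgc0 : Continuous wt :=
    ha.mul (hfγ.div (χ.continuous.comp hγ) fun θ => hroot _ (hγV θ))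
  -- Since `(X - γ) Q + χ(γ) = χ`, Cayley–Hamilton shows that `Q / χ(γ)` evaluated at `M` is `(γ -
  -- M)⁻¹`. Integrating it against `a f(γ)` produces the interpolating polynomial `p`.
  set Q : ℝ → Polynomial ℂ := fun θ => χ /ₘ (Polynomial.X - Polynomial.C (γ θ)) with hQ
  have hQmul : ∀ θ, (Polynomial.X - Polynomial.C (γ θ)) * Q θ + Polynomial.C (χ.eval (γ θ)) = χ := by
    intro θ
    have := Polynomial.modByMonic_add_div χ (Polynomial.X - Polynomial.C (γ θ))
    rw [Polynomial.modByMonic_X_sub_C_eq_C_eval] at this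
    rw [add_comm]; exact this
  have hQdeg : ∀ θ, (Q θ).natDegree < χ.natDegree + 1 := fun θ => by
    rw [hQ]
    simp only [Polynomial.natDegree_divByMonic _ (Polynomial.monic_X_sub_C _)]
    omega
  have hQc : ∀ j, Continuous fun θ => (Q θ).coeff j := fun j => by
    simp only [hQ, Polynomial.coeff_divByMonic_X_sub_C]
    fun_prop
  set p : Polynomial ℂ := ∑ j ∈ Finset.range (χ.natDegree + 1),
    Polynomial.C (∫ θ in (0 : ℝ)..2 * Real.pi, wt θ * (Q θ).coeff j) * Polynomial.X ^ j with hp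
  have hint : ∀ j, IntervalIntegrable (fun θ => wt θ * (Q θ).coeff j) volume 0 (2 * Real.pi) :=
    fun j => (hgc0.mul (hQc j)).intervalIntegrable _ _
  have hpeval : ∀ w, p.eval w = ∫ θ in (0 : ℝ)..2 * Real.pi, wt θ * (Q θ).eval w := by
    intro w
    simp only [hp, Polynomial.eval_finsetSum, Polynomial.eval_mul, Polynomial.eval_C,
      Polynomial.eval_pow, Polynomial.eval_X]
    simp only [← intervalIntegral.integral_mul_const]
    rw [← intervalIntegral.integral_finsetSum fun j _ => (hint j).mul_const _]
    refine intervalIntegral.integral_congr fun θ _ => ?_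
    rw [Polynomial.eval_eq_sum_range' (hQdeg θ), Finset.mul_sum]
    exact Finset.sum_congr rfl fun j _ => by ring
  -- Hermite's error formula: the error carries the factor `χ`, so at each eigenvalue it vanishes to
  -- the order of the multiplicity.
  have hsub : ∀ w ∈ V, f w - p.eval w =
      χ.eval w * ∫ θ in (0 : ℝ)..2 * Real.pi, wt θ / (γ θ - w) := by
    intro w hw
    have hne : ∀ θ, γ θ - w ≠ 0 := fun θ h0 => hγV θ (by rwa [sub_eq_zero.1 h0])
    rw [← hcauchy w hw, hpeval, ← intervalIntegral.integral_sub,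
      ← intervalIntegral.integral_const_mul]
    · refine intervalIntegral.integral_congr fun θ _ => ?_
      simp only [hwt]
      have h1 := congrArg (Polynomial.eval w) (hQmul θ)
      simp only [Polynomial.eval_add, Polynomial.eval_mul, Polynomial.eval_sub, Polynomial.eval_X,
        Polynomial.eval_C] at h1
      rw [← h1]
      have := hne θ
      have h3 := hroot _ (hγV θ)
      field_simp
      ring
    · exact (ha.mul (hfγ.div (by fun_prop) hne)).intervalIntegrable _ _
    · refine (hgc0.mul ?_).intervalIntegrable _ _
      have : (fun θ => (Q θ).eval w) =
          fun θ => ∑ j ∈ Finset.range (χ.natDegree + 1), (Q θ).coeff j * w ^ j := by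
        ext θ; exact Polynomial.eval_eq_sum_range' (hQdeg θ) _
      rw [this]
      exact continuous_finsetSum _ fun j _ => (hQc j).mul continuous_const
  refine ⟨p, ?_, ?_⟩
  · intro μ j hj
    have hr : χ.IsRoot μ := by
      by_contra hn
      rw [Polynomial.rootMultiplicity_eq_zero hn] at hj
      omega
    have hμ : μ ∈ spectrum ℂ M := Matrix.mem_spectrum_of_isRoot_charpoly hr
    have hμV := hMV hμ
    obtain ⟨δ, hδ, hball⟩ := Metric.isOpen_iff.1 hVo μ hμV
    obtain ⟨B, hB⟩ : ∃ B, ∀ θ ∈ Set.uIcc 0 (2 * Real.pi), ‖wt θ‖ ≤ B :=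
      isCompact_uIcc.exists_bound_of_continuousOn hgc0.continuousOn
    obtain ⟨g, hg⟩ := Polynomial.pow_rootMultiplicity_dvd χ μ
    have hgc : ContinuousAt (fun w => g.eval w) μ := g.continuous.continuousAt
    have hpan : AnalyticAt ℂ (fun w => p.eval w) μ := by
      have := AnalyticOnNhd.eval_polynomial (𝕜 := ℂ) p
      exact this μ (mem_univ _)
    have hbound : ∀ᶠ w in 𝓝 μ, ‖f w - p.eval w‖ ≤
        ((‖g.eval μ‖ + 1) * (B / (δ / 2) * |2 * Real.pi - 0|)) *
          ‖w - μ‖ ^ (χ.rootMultiplicity μ) := by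
      filter_upwards [Metric.ball_mem_nhds μ (half_pos hδ),
        hgc.norm.eventually (gt_mem_nhds (lt_add_one _))] with w hw hgw
      have hwV : w ∈ V := hball (Metric.ball_subset_ball (by linarith) hw)
      rw [hsub w hwV, norm_mul]
      have h1 : ‖∫ θ in (0 : ℝ)..2 * Real.pi, wt θ / (γ θ - w)‖ ≤
          B / (δ / 2) * |2 * Real.pi - 0| := by
        refine intervalIntegral.norm_integral_le_of_norm_le_const fun θ hθ => ?_
        rw [norm_div]
        -- The contour avoids `V`, hence the `δ`-ball about `μ`, while `w` is within `δ / 2` of `μ`.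
        have h2 : δ / 2 ≤ ‖γ θ - w‖ := by
          have h3 : δ ≤ dist (γ θ) μ := by
            by_contra! hlt
            exact hγV θ (hball hlt)
          rw [Metric.mem_ball] at hw
          have := dist_triangle (γ θ) w μ
          rw [dist_eq_norm (γ θ) w] at this
          linarith
        exact div_le_div₀ ((norm_nonneg _).trans (hB θ (uIoc_subset_uIcc hθ)))
          (hB θ (uIoc_subset_uIcc hθ)) (half_pos hδ) h2
      have h2 : ‖χ.eval w‖ ≤ (‖g.eval μ‖ + 1) * ‖w - μ‖ ^ (χ.rootMultiplicity μ) := by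
        conv_lhs => rw [hg]
        simp only [Polynomial.eval_mul, Polynomial.eval_pow, Polynomial.eval_sub,
          Polynomial.eval_X, Polynomial.eval_C, norm_mul, norm_pow]
        rw [mul_comm]
        gcongr
      calc _ ≤ ((‖g.eval μ‖ + 1) * ‖w - μ‖ ^ (χ.rootMultiplicity μ)) *
            (B / (δ / 2) * |2 * Real.pi - 0|) := by gcongr
        _ = _ := by ring
    have h0 := iteratedDeriv_eq_zero_of_norm_le ((hfa μ hμ).sub hpan) hbound j hj
    have h1 : iteratedDeriv j (f - fun w => p.eval w) μ =
        iteratedDeriv j f μ - iteratedDeriv j (fun w => p.eval w) μ :=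
      iteratedDeriv_sub (hfa μ hμ).contDiffAt hpan.contDiffAt
    rw [h1, sub_eq_zero] at h0
    rw [h0, iteratedDeriv_eq_iterate]
    have : ∀ n, (deriv^[n] fun w => p.eval w) = fun w => (Polynomial.derivative^[n] p).eval w := by
      intro n
      induction n with
      | zero => rfl
      | succ n ih =>
        rw [Function.iterate_succ_apply', Function.iterate_succ_apply', ih]
        ext w
        exact Polynomial.deriv _
    rw [this]
  · ext i j
    have hQM : ∀ θ, (Matrix.scalar ι (γ θ) - M)⁻¹ =
        (χ.eval (γ θ))⁻¹ • Polynomial.aeval M (Q θ) := by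
      intro θ
      refine Matrix.inv_eq_right_inv ?_
      have h1 := congrArg (Polynomial.aeval M) (hQmul θ)
      rw [Matrix.aeval_self_charpoly, map_add, map_mul, map_sub, Polynomial.aeval_X,
        Polynomial.aeval_C, Polynomial.aeval_C] at h1
      have h2 : (Matrix.scalar ι (γ θ) - M) * Polynomial.aeval M (Q θ) =
          algebraMap ℂ (Matrix ι ι ℂ) (χ.eval (γ θ)) := by
        have h3 : algebraMap ℂ (Matrix ι ι ℂ) (γ θ) = Matrix.scalar ι (γ θ) := rfl
        rw [h3] at h1
        rw [← sub_eq_zero, ← neg_eq_zero, ← h1]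
        noncomm_ring
      rw [mul_smul_comm, h2, Algebra.algebraMap_eq_smul_one, smul_smul,
        inv_mul_cancel₀ (hroot _ (hγV θ)), one_smul]
    simp only [Matrix.of_apply, hp, map_sum, map_mul, Polynomial.aeval_C, map_pow,
      Polynomial.aeval_X, Algebra.algebraMap_eq_smul_one, smul_mul_assoc, one_mul,
      Matrix.sum_apply, Matrix.smul_apply, smul_eq_mul]
    simp only [← intervalIntegral.integral_mul_const]
    rw [← intervalIntegral.integral_finsetSum fun j _ => (hint j).mul_const _]
    refine intervalIntegral.integral_congr fun θ _ => ?_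
    simp only [hQM, hwt, Matrix.smul_apply, smul_eq_mul]
    rw [Polynomial.aeval_eq_sum_range' (hQdeg θ)]
    simp only [Matrix.sum_apply, Matrix.smul_apply, smul_eq_mul, Finset.mul_sum]
    exact Finset.sum_congr rfl fun j _ => by ring


/-! ### The resolvent of the symbol of a stiffly accurate method -/

namespace RKMethod

variable {m : ℕ} (M : RKMethod m)

/-- The inverse of the coefficient matrix, which is the value of the symbol at `0`. -/
noncomputable def invA : Matrix (Fin (m + 1)) (Fin (m + 1)) ℂ := M.AC⁻¹

/-- The resolvent `(A⁻¹ - z I)⁻¹`. -/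
noncomputable def res (z : ℂ) : Matrix (Fin (m + 1)) (Fin (m + 1)) ℂ := (M.invA - z • 1)⁻¹

/-- The rank-one matrix `A⁻¹ 𝟙 (0, …, 0, 1)`. -/
noncomputable def rankOne : Matrix (Fin (m + 1)) (Fin (m + 1)) ℂ :=
  Matrix.vecMulVec (M.invA *ᵥ 1) (Pi.single (Fin.last m) 1)

/-- The stability function of a stiffly accurate method, in terms of the resolvent of `A⁻¹`. -/
noncomputable def stab (z : ℂ) : ℂ := (M.res z *ᵥ (M.invA *ᵥ 1)) (Fin.last m)

/-- Closed form of the coefficients of the resolvent of the symbol. -/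
noncomputable def resCoeff (n : ℕ) (z : ℂ) : Matrix (Fin (m + 1)) (Fin (m + 1)) ℂ :=
  if n = 0 then M.res z else M.stab z ^ (n - 1) • (M.res z * M.rankOne * M.res z)

variable {M}

theorem Admissible.isUnit_det_AC (hM : M.Admissible) : IsUnit M.AC.det := by
  have h : M.AC = Complex.ofRealHom.mapMatrix M.A := rfl
  rw [h, ← RingHom.map_det]
  exact hM.invertible.map _

theorem Admissible.bC_vecMul_invA (hM : M.Admissible) :
    M.bC ᵥ* M.invA = Pi.single (Fin.last m) 1 := by
  have h2 : M.invA = M.A⁻¹.map Complex.ofReal := by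
    refine Matrix.inv_eq_right_inv ?_
    have h : M.AC = Complex.ofRealHom.mapMatrix M.A := rfl
    have h' : M.A⁻¹.map Complex.ofReal = Complex.ofRealHom.mapMatrix M.A⁻¹ := rfl
    rw [h, h', ← map_mul, Matrix.mul_nonsing_inv _ hM.invertible, map_one]
  ext i
  have h3 := congrFun hM.stifflyAccurate i
  have h4 := congrArg Complex.ofReal h3
  simp only [Matrix.vecMul, dotProduct, Complex.ofReal_sum, Complex.ofReal_mul] at h4
  rw [h2]
  simp only [Matrix.vecMul, dotProduct, Matrix.map_apply, bC]
  rw [h4]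
  by_cases hi : i = Fin.last m
  · subst hi; simp
  · simp [hi]

/-- From `bᵀA⁻¹ = e_sᵀ` follows `bᵀA⁻¹𝟙 = 1`, so with `c = ζ/(1-ζ)` the Sherman–Morrison coefficient
is `c/(1+c) = ζ`. At `ζ = 1` the convention `1 / 0 = 0` spoils the identity. -/
theorem Admissible.symbol_eq (hM : M.Admissible) {ζ : ℂ} (hζ : ζ ≠ 1) :
    M.symbol ζ = M.invA - ζ • M.rankOne := by
  have h1 : M.AC * M.invA = 1 := Matrix.mul_nonsing_inv _ hM.isUnit_det_AC
  refine Matrix.inv_eq_right_inv ?_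
  have h2 : M.AC * M.rankOne = Matrix.vecMulVec 1 (Pi.single (Fin.last m) 1) := by
    rw [rankOne, Matrix.mul_vecMulVec, Matrix.mulVec_mulVec, h1, Matrix.one_mulVec]
  have h3 : Matrix.vecMulVec (1 : Fin (m + 1) → ℂ) M.bC * M.invA = Matrix.vecMulVec 1 (Pi.single (Fin.last m) 1) := by
    rw [Matrix.vecMulVec_mul, hM.bC_vecMul_invA]
  have h4 : Matrix.vecMulVec (1 : Fin (m + 1) → ℂ) M.bC * M.rankOne =
      Matrix.vecMulVec 1 (Pi.single (Fin.last m) 1) := by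
    rw [rankOne, Matrix.vecMulVec_mul_vecMulVec, Matrix.dotProduct_mulVec, hM.bC_vecMul_invA]
    simp
  have hne : (1 : ℂ) - ζ ≠ 0 := sub_ne_zero.2 hζ.symm
  rw [mul_sub, add_mul, add_mul, h1, smul_mul_assoc, h3, mul_smul_comm, h2, smul_mul_assoc,
    mul_smul_comm, h4]
  have : ζ / (1 - ζ) - ζ - ζ / (1 - ζ) * ζ = 0 := by field_simp; ring
  rw [smul_smul, add_sub_add_comm, sub_eq_add_neg 1, add_assoc, ← sub_smul, ← neg_smul, ← add_smul]
  have h5 : -ζ + (ζ / (1 - ζ) - ζ / (1 - ζ) * ζ) = 0 := by rw [← this]; ring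
  rw [h5, zero_smul, add_zero]

/-- For a rank-one matrix, `u vᵀ R u vᵀ = (vᵀ R u) u vᵀ`. This is what makes the expansion of the
resolvent a scalar geometric series. -/
theorem rankOne_mul_res_mul_rankOne (z : ℂ) :
    M.rankOne * M.res z * M.rankOne = M.stab z • M.rankOne := by
  rw [rankOne, Matrix.vecMulVec_mul, Matrix.vecMulVec_mul_vecMulVec, ← Matrix.dotProduct_mulVec,
    single_dotProduct, one_mul, Matrix.vecMulVec_smul, stab]

theorem res_mul_rankOne_mul_res_last (z : ℂ) (i : Fin (m + 1)) :
    (M.res z * M.rankOne * M.res z) (Fin.last m) i = M.stab z * M.res z (Fin.last m) i := by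
  rw [rankOne, Matrix.mul_vecMulVec, Matrix.vecMulVec_mul, Matrix.single_one_vecMul]
  rfl

/-- The last row of `R u e_sᵀ R` is the scalar `e_sᵀ R u = stab z` times the last row of `R`, which
supplies the factor missing from `stab z ^ (n - 1)`. -/
theorem resCoeff_last {n : ℕ} (hn : 1 ≤ n) (z : ℂ) (i : Fin (m + 1)) :
    M.resCoeff n z (Fin.last m) i = M.stab z ^ n * M.res z (Fin.last m) i := by
  rw [resCoeff, if_neg (by omega), Matrix.smul_apply, res_mul_rankOne_mul_res_last, smul_eq_mul,
    ← mul_assoc, ← pow_succ, Nat.sub_add_cancel hn]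

/-- Sherman–Morrison for `(A⁻¹ - z) - ζ u e_sᵀ`; a right inverse is enough for square matrices. -/
theorem Admissible.symbol_sub_mul (hM : M.Admissible) {z ζ : ℂ} (hζ : ζ ≠ 1)
    (hz : IsUnit (M.invA - z • 1)) (hne : 1 - ζ * M.stab z ≠ 0) :
    (M.symbol ζ - z • 1) * (M.res z + ((1 - ζ * M.stab z)⁻¹ * ζ) •
      (M.res z * M.rankOne * M.res z)) = 1 := by
  have h1 : (M.invA - z • 1) * M.res z = 1 :=
    Matrix.mul_nonsing_inv _ ((Matrix.isUnit_iff_isUnit_det _).1 hz)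
  have hs : (1 - ζ * M.stab z)⁻¹ * ζ - (ζ + ζ * ((1 - ζ * M.stab z)⁻¹ * ζ) * M.stab z) = 0 := by
    field_simp
    ring
  rw [hM.symbol_eq hζ]
  generalize (1 - ζ * M.stab z)⁻¹ * ζ = c at hs ⊢
  have e1 : M.invA - ζ • M.rankOne - z • 1 = (M.invA - z • 1) - ζ • M.rankOne := by abel
  have e2 : (M.invA - z • 1) * (M.res z * M.rankOne * M.res z) = M.rankOne * M.res z := by
    rw [← mul_assoc, ← mul_assoc, h1, one_mul]
  have e3 : M.rankOne * (M.res z * M.rankOne * M.res z) =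
      M.stab z • (M.rankOne * M.res z) := by
    rw [← mul_assoc, ← mul_assoc, rankOne_mul_res_mul_rankOne, smul_mul_assoc]
  rw [e1, sub_mul, mul_add, h1, mul_smul_comm, e2, smul_mul_assoc, mul_add, mul_smul_comm, e3,
    add_sub_assoc, smul_add, smul_smul, smul_smul, ← add_smul, ← sub_smul, hs, zero_smul, add_zero]

theorem Admissible.resolvent_hasSum (hM : M.Admissible) {z ζ : ℂ} (hζ : ζ ≠ 1)
    (hz : IsUnit (M.invA - z • 1)) (hs : ‖ζ‖ * ‖M.stab z‖ < 1) :
    IsUnit (M.symbol ζ - z • (1 : Matrix (Fin (m + 1)) (Fin (m + 1)) ℂ)) ∧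
      HasSum (fun n : ℕ => ζ ^ n • M.resCoeff n z) (M.resolvent z ζ) := by
  have hlt : ‖ζ * M.stab z‖ < 1 := by rwa [norm_mul]
  have hne : 1 - ζ * M.stab z ≠ 0 := by
    intro h0
    rw [← sub_eq_zero.1 h0, norm_one] at hlt
    exact lt_irrefl _ hlt
  have hmul := hM.symbol_sub_mul hζ hz hne
  refine ⟨IsUnit.of_mul_eq_one _ hmul, ?_⟩
  rw [resolvent, Matrix.inv_eq_right_inv hmul]
  have h2 : HasSum (fun n : ℕ => ζ ^ (n + 1) • M.resCoeff (n + 1) z)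
      (((1 - ζ * M.stab z)⁻¹ * ζ) • (M.res z * M.rankOne * M.res z)) := by
    have h3 : (fun n : ℕ => ζ ^ (n + 1) • M.resCoeff (n + 1) z) = fun n : ℕ =>
        ((ζ * M.stab z) ^ n * ζ) • (M.res z * M.rankOne * M.res z) := by
      ext1 n
      rw [resCoeff, if_neg (Nat.succ_ne_zero n), smul_smul, Nat.add_sub_cancel, mul_pow,
        pow_succ, mul_right_comm]
    rw [h3]
    exact ((hasSum_geometric_of_norm_lt_one hlt).mul_right ζ).smul_const _
  have h3 := HasSum.zero_add (f := fun n : ℕ => ζ ^ n • M.resCoeff n z) h2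
  have h4 : ζ ^ 0 • M.resCoeff 0 z = M.res z := by
    rw [pow_zero, one_smul, resCoeff, if_pos rfl]
  rwa [h4] at h3

theorem Admissible.eventually_resolvent_hasSum (hM : M.Admissible) {z : ℂ}
    (hz : IsUnit (M.invA - z • 1)) : ∀ᶠ ζ in 𝓝 (0 : ℂ),
      IsUnit (M.symbol ζ - z • (1 : Matrix (Fin (m + 1)) (Fin (m + 1)) ℂ)) ∧
      HasSum (fun n : ℕ => ζ ^ n • M.resCoeff n z) (M.resolvent z ζ) := by
  have h1 : Tendsto (fun ζ : ℂ => ‖ζ‖ * ‖M.stab z‖) (𝓝 0) (𝓝 0) := by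
    have : Continuous fun ζ : ℂ => ‖ζ‖ * ‖M.stab z‖ := by fun_prop
    simpa using this.tendsto 0
  filter_upwards [h1.eventually (gt_mem_nhds one_pos), isOpen_ne.mem_nhds (zero_ne_one (α := ℂ))]
    with ζ h2 h3
  exact hM.resolvent_hasSum h3 hz h2

theorem Admissible.E_eq (hM : M.Admissible) {z : ℂ} (hz : IsUnit (M.invA - z • 1)) (n : ℕ) :
    M.E n z = M.resCoeff n z :=
  congrFun (powerCoeff_eq_of_hasSum (c := fun n => M.resCoeff n z)
    ((hM.eventually_resolvent_hasSum hz).mono fun _ h => h.2)) n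

theorem Admissible.e_eq (hM : M.Admissible) {z : ℂ} (hz : IsUnit (M.invA - z • 1)) {n : ℕ}
    (hn : 1 ≤ n) (i : Fin (m + 1)) :
    M.e n z i = M.stab z ^ n * M.res z (Fin.last m) i := by
  rw [e, hM.E_eq hz, resCoeff_last hn]

theorem not_isUnit_invA_sub_iff {z : ℂ} :
    ¬ IsUnit (M.invA - z • (1 : Matrix (Fin (m + 1)) (Fin (m + 1)) ℂ)) ↔
      z ∈ spectrum ℂ M.invA := by
  rw [spectrum.mem_iff, Algebra.algebraMap_eq_smul_one, ← IsUnit.neg_iff, neg_sub]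

/-- The eigenvalues of `A⁻¹` are the reciprocals of those of `A`, and inversion preserves the sign
of the real part. -/
theorem Admissible.re_pos_of_mem_spectrum (hM : M.Admissible) {μ : ℂ}
    (hμ : μ ∈ spectrum ℂ M.invA) : 0 < μ.re := by
  let U : (Matrix (Fin (m + 1)) (Fin (m + 1)) ℂ)ˣ := Matrix.nonsingInvUnit M.AC hM.isUnit_det_AC
  have h1 : μ ∈ spectrum ℂ ((U⁻¹ : (Matrix (Fin (m + 1)) (Fin (m + 1)) ℂ)ˣ) :
      Matrix (Fin (m + 1)) (Fin (m + 1)) ℂ) := hμ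
  have h2 : μ⁻¹ ∈ spectrum ℂ M.AC := spectrum.inv₀_mem_iff.2 h1
  have h3 := hM.eigenvalues_pos _ h2
  rw [Complex.inv_re] at h3
  by_contra! h4
  exact absurd h3 (not_lt.2 (div_nonpos_of_nonpos_of_nonneg h4 (Complex.normSq_nonneg _)))

theorem Admissible.isUnit_of_re_nonpos (hM : M.Admissible) {z : ℂ} (hz : z.re ≤ 0) :
    IsUnit (M.invA - z • (1 : Matrix (Fin (m + 1)) (Fin (m + 1)) ℂ)) := by
  by_contra hn
  exact absurd (hM.re_pos_of_mem_spectrum (not_isUnit_invA_sub_iff.1 hn)) (not_lt.2 hz)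

theorem norm_sub_one_lt_norm_add_one {z : ℂ} (hz : 0 < z.re) : ‖z - 1‖ < ‖z + 1‖ := by
  rw [← sq_lt_sq₀ (norm_nonneg _) (norm_nonneg _), ← Complex.normSq_eq_norm_sq,
    ← Complex.normSq_eq_norm_sq, Complex.normSq_apply, Complex.normSq_apply]
  simp
  nlinarith

theorem re_pos_of_norm_sub_one_lt {z : ℂ} (hz : ‖z - 1‖ < ‖z + 1‖) : 0 < z.re := by
  rw [← sq_lt_sq₀ (norm_nonneg _) (norm_nonneg _), ← Complex.normSq_eq_norm_sq,
    ← Complex.normSq_eq_norm_sq, Complex.normSq_apply, Complex.normSq_apply] at hz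
  simp at hz
  nlinarith

/-- The scaled spectrum lies in a disc of Apollonius with respect to `1` and `-1`. -/
theorem Admissible.exists_apollonius (hM : M.Admissible) {h : ℝ} (hh : 0 < h) :
    ∃ ρ : ℝ, 0 < ρ ∧ ρ < 1 ∧ ∀ z : ℂ, ρ * ‖z + 1‖ ≤ ‖z - 1‖ →
      IsUnit (M.invA - ((h : ℂ) * z) • (1 : Matrix (Fin (m + 1)) (Fin (m + 1)) ℂ)) := by
  have hne : (h : ℂ) ≠ 0 := by exact_mod_cast hh.ne'
  -- Points of the open right half-plane are strictly closer to `1` than to `-1`; at finitely many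
  -- points this strict inequality survives multiplication by a `ρ` close to `1`.
  have key : ∀ᶠ ρ in 𝓝[<] (1 : ℝ), ∀ μ ∈ spectrum ℂ M.invA,
      ‖μ / h - 1‖ < ρ * ‖μ / h + 1‖ := by
    rw [Filter.eventually_all_finite (Matrix.finite_spectrum M.invA)]
    intro μ hμ
    have hre : 0 < (μ / h).re := by
      rw [Complex.div_ofReal_re]
      exact div_pos (hM.re_pos_of_mem_spectrum hμ) hh
    have hc : Tendsto (fun ρ : ℝ => ρ * ‖μ / h + 1‖) (𝓝[<] 1) (𝓝 (1 * ‖μ / h + 1‖)) :=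
      (Continuous.tendsto (by fun_prop) 1).mono_left nhdsWithin_le_nhds
    refine hc.eventually (lt_mem_nhds ?_)
    rw [one_mul]
    exact norm_sub_one_lt_norm_add_one hre
  obtain ⟨ρ, hρ, h0, h1⟩ := (key.and (Ioo_mem_nhdsLT (zero_lt_one (α := ℝ)))).exists
  refine ⟨ρ, h0, h1, fun z hz => ?_⟩
  by_contra hn
  have := hρ _ (not_isUnit_invA_sub_iff.1 hn)
  rw [mul_div_cancel_left₀ _ hne] at this
  exact absurd this (not_lt.2 hz)

theorem differentiableAt_det {n : ℕ} {G : ℂ → Matrix (Fin n) (Fin n) ℂ} {z : ℂ}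
    (hG : ∀ i j, DifferentiableAt ℂ (fun z => G z i j) z) :
    DifferentiableAt ℂ (fun z => (G z).det) z := by
  simp only [Matrix.det_apply]
  refine DifferentiableAt.fun_sum fun σ _ => DifferentiableAt.const_smul ?_ _
  exact DifferentiableAt.fun_finsetProd fun i _ => hG _ _

theorem differentiableAt_res {z : ℂ} (hz : IsUnit (M.invA - z • 1)) (i j : Fin (m + 1)) :
    DifferentiableAt ℂ (fun z => M.res z i j) z := by
  have hent : ∀ k l, DifferentiableAt ℂ (fun z : ℂ =>
      (M.invA - z • (1 : Matrix (Fin (m + 1)) (Fin (m + 1)) ℂ)) k l) z := fun k l => by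
    simp only [Matrix.sub_apply, Matrix.smul_apply, smul_eq_mul]
    fun_prop
  -- Cramer's rule: an entry of the inverse is a quotient of determinants whose entries are affine
  -- in `z`.
  have h1 : (fun z => M.res z i j) = fun z =>
      ((M.invA - z • 1).det)⁻¹ * ((M.invA - z • 1).updateRow j (Pi.single i 1)).det := by
    ext w
    rw [res, Matrix.inv_def, Matrix.smul_apply, Matrix.adjugate_apply, Ring.inverse_eq_inv',
      smul_eq_mul]
  rw [h1]
  refine ((differentiableAt_det hent).fun_inv ?_).mul (differentiableAt_det fun k l => ?_)
  · exact ((Matrix.isUnit_iff_isUnit_det _).1 hz).ne_zero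
  · by_cases hk : k = j
    · subst hk; simp only [Matrix.updateRow_self]; fun_prop
    · simp only [Matrix.updateRow_ne hk]; exact hent k l

theorem differentiableAt_stab {z : ℂ} (hz : IsUnit (M.invA - z • 1)) :
    DifferentiableAt ℂ M.stab z := by
  have : M.stab = fun z => ∑ j, M.res z (Fin.last m) j * (M.invA *ᵥ 1) j := rfl
  rw [this]
  exact DifferentiableAt.fun_sum fun j _ => (differentiableAt_res hz _ _).mul_const _

theorem differentiableAt_resCoeff {z : ℂ} (hz : IsUnit (M.invA - z • 1)) (n : ℕ)
    (i j : Fin (m + 1)) : DifferentiableAt ℂ (fun z => M.resCoeff n z i j) z := by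
  by_cases hn : n = 0
  · simp only [resCoeff, if_pos hn]; exact differentiableAt_res hz i j
  · simp only [resCoeff, if_neg hn, Matrix.smul_apply, smul_eq_mul, Matrix.mul_apply]
    refine ((differentiableAt_stab hz).pow _).mul (DifferentiableAt.fun_sum fun k _ =>
      DifferentiableAt.mul (DifferentiableAt.fun_sum fun l _ => ?_) (differentiableAt_res hz _ _))
    exact (differentiableAt_res hz _ _).mul_const _

-- From `(A⁻¹ - z) R = 1` one gets `|z| ‖R‖ ≤ ‖A⁻¹‖ ‖R‖ + ‖1‖`, and the first term is absorbed once
-- `|z| ≥ 2 ‖A⁻¹‖`.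
attribute [local instance] Matrix.linftyOpNormedRing Matrix.linftyOpNormedAlgebra in
theorem exists_norm_res_le_of_large : ∃ N : ℝ, 0 < N ∧ ∀ z : ℂ, N ≤ ‖z‖ →
    IsUnit (M.invA - z • (1 : Matrix (Fin (m + 1)) (Fin (m + 1)) ℂ)) →
    ∀ i j, ‖M.res z i j‖ ≤ N / ‖z‖ := by
  refine ⟨2 * ‖M.invA‖ + 2 * ‖(1 : Matrix (Fin (m + 1)) (Fin (m + 1)) ℂ)‖ + 1, by positivity,
    fun z hz hu i j => ?_⟩
  have hzpos : 0 < ‖z‖ := lt_of_lt_of_le (by positivity) hz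
  have hent : ‖M.res z i j‖ ≤ ‖M.res z‖ := by
    rw [Matrix.linfty_opNorm_def, ← coe_nnnorm, NNReal.coe_le_coe]
    exact (Finset.single_le_sum (f := fun j => ‖M.res z i j‖₊) (fun _ _ => zero_le)
      (Finset.mem_univ j)).trans
        (Finset.le_sup (f := fun i => ∑ j, ‖M.res z i j‖₊) (Finset.mem_univ i))
  have h1 : (M.invA - z • 1) * M.res z = 1 :=
    Matrix.mul_nonsing_inv _ ((Matrix.isUnit_iff_isUnit_det _).1 hu)
  have h2 : z • M.res z = M.invA * M.res z - 1 := by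
    rw [← h1, sub_mul, smul_mul_assoc, one_mul]; abel
  have h3 : ‖z‖ * ‖M.res z‖ ≤ ‖M.invA‖ * ‖M.res z‖ +
      ‖(1 : Matrix (Fin (m + 1)) (Fin (m + 1)) ℂ)‖ := by
    rw [← norm_smul, h2]
    exact (norm_sub_le _ _).trans (by gcongr; exact norm_mul_le _ _)
  rw [le_div_iff₀ hzpos]
  have hn := norm_nonneg (M.res z)
  have hn1 := norm_nonneg M.invA
  have hn2 := norm_nonneg (1 : Matrix (Fin (m + 1)) (Fin (m + 1)) ℂ)
  have h4 : ‖M.res z‖ * ‖z‖ ≤ 2 * ‖(1 : Matrix (Fin (m + 1)) (Fin (m + 1)) ℂ)‖ := by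
    nlinarith [mul_nonneg hn hn2]
  nlinarith [mul_le_mul_of_nonneg_right hent hzpos.le]

/-- Compactness controls a ball, the decay of the resolvent at infinity controls the rest. The set
`T` will be the closed exterior of a disc of Apollonius containing the scaled spectrum. -/
theorem exists_norm_res_le {h : ℝ} (hh : 0 < h) {T : Set ℂ} (hT : IsClosed T)
    (hunit : ∀ z ∈ T, IsUnit (M.invA - ((h : ℂ) * z) •
      (1 : Matrix (Fin (m + 1)) (Fin (m + 1)) ℂ))) :
    ∃ C : ℝ, 0 < C ∧ ∀ z ∈ T, ∀ i j, ‖M.res (h * z) i j‖ ≤ C / (1 + ‖z‖) := by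
  obtain ⟨N, hN, hlarge⟩ := exists_norm_res_le_of_large (M := M)
  have hcomp : IsCompact (T ∩ Metric.closedBall 0 (N / h + 1)) :=
    (isCompact_closedBall 0 _).inter_left hT
  have hb : ∀ i j, ∃ B, ∀ z ∈ T ∩ Metric.closedBall 0 (N / h + 1), ‖M.res (h * z) i j‖ ≤ B := by
    intro i j
    refine hcomp.exists_bound_of_continuousOn fun z hz => ContinuousAt.continuousWithinAt ?_
    have := (differentiableAt_res (hunit z hz.1) i j).continuousAt
    exact ContinuousAt.comp (f := fun z : ℂ => (h : ℂ) * z) (x := z) this (by fun_prop)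
  choose B hB using hb
  set B' := ∑ i, ∑ j, |B i j| with hB'
  have hB'0 : 0 ≤ B' := Finset.sum_nonneg fun i _ => Finset.sum_nonneg fun j _ => abs_nonneg _
  have hle : ∀ i j, B i j ≤ B' := fun i j =>
    (le_abs_self _).trans ((Finset.single_le_sum (f := fun j => |B i j|)
      (fun _ _ => abs_nonneg _) (Finset.mem_univ j)).trans
      (Finset.single_le_sum (f := fun i => ∑ j, |B i j|)
        (fun _ _ => Finset.sum_nonneg fun j _ => abs_nonneg _) (Finset.mem_univ i)))
  -- The first summand serves `‖z‖ ≤ N / h + 1`, the second larger `‖z‖`, where `1 + ‖z‖ ≤ 2 ‖z‖`.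
  refine ⟨B' * (1 + (N / h + 1)) + 2 * (N / h), by positivity, fun z hz i j => ?_⟩
  rw [le_div_iff₀ (by positivity)]
  by_cases hzN : ‖z‖ ≤ N / h + 1
  · have h1 := (hB i j z ⟨hz, by simpa using hzN⟩).trans (hle i j)
    have h2 : ‖M.res (h * z) i j‖ * (1 + ‖z‖) ≤ B' * (1 + (N / h + 1)) := by gcongr
    have h3 : 0 ≤ 2 * (N / h) := by positivity
    linarith
  · push Not at hzN
    have hNh : 0 < N / h := by positivity
    have hn : ‖(h : ℂ) * z‖ = h * ‖z‖ := by
      rw [norm_mul, Complex.norm_real, Real.norm_of_nonneg hh.le]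
    have h1 := hlarge ((h : ℂ) * z) (by
      rw [hn]
      have : N / h ≤ ‖z‖ := by linarith
      rw [div_le_iff₀ hh] at this
      linarith) (hunit z hz) i j
    rw [hn] at h1
    have hz1 : 1 ≤ ‖z‖ := by linarith
    have h2 : N / (h * ‖z‖) * (1 + ‖z‖) ≤ 2 * (N / h) := by
      rw [div_mul_eq_mul_div, div_le_iff₀ (by positivity)]
      have : 2 * (N / h) * (h * ‖z‖) = 2 * N * ‖z‖ := by field_simp
      rw [this]
      nlinarith
    have h3 : ‖M.res (h * z) i j‖ * (1 + ‖z‖) ≤ N / (h * ‖z‖) * (1 + ‖z‖) := by gcongr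
    have h4 : 0 ≤ B' * (1 + (N / h + 1)) := by positivity
    linarith

theorem exists_norm_stab_le {h : ℝ} {T : Set ℂ} {C : ℝ}
    (hC : ∀ z ∈ T, ∀ i j, ‖M.res (h * z) i j‖ ≤ C / (1 + ‖z‖)) :
    ∃ C', 0 ≤ C' ∧ ∀ z ∈ T, ‖M.stab (h * z)‖ ≤ C' * (C / (1 + ‖z‖)) := by
  refine ⟨∑ j, ‖(M.invA *ᵥ 1) j‖, Finset.sum_nonneg fun _ _ => norm_nonneg _, fun z hz => ?_⟩
  have : M.stab (h * z) = ∑ j, M.res (h * z) (Fin.last m) j * (M.invA *ᵥ 1) j := rfl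
  rw [this, Finset.sum_mul]
  refine (norm_sum_le _ _).trans (Finset.sum_le_sum fun j _ => ?_)
  rw [norm_mul, mul_comm]
  gcongr
  exact hC z hz _ _

end RKMethod


/-! ### Cauchy's formula on circles of Apollonius -/

/-- The Möbius transformation of the unit disc onto the right half-plane. -/
noncomputable def cayley (u : ℂ) : ℂ := (1 + u) / (1 - u)

/-- The image under `cayley` of the circle of radius `ρ`. -/
noncomputable def cayleyContour (ρ θ : ℝ) : ℂ := cayley (circleMap 0 ρ θ)

/-- The density of `dz / (2 π i)` along `cayleyContour`. -/
noncomputable def cayleyDensity (ρ θ : ℝ) : ℂ :=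
  (2 * (Real.pi : ℂ) * Complex.I)⁻¹ *
    (2 / (1 - circleMap 0 ρ θ) ^ 2 * (circleMap 0 ρ θ * Complex.I))

theorem one_sub_ne_zero_of_norm_lt {u : ℂ} (hu : ‖u‖ < 1) : 1 - u ≠ 0 := by
  intro h
  rw [← sub_eq_zero.1 h, norm_one] at hu
  exact lt_irrefl _ hu

theorem norm_circleMap_zero_of_pos {ρ : ℝ} (h0 : 0 < ρ) (θ : ℝ) : ‖circleMap 0 ρ θ‖ = ρ := by
  rw [norm_circleMap_zero, abs_of_pos h0]

theorem cayley_sub_one {u : ℂ} (hu : 1 - u ≠ 0) : cayley u - 1 = 2 * u / (1 - u) := by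
  rw [cayley]; field_simp; ring

theorem cayley_add_one {u : ℂ} (hu : 1 - u ≠ 0) : cayley u + 1 = 2 / (1 - u) := by
  rw [cayley]; field_simp; ring

theorem norm_cayley_sub_one {u : ℂ} (hu : 1 - u ≠ 0) : ‖cayley u - 1‖ = ‖u‖ * ‖cayley u + 1‖ := by
  rw [cayley_sub_one hu, cayley_add_one hu, norm_div, norm_mul, norm_div]; ring

theorem re_cayley_pos {u : ℂ} (hu : ‖u‖ < 1) : 0 < (cayley u).re := by
  have h1 := one_sub_ne_zero_of_norm_lt hu
  refine RKMethod.re_pos_of_norm_sub_one_lt ?_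
  rw [norm_cayley_sub_one h1]
  have : 0 < ‖cayley u + 1‖ := norm_pos_iff.2 (by
    rw [cayley_add_one h1]; exact div_ne_zero two_ne_zero h1)
  nlinarith

section

variable {ρ : ℝ}

theorem one_sub_circleMap_ne_zero (h0 : 0 < ρ) (h1 : ρ < 1) (θ : ℝ) : 1 - circleMap 0 ρ θ ≠ 0 :=
  one_sub_ne_zero_of_norm_lt (by rwa [norm_circleMap_zero_of_pos h0])

theorem continuous_cayleyContour (h0 : 0 < ρ) (h1 : ρ < 1) : Continuous (cayleyContour ρ) :=
  (continuous_const.add (continuous_circleMap 0 ρ)).div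
    (continuous_const.sub (continuous_circleMap 0 ρ)) (one_sub_circleMap_ne_zero h0 h1)

theorem continuous_cayleyDensity (h0 : 0 < ρ) (h1 : ρ < 1) : Continuous (cayleyDensity ρ) :=
  continuous_const.mul ((continuous_const.div
    ((continuous_const.sub (continuous_circleMap 0 ρ)).pow 2)
      fun θ => pow_ne_zero 2 (one_sub_circleMap_ne_zero h0 h1 θ)).mul
        ((continuous_circleMap 0 ρ).mul continuous_const))

theorem re_cayleyContour_pos (h0 : 0 < ρ) (h1 : ρ < 1) (θ : ℝ) : 0 < (cayleyContour ρ θ).re :=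
  re_cayley_pos (by rwa [norm_circleMap_zero_of_pos h0])

theorem norm_cayleyContour_sub_one (h0 : 0 < ρ) (h1 : ρ < 1) (θ : ℝ) :
    ‖cayleyContour ρ θ - 1‖ = ρ * ‖cayleyContour ρ θ + 1‖ := by
  rw [cayleyContour, norm_cayley_sub_one (one_sub_circleMap_ne_zero h0 h1 θ),
    norm_circleMap_zero_of_pos h0]

/-- Cauchy's formula in the half-plane, for the circles of Apollonius. -/
theorem integral_cayley_cauchy (h0 : 0 < ρ) (h1 : ρ < 1) {f : ℂ → ℂ} (hf : ∀ z : ℂ, 0 < z.re → DifferentiableAt ℂ f z)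
    {w : ℂ} (hw : ‖w - 1‖ < ρ * ‖w + 1‖) :
    ∫ θ in (0 : ℝ)..2 * Real.pi,
      cayleyDensity ρ θ * (f (cayleyContour ρ θ) / (cayleyContour ρ θ - w)) = f w := by
  have hw1 : w + 1 ≠ 0 := by
    intro h
    rw [h, norm_zero, mul_zero] at hw
    exact absurd hw (not_lt.2 (norm_nonneg _))
  set v := (w - 1) / (w + 1) with hv
  have hvρ : ‖v‖ < ρ := by
    rw [hv, norm_div, div_lt_iff₀ (norm_pos_iff.2 hw1)]; exact hw
  have hv1 : 1 - v ≠ 0 := one_sub_ne_zero_of_norm_lt (hvρ.trans h1)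
  have hcv : cayley v = w := by
    rw [cayley, div_eq_iff hv1, hv]
    field_simp
    ring
  -- With `z = cayley u` and `w = cayley v`, one has `dz / (z - w) = (1 - v) / (1 - u) · du / (u -
  -- v)`. The extra factor equals `1` at `u = v`.
  have hF : DifferentiableOn ℂ (fun u => f (cayley u) * ((1 - v) / (1 - u)))
      (Metric.closedBall 0 ρ) := by
    intro u hu
    have hu1 : ‖u‖ < 1 := (mem_closedBall_zero_iff.1 hu).trans_lt h1
    have hu2 := one_sub_ne_zero_of_norm_lt hu1
    have hc : DifferentiableAt ℂ cayley u :=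
      ((differentiableAt_const _).add differentiableAt_id).div
        ((differentiableAt_const _).sub differentiableAt_id) hu2
    refine DifferentiableAt.differentiableWithinAt ?_
    refine ((hf _ (re_cayley_pos hu1)).comp u hc).mul ?_
    exact (differentiableAt_const _).div ((differentiableAt_const _).sub differentiableAt_id) hu2
  have key := hF.circleIntegral_sub_inv_smul (mem_ball_zero_iff.2 hvρ)
  rw [circleIntegral] at key
  have hpi : (2 * (Real.pi : ℂ) * Complex.I) ≠ 0 := Complex.two_pi_I_ne_zero
  have h2 := congrArg (fun t => (2 * (Real.pi : ℂ) * Complex.I)⁻¹ * t) key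
  simp only [smul_eq_mul, inv_mul_cancel_left₀ hpi, hcv, div_self hv1, mul_one] at h2
  rw [← h2, ← intervalIntegral.integral_const_mul]
  refine intervalIntegral.integral_congr fun θ _ => ?_
  simp only [deriv_circleMap, cayleyDensity, cayleyContour]
  have hu2 := one_sub_circleMap_ne_zero h0 h1 θ
  have huv : circleMap 0 ρ θ - v ≠ 0 := by
    intro h
    rw [← sub_eq_zero.1 h, norm_circleMap_zero_of_pos h0] at hvρ
    exact lt_irrefl _ hvρ
  generalize circleMap 0 ρ θ = u at *
  have hd : cayley u - w = 2 * (u - v) / ((1 - u) * (1 - v)) := by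
    rw [← hcv, cayley, cayley]; field_simp; ring
  rw [hd]
  generalize f (cayley u) = fu
  field_simp

end

/-! ### Contour integrals for the weight matrices -/

namespace RKMethod

variable {m : ℕ} {M : RKMethod m}

/-- The power expansion of `f(Δ(ζ)/h)`, with contour integrals for the coefficients. -/
theorem Admissible.cqMatrix_hasSum (hM : M.Admissible) {f : ℂ → ℂ}
    (hf : ∀ z : ℂ, 0 < z.re → AnalyticAt ℂ f z) {h : ℝ} (hh : 0 < h) {ρ : ℝ}
    (h0 : 0 < ρ) (h1 : ρ < 1)
    (hunit : ∀ z : ℂ, ρ * ‖z + 1‖ ≤ ‖z - 1‖ →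
      IsUnit (M.invA - ((h : ℂ) * z) • (1 : Matrix (Fin (m + 1)) (Fin (m + 1)) ℂ))) :
    ∀ᶠ ζ in 𝓝 (0 : ℂ), IsMatrixFunction f ((h : ℂ)⁻¹ • M.symbol ζ) (M.cqMatrix f h ζ) ∧
      HasSum (fun n : ℕ => ζ ^ n • Matrix.of fun i j =>
        -(h : ℂ) * ∫ θ in (0 : ℝ)..2 * Real.pi, cayleyDensity ρ θ * (f (cayleyContour ρ θ) *
          M.resCoeff n (h * cayleyContour ρ θ) i j)) (M.cqMatrix f h ζ) := by
  set T : Set ℂ := {z | ρ * ‖z + 1‖ ≤ ‖z - 1‖} with hT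
  have hTc : IsClosed T := isClosed_le (by fun_prop) (by fun_prop)
  have hγT : ∀ θ, cayleyContour ρ θ ∈ T := fun θ => (norm_cayleyContour_sub_one h0 h1 θ).ge
  obtain ⟨C, hC, hres⟩ := exists_norm_res_le hh hTc hunit
  obtain ⟨C', hC', hstab⟩ := exists_norm_stab_le hres
  have hres' : ∀ z ∈ T, ∀ i j, ‖M.res (h * z) i j‖ ≤ C := fun z hz i j =>
    (hres z hz i j).trans (div_le_self hC.le (by linarith [norm_nonneg z]))
  have hstab' : ∀ z ∈ T, ‖M.stab (h * z)‖ ≤ C' * C := fun z hz =>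
    (hstab z hz).trans (mul_le_mul_of_nonneg_left
      (div_le_self hC.le (by linarith [norm_nonneg z])) hC')
  set P : ℝ := ∑ k, ∑ l, C * ‖M.rankOne l k‖ * C with hP
  have hP0 : 0 ≤ P := Finset.sum_nonneg fun k _ => Finset.sum_nonneg fun l _ => by positivity
  have hprod : ∀ z ∈ T, ∀ i j, ‖(M.res (h * z) * M.rankOne * M.res (h * z)) i j‖ ≤ P := by
    intro z hz i j
    rw [Matrix.mul_apply]
    refine (norm_sum_le _ _).trans (Finset.sum_le_sum fun k _ => ?_)
    rw [Matrix.mul_apply, Finset.sum_mul]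
    refine (norm_sum_le _ _).trans (Finset.sum_le_sum fun l _ => ?_)
    rw [norm_mul, norm_mul]
    gcongr
    · exact hres' z hz _ _
    · exact hres' z hz _ _
  -- This makes `‖ζ‖ ‖stab‖ ≤ 1 / 2` on all of `T`, so one geometric majorant serves the whole
  -- contour.
  have hsmall : ∀ᶠ ζ in 𝓝 (0 : ℂ), ‖ζ‖ < (2 * (C' * C + 1))⁻¹ ∧ ‖ζ‖ < 1 := by
    refine ((continuous_norm.tendsto (0 : ℂ)).eventually (gt_mem_nhds ?_)).and
      ((continuous_norm.tendsto (0 : ℂ)).eventually (gt_mem_nhds ?_))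
    · rw [norm_zero]; positivity
    · rw [norm_zero]; exact one_pos
  have hγc := continuous_cayleyContour h0 h1
  have hac := continuous_cayleyDensity h0 h1
  have hfγ : Continuous fun θ => f (cayleyContour ρ θ) :=
    continuous_iff_continuousAt.2 fun θ => ContinuousAt.comp
      (hf _ (re_cayleyContour_pos h0 h1 θ)).continuousAt hγc.continuousAt
  obtain ⟨B, hB⟩ : ∃ B, ∀ θ ∈ Set.uIcc 0 (2 * Real.pi),
      ‖cayleyDensity ρ θ * f (cayleyContour ρ θ)‖ ≤ B :=
    isCompact_uIcc.exists_bound_of_continuousOn (hac.mul hfγ).continuousOn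
  have hB0 : 0 ≤ B := (norm_nonneg _).trans (hB 0 left_mem_uIcc)
  filter_upwards [hsmall] with ζ ⟨hζ, hζ1⟩
  have hζne : ζ ≠ 1 := by rintro rfl; simp at hζ1
  have hhne : (h : ℂ) ≠ 0 := by exact_mod_cast hh.ne'
  have hhalf : ∀ z ∈ T, ‖ζ‖ * ‖M.stab (h * z)‖ ≤ 1 / 2 := by
    intro z hz
    have hpos : 0 < 2 * (C' * C + 1) := by positivity
    calc ‖ζ‖ * ‖M.stab (h * z)‖ ≤ (2 * (C' * C + 1))⁻¹ * (C' * C + 1) := by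
          gcongr
          exact (hstab' z hz).trans (by linarith)
      _ = 1 / 2 := by field_simp
  have hsum : ∀ z ∈ T, _ := fun z hz =>
    hM.resolvent_hasSum hζne (hunit z hz) ((hhalf z hz).trans_lt (by norm_num))
  -- Since `z - Δ/h = -h⁻¹ (Δ - h z)`, inversion yields the factor `-h` of the coefficients.
  have hinv : ∀ z ∈ T, (Matrix.scalar (Fin (m + 1)) z - (h : ℂ)⁻¹ • M.symbol ζ)⁻¹ =
      (-(h : ℂ)) • M.resolvent (h * z) ζ := by
    intro z hz
    refine Matrix.inv_eq_right_inv ?_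
    have hu := (hsum z hz).1
    have e1 : Matrix.scalar (Fin (m + 1)) z - (h : ℂ)⁻¹ • M.symbol ζ =
        (-(h : ℂ)⁻¹) • (M.symbol ζ - ((h : ℂ) * z) • 1) := by
      have e2 : Matrix.scalar (Fin (m + 1)) z = z • 1 := (Matrix.smul_one_eq_diagonal z).symm
      rw [smul_sub, smul_smul, neg_mul, inv_mul_cancel_left₀ hhne, e2]
      simp only [neg_smul]
      abel
    rw [e1, smul_mul_smul_comm, resolvent,
      Matrix.mul_nonsing_inv _ ((Matrix.isUnit_iff_isUnit_det _).1 hu)]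
    rw [neg_mul_neg, inv_mul_cancel₀ hhne, one_smul]
  have hVo : IsOpen {w : ℂ | ‖w - 1‖ < ρ * ‖w + 1‖} := isOpen_lt (by fun_prop) (by fun_prop)
  -- The resolvent exists outside the disc, so for these `ζ` no eigenvalue of `Δ(ζ)/h` has left it.
  have hspec : spectrum ℂ ((h : ℂ)⁻¹ • M.symbol ζ) ⊆ {w : ℂ | ‖w - 1‖ < ρ * ‖w + 1‖} := by
    intro w hw
    by_contra hn
    have hwT : w ∈ T := not_lt.1 (show ¬ (‖w - 1‖ < ρ * ‖w + 1‖) from hn)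
    refine (spectrum.mem_iff.1 hw) ?_
    have e1 : algebraMap ℂ (Matrix (Fin (m + 1)) (Fin (m + 1)) ℂ) w - (h : ℂ)⁻¹ • M.symbol ζ =
        (-(h : ℂ)⁻¹) • (M.symbol ζ - ((h : ℂ) * w) • 1) := by
      rw [smul_sub, smul_smul, neg_mul, inv_mul_cancel_left₀ hhne, Algebra.algebraMap_eq_smul_one]
      simp only [neg_smul]
      abel
    rw [e1]
    have hu := (hsum w hwT).1
    exact hu.smul (Units.mk0 (-(h : ℂ)⁻¹) (neg_ne_zero.2 (inv_ne_zero hhne)))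
  have hγV : ∀ θ, cayleyContour ρ θ ∉ {w : ℂ | ‖w - 1‖ < ρ * ‖w + 1‖} := fun θ hθ =>
    (lt_self_iff_false _).1 ((mem_ofPred.1 hθ).trans_le (hγT θ))
  have hmf := isMatrixFunction_of_cauchy (f := f) (M := (h : ℂ)⁻¹ • M.symbol ζ) hac hγc hfγ hVo
    hγV hspec
    (fun μ hμ => hf μ (re_pos_of_norm_sub_one_lt ((hspec hμ).trans_le
      (mul_le_of_le_one_left (norm_nonneg _) h1.le))))
    (fun w hw => integral_cayley_cauchy h0 h1 (fun z hz => (hf z hz).differentiableAt) hw)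
  have hcq := hmf.matrixFunction_eq
  have hcq' : M.cqMatrix f h ζ = _ := hcq
  rw [← hcq] at hmf
  refine ⟨hmf, ?_⟩
  rw [hcq']
  refine Pi.hasSum.2 fun i => Pi.hasSum.2 fun j => ?_
  simp only [Matrix.smul_apply, Matrix.of_apply, smul_eq_mul]
  -- `C` covers `n = 0`. For `n ≥ 1` only `n - 1` factors `stab` are present, and the `2` in `2 * P`
  -- makes up for the missing one half.
  have hterm : ∀ n θ, ‖ζ ^ n * M.resCoeff n (h * cayleyContour ρ θ) i j‖ ≤
      (C + 2 * P) * (1 / 2) ^ n := by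
    intro n θ
    set z := cayleyContour ρ θ
    rcases n with _ | n
    · simp only [resCoeff, pow_zero, one_mul, if_true, mul_one]
      exact (hres' z (hγT θ) i j).trans (by linarith)
    · simp only [resCoeff, Nat.succ_ne_zero, if_false, Nat.add_sub_cancel, Matrix.smul_apply,
        smul_eq_mul]
      rw [norm_mul, norm_mul, norm_pow, norm_pow, ← mul_assoc, pow_succ, mul_right_comm (‖ζ‖ ^ n),
        ← mul_pow]
      calc (‖ζ‖ * ‖M.stab (h * z)‖) ^ n * ‖ζ‖ * ‖(M.res (h * z) * M.rankOne * M.res (h * z)) i j‖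
          ≤ (1 / 2) ^ n * 1 * P := by
            gcongr
            · exact hhalf z (hγT θ)
            · exact hprod z (hγT θ) i j
        _ = (2 * P) * (1 / 2) ^ (n + 1) := by rw [pow_succ]; ring
        _ ≤ _ := by gcongr; linarith
  have hcont : ∀ n, Continuous fun θ => M.resCoeff n (h * cayleyContour ρ θ) i j := fun n =>
    continuous_iff_continuousAt.2 fun θ => ContinuousAt.comp
      (f := fun θ => (h : ℂ) * cayleyContour ρ θ) (x := θ)
      (differentiableAt_resCoeff (hunit _ (hγT θ)) n i j).continuousAt
      (continuous_const.mul hγc).continuousAt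
  have hgeom : Summable fun n : ℕ => ((1 : ℝ) / 2) ^ n :=
    summable_geometric_of_lt_one (by norm_num) (by norm_num)
  have key : HasSum (fun n : ℕ => ∫ θ in (0 : ℝ)..2 * Real.pi,
      (-(h : ℂ)) * (cayleyDensity ρ θ * f (cayleyContour ρ θ) *
        (ζ ^ n * M.resCoeff n (h * cayleyContour ρ θ) i j)))
      (∫ θ in (0 : ℝ)..2 * Real.pi, (-(h : ℂ)) * (cayleyDensity ρ θ * f (cayleyContour ρ θ) *
        M.resolvent (h * cayleyContour ρ θ) ζ i j)) := by
    refine intervalIntegral.hasSum_integral_of_dominated_convergence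
      (fun n _ => h * (B * ((C + 2 * P) * (1 / 2) ^ n))) ?_ ?_ ?_ ?_ ?_
    · intro n
      exact (continuous_const.mul ((hac.mul hfγ).mul
        (continuous_const.mul (hcont n)))).aestronglyMeasurable
    · intro n
      refine Eventually.of_forall fun θ hθ => ?_
      rw [norm_mul, norm_mul, norm_neg, Complex.norm_real, Real.norm_of_nonneg hh.le]
      gcongr
      · exact hB θ (uIoc_subset_uIcc hθ)
      · exact hterm n θ
    · exact Eventually.of_forall fun θ _ => ((hgeom.mul_left _).mul_left _).mul_left _
    · exact intervalIntegrable_const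
    · refine Eventually.of_forall fun θ _ => HasSum.mul_left _ (HasSum.mul_left _ ?_)
      exact Pi.hasSum.1 (Pi.hasSum.1 (hsum _ (hγT θ)).2 i) j
  convert key using 1
  · ext n
    rw [← intervalIntegral.integral_const_mul, ← intervalIntegral.integral_const_mul]
    refine intervalIntegral.integral_congr fun θ _ => ?_
    ring
  · refine intervalIntegral.integral_congr fun θ _ => ?_
    simp only [hinv _ (hγT θ), Matrix.smul_apply, smul_eq_mul]
    ring

theorem Admissible.W_eq (hM : M.Admissible) {f : ℂ → ℂ}
    (hf : ∀ z : ℂ, 0 < z.re → AnalyticAt ℂ f z) {h : ℝ} (hh : 0 < h) {ρ : ℝ}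
    (h0 : 0 < ρ) (h1 : ρ < 1)
    (hunit : ∀ z : ℂ, ρ * ‖z + 1‖ ≤ ‖z - 1‖ →
      IsUnit (M.invA - ((h : ℂ) * z) • (1 : Matrix (Fin (m + 1)) (Fin (m + 1)) ℂ))) :
    M.W f h = fun n => Matrix.of fun i j =>
      -(h : ℂ) * ∫ θ in (0 : ℝ)..2 * Real.pi, cayleyDensity ρ θ * (f (cayleyContour ρ θ) *
        M.resCoeff n (h * cayleyContour ρ θ) i j) :=
  powerCoeff_eq_of_hasSum ((hM.cqMatrix_hasSum hf hh h0 h1 hunit).mono fun _ h => h.2)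

end RKMethod


/-! ### Integrable majorants and Cauchy's theorem in a half-strip -/

/-- The majorant `(1 + t^{-1/2}) / (1 + t)²` of the integrands. -/
noncomputable def sqrtDecay (t : ℝ) : ℝ := (1 + t ^ (-(1 / 2) : ℝ)) / (1 + t) ^ 2

theorem sqrtDecay_nonneg {t : ℝ} (ht : 0 ≤ t) : 0 ≤ sqrtDecay t := by
  unfold sqrtDecay; positivity

theorem sqrtDecay_anti {s t : ℝ} (hs : 0 < s) (hst : s ≤ t) : sqrtDecay t ≤ sqrtDecay s := by
  unfold sqrtDecay
  have := Real.rpow_le_rpow_of_nonpos hs hst (by norm_num : (-(1 / 2) : ℝ) ≤ 0)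
  gcongr

theorem sqrtDecay_le {t : ℝ} (ht : 0 ≤ t) : sqrtDecay t ≤ 1 + t ^ (-(1 / 2) : ℝ) := by
  unfold sqrtDecay
  refine div_le_self (by positivity) ?_
  nlinarith

theorem intervalIntegrable_abs_rpow_neg_half (a b : ℝ) :
    IntervalIntegrable (fun x : ℝ => |x| ^ (-(1 / 2) : ℝ)) volume a b := by
  have h := (intervalIntegral.intervalIntegrable_cpow' (a := a) (b := b)
    (r := ((-(1 / 2) : ℝ) : ℂ)) (by rw [Complex.ofReal_re]; norm_num)).norm
  refine h.congr ?_
  intro x _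
  simp only [Complex.norm_cpow_real, Complex.norm_real, Real.norm_eq_abs]

theorem integrable_sqrtDecay : Integrable fun y : ℝ => sqrtDecay |y| := by
  have h1 : IntegrableOn (fun y : ℝ => |y| ^ (-(1 / 2) : ℝ)) (Ioc (-1) 1) :=
    (intervalIntegrable_iff_integrableOn_Ioc_of_le (by norm_num)).1
      (intervalIntegrable_abs_rpow_neg_half (-1) 1)
  -- The indicator term carries the singularity at `0`; for `|y| ≥ 1` the power is at most `1` and
  -- `2 / (1 + y²)` suffices.
  have h2 := (h1.integrable_indicator measurableSet_Ioc).add (integrable_inv_one_add_sq.const_mul 2)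
  refine h2.mono' ?_ (Eventually.of_forall fun y => ?_)
  · unfold sqrtDecay
    exact Measurable.aestronglyMeasurable (by fun_prop)
  · rw [Real.norm_of_nonneg (sqrtDecay_nonneg (abs_nonneg y))]
    simp only [Pi.add_apply]
    have hp : 0 ≤ |y| ^ (-(1 / 2) : ℝ) := Real.rpow_nonneg (abs_nonneg _) _
    have hle : (1 + y ^ 2) ≤ (1 + |y|) ^ 2 := by nlinarith [abs_nonneg y, sq_abs y]
    have h3 : 1 / (1 + |y|) ^ 2 ≤ (1 + y ^ 2)⁻¹ := by
      rw [one_div]; exact inv_anti₀ (by positivity) hle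
    unfold sqrtDecay
    rw [add_div]
    have h4 : 0 ≤ (1 + y ^ 2)⁻¹ := by positivity
    by_cases hy : y ∈ Ioc (-1 : ℝ) 1
    · rw [indicator_of_mem hy]
      have : |y| ^ (-(1 / 2) : ℝ) / (1 + |y|) ^ 2 ≤ |y| ^ (-(1 / 2) : ℝ) :=
        div_le_self hp (by nlinarith [abs_nonneg y])
      linarith
    · rw [indicator_of_notMem hy]
      have hy1 : 1 ≤ |y| := by
        by_contra! hlt
        exact hy ⟨(abs_lt.1 hlt).1, (abs_lt.1 hlt).2.le⟩
      have h5 : |y| ^ (-(1 / 2) : ℝ) ≤ 1 := Real.rpow_le_one_of_one_le_of_nonpos hy1 (by norm_num)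
      have : |y| ^ (-(1 / 2) : ℝ) / (1 + |y|) ^ 2 ≤ 1 / (1 + |y|) ^ 2 := by gcongr
      linarith

theorem tendsto_sqrtDecay : Tendsto sqrtDecay atTop (𝓝 0) := by
  have h1 : Tendsto (fun t : ℝ => (2 : ℝ) / t) atTop (𝓝 0) :=
    tendsto_const_nhds.div_atTop tendsto_id
  refine tendsto_of_tendsto_of_tendsto_of_le_of_le' tendsto_const_nhds h1 ?_ ?_
  · filter_upwards [eventually_ge_atTop 0] with t ht using sqrtDecay_nonneg ht
  · filter_upwards [eventually_ge_atTop 1] with t ht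
    have h5 : t ^ (-(1 / 2) : ℝ) ≤ 1 := Real.rpow_le_one_of_one_le_of_nonpos ht (by norm_num)
    unfold sqrtDecay
    rw [div_le_div_iff₀ (by positivity) (by positivity)]
    nlinarith

/-- The truncation is two-sided because the rectangles in the half-strip must be bounded and also
stay above the base. -/
theorem tendsto_integral_Ioc_Ioi {f : ℝ → ℂ} (hf : IntegrableOn f (Ioi 0)) :
    Tendsto (fun n : ℕ => ∫ y in (1 / ((n : ℝ) + 1))..((n : ℝ) + 1), f y) atTop
      (𝓝 (∫ y in Ioi 0, f y)) := by
  have hU : (⋃ n : ℕ, Ioc (1 / ((n : ℝ) + 1)) ((n : ℝ) + 1)) = Ioi 0 := by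
    ext y
    simp only [mem_iUnion, mem_Ioc, mem_Ioi]
    constructor
    · rintro ⟨n, h1, -⟩
      exact lt_trans (by positivity) h1
    · intro hy
      obtain ⟨n, hn⟩ := exists_nat_gt (max y (1 / y))
      refine ⟨n, ?_, ?_⟩
      · rw [div_lt_comm₀ (by positivity) hy]
        linarith [le_max_right y (1 / y)]
      · linarith [le_max_left y (1 / y)]
  have hmono : Monotone fun n : ℕ => Ioc (1 / ((n : ℝ) + 1)) ((n : ℝ) + 1) := by
    intro a b hab
    have : (a : ℝ) ≤ b := by exact_mod_cast hab
    refine Ioc_subset_Ioc ?_ (by linarith)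
    exact one_div_le_one_div_of_le (by positivity) (by linarith)
  have := tendsto_setIntegral_of_monotone (fun n : ℕ => measurableSet_Ioc) hmono
    (by rw [hU]; exact hf)
  rw [hU] at this
  refine this.congr fun n => (intervalIntegral.integral_of_le ?_).symm
  rw [div_le_iff₀ (by positivity)]
  nlinarith [(Nat.cast_nonneg n : (0 : ℝ) ≤ n)]

/-- Cauchy's theorem in a half-strip, for a function with integrable singularities on the base. -/
theorem integral_halfStrip {a b : ℝ} (hab : a < b) {G : ℂ → ℂ} {Gb : ℝ → ℂ} {ux uy : ℝ → ℝ}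
    (hG : ∀ x ∈ Icc a b, ∀ y : ℝ, 0 < y → DifferentiableAt ℂ G (x + y * Complex.I))
    (hGx : ∀ x ∈ Ioo a b, ∀ y : ℝ, 0 < y → ‖G (x + y * Complex.I)‖ ≤ ux x)
    (hux : IntervalIntegrable ux volume a b)
    (hGy : ∀ x ∈ Icc a b, ∀ y : ℝ, 0 < y → ‖G (x + y * Complex.I)‖ ≤ uy y)
    (huy : IntegrableOn uy (Ioi 0)) (huy0 : Tendsto uy atTop (𝓝 0))
    (hlim : ∀ x ∈ Ioo a b, Tendsto (fun y : ℝ => G (x + y * Complex.I)) (𝓝[>] 0) (𝓝 (Gb x))) :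
    Complex.I * ∫ y in Ioi (0 : ℝ), G (a + y * Complex.I) =
      Complex.I * (∫ y in Ioi (0 : ℝ), G (b + y * Complex.I)) + ∫ x in a..b, Gb x := by
  have hvert : ∀ x ∈ Icc a b, IntegrableOn (fun y : ℝ => G (x + y * Complex.I)) (Ioi 0) := by
    intro x hx
    refine Integrable.mono' huy ?_ ?_
    · refine ContinuousOn.aestronglyMeasurable (fun y hy => ?_) measurableSet_Ioi
      refine ContinuousAt.continuousWithinAt ?_
      exact ContinuousAt.comp (f := fun y : ℝ => (x : ℂ) + y * Complex.I)
        (hG x hx y hy).continuousAt (by fun_prop)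
    · rw [ae_restrict_iff' measurableSet_Ioi]
      exact Eventually.of_forall fun y hy => hGy x hx y hy
  have hεpos : ∀ n : ℕ, (0 : ℝ) < 1 / ((n : ℝ) + 1) := fun n => by positivity
  have hYpos : ∀ n : ℕ, (0 : ℝ) < (n : ℝ) + 1 := fun n => by positivity
  have hε0 : Tendsto (fun n : ℕ => 1 / ((n : ℝ) + 1)) atTop (𝓝[>] 0) :=
    tendsto_nhdsWithin_iff.2 ⟨tendsto_one_div_add_atTop_nhds_zero_nat,
      Eventually.of_forall hεpos⟩
  have hY : Tendsto (fun n : ℕ => (n : ℝ) + 1) atTop atTop :=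
    tendsto_atTop_add_const_right _ _ tendsto_natCast_atTop_atTop
  -- The bound `ux` and the boundary value are available only in the open interval: the singularity
  -- may sit at an endpoint.
  have hIoo : ∀ᵐ x : ℝ, x ∈ Ioc a b → x ∈ Ioo a b := by
    filter_upwards [Measure.ae_ne volume b] with x hx hx2
    exact ⟨hx2.1, lt_of_le_of_ne hx2.2 hx⟩
  have hbot : Tendsto (fun n : ℕ => ∫ x in a..b, G (x + (1 / ((n : ℝ) + 1) : ℝ) * Complex.I)) atTop
      (𝓝 (∫ x in a..b, Gb x)) := by
    refine intervalIntegral.tendsto_integral_filter_of_dominated_convergence ux ?_ ?_ hux ?_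
    · refine Eventually.of_forall fun n => ?_
      rw [uIoc_of_le hab.le]
      refine ContinuousOn.aestronglyMeasurable (fun x hx => ?_) measurableSet_Ioc
      refine ContinuousAt.continuousWithinAt ?_
      exact ContinuousAt.comp (f := fun x : ℝ => (x : ℂ) + (1 / ((n : ℝ) + 1) : ℝ) * Complex.I)
        (hG x ⟨hx.1.le, hx.2⟩ _ (hεpos n)).continuousAt (by fun_prop)
    · refine Eventually.of_forall fun n => ?_
      rw [uIoc_of_le hab.le]
      filter_upwards [hIoo] with x hx hx2 using hGx x (hx hx2) _ (hεpos n)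
    · rw [uIoc_of_le hab.le]
      filter_upwards [hIoo] with x hx hx2 using (hlim x (hx hx2)).comp hε0
  have htop : Tendsto (fun n : ℕ => ∫ x in a..b, G (x + (((n : ℝ) + 1 : ℝ) : ℂ) * Complex.I)) atTop
      (𝓝 0) := by
    have h1 : Tendsto (fun n : ℕ => uy ((n : ℝ) + 1) * |b - a|) atTop (𝓝 0) := by
      simpa using (huy0.comp hY).mul_const |b - a|
    refine squeeze_zero_norm (fun n => ?_) h1
    refine intervalIntegral.norm_integral_le_of_norm_le_const fun x hx => ?_
    rw [uIoc_of_le hab.le] at hx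
    exact hGy x ⟨hx.1.le, hx.2⟩ _ (hYpos n)
  have hrect : ∀ n : ℕ, ((∫ x in a..b, G (x + (1 / ((n : ℝ) + 1) : ℝ) * Complex.I)) -
      ∫ x in a..b, G (x + (((n : ℝ) + 1 : ℝ) : ℂ) * Complex.I)) +
      Complex.I • (∫ y in (1 / ((n : ℝ) + 1))..((n : ℝ) + 1), G (b + y * Complex.I)) -
      Complex.I • (∫ y in (1 / ((n : ℝ) + 1))..((n : ℝ) + 1), G (a + y * Complex.I)) = 0 := by
    intro n
    have hle : 1 / ((n : ℝ) + 1) ≤ (n : ℝ) + 1 := by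
      rw [div_le_iff₀ (by positivity)]
      nlinarith [(Nat.cast_nonneg n : (0 : ℝ) ≤ n)]
    refine Complex.integral_boundary_rect_eq_zero_of_differentiableOn G
      ⟨a, 1 / ((n : ℝ) + 1)⟩ ⟨b, (n : ℝ) + 1⟩ ?_
    intro z hz
    rw [Complex.mem_reProdIm] at hz
    simp only [uIcc_of_le hab.le, uIcc_of_le hle] at hz
    have := hG z.re hz.1 z.im ((hεpos n).trans_le hz.2.1)
    rw [Complex.re_add_im] at this
    exact this.differentiableWithinAt
  have hR := (tendsto_integral_Ioc_Ioi (hvert b (right_mem_Icc.2 hab.le))).const_smul Complex.I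
  have hL := (tendsto_integral_Ioc_Ioi (hvert a (left_mem_Icc.2 hab.le))).const_smul Complex.I
  have hall := ((hbot.sub htop).add hR).sub hL
  have h0 := tendsto_nhds_unique (hall.congr hrect) tendsto_const_nhds
  rw [sub_zero, smul_eq_mul, smul_eq_mul, sub_eq_zero] at h0
  rw [← h0, add_comm]

/-! ### Opening the circles onto the imaginary axis -/

/-- The point is uniformity in `ρ`: it controls the singularity at `z = 0 = cayley (-1)` while `ρ →
1`. Jordan's inequality reduces it to `sin² ((θ - π) / 2) = (1 + cos θ) / 2 ≤ 1 + 2ρ cos θ + ρ²`. -/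
theorem norm_one_add_circleMap {ρ : ℝ} (h0 : 0 < ρ) (h1 : ρ ≤ 1) {θ : ℝ}
    (hθ : θ ∈ Icc 0 (2 * Real.pi)) : |θ - Real.pi| / Real.pi ≤ ‖1 + circleMap 0 ρ θ‖ := by
  have hpi := Real.pi_pos
  have h2 : |(θ - Real.pi) / 2| ≤ Real.pi / 2 := by
    rw [abs_le]; constructor <;> linarith [hθ.1, hθ.2]
  have h3 := Real.mul_abs_le_abs_sin h2
  have h4 : 2 / Real.pi * |(θ - Real.pi) / 2| = |θ - Real.pi| / Real.pi := by
    rw [abs_div, abs_two]; field_simp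
  rw [h4] at h3
  refine h3.trans ?_
  rw [← abs_of_nonneg (norm_nonneg (1 + circleMap 0 ρ θ)), ← sq_le_sq, ← Complex.normSq_eq_norm_sq]
  have h5 : Real.sin ((θ - Real.pi) / 2) ^ 2 = (1 + Real.cos θ) / 2 := by
    have e : (θ - Real.pi) / 2 = θ / 2 - Real.pi / 2 := by ring
    rw [e, Real.sin_sub_pi_div_two, neg_sq, Real.cos_sq]
    ring_nf
  rw [h5, Complex.normSq_apply]
  have hre : (1 + circleMap 0 ρ θ).re = 1 + ρ * Real.cos θ := by
    simp [circleMap, Complex.exp_ofReal_mul_I_re]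
  have him : (1 + circleMap 0 ρ θ).im = ρ * Real.sin θ := by
    simp [circleMap, Complex.exp_ofReal_mul_I_im]
  rw [hre, him]
  have h6 := Real.sin_sq_add_cos_sq θ
  have h7 := Real.neg_one_le_cos θ
  have h8 := Real.cos_le_one θ
  have e1 : (1 + ρ * Real.cos θ) * (1 + ρ * Real.cos θ) + ρ * Real.sin θ * (ρ * Real.sin θ) =
      1 + 2 * ρ * Real.cos θ + ρ ^ 2 := by
    have : Real.sin θ ^ 2 = 1 - Real.cos θ ^ 2 := by linarith
    linear_combination ρ ^ 2 * this
  rw [e1]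
  by_cases hc : 0 ≤ Real.cos θ
  · nlinarith [mul_nonneg h0.le hc]
  -- With `c = cos θ < 0`, use `1 + 2ρc + ρ² = (ρ + c)² + (1 - c)(1 + c)`.
  · nlinarith [sq_nonneg (ρ + Real.cos θ)]

/-- Here `dz = 2 du / (1 - u)²` and `z + 1 = 2 / (1 - u)`, so the density is at most of size `‖z +
1‖²`. The bound cancels the denominator of `sqrtDecay` and leaves `1 + ‖z‖^(-1/2)`. -/
theorem norm_cayleyDensity {ρ : ℝ} (h0 : 0 < ρ) (h1 : ρ < 1) (θ : ℝ) :
    ‖cayleyDensity ρ θ‖ ≤ (1 + ‖cayleyContour ρ θ‖) ^ 2 := by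
  have hne := one_sub_circleMap_ne_zero h0 h1 θ
  have hpos := norm_pos_iff.2 hne
  have hγ : ‖cayleyContour ρ θ + 1‖ = 2 / ‖1 - circleMap 0 ρ θ‖ := by
    rw [cayleyContour, cayley_add_one hne, norm_div]; simp
  have hle : 2 / ‖1 - circleMap 0 ρ θ‖ ≤ 1 + ‖cayleyContour ρ θ‖ := by
    rw [← hγ, add_comm]; exact (norm_add_le _ _).trans (by simp)
  have hpi : (1 : ℝ) ≤ Real.pi := by linarith [Real.pi_gt_three]
  have e : ‖cayleyDensity ρ θ‖ = (2 * Real.pi)⁻¹ * (2 / ‖1 - circleMap 0 ρ θ‖ ^ 2 * ρ) := by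
    rw [cayleyDensity]
    simp only [norm_mul, norm_inv, norm_div, norm_pow, Complex.norm_I, Complex.norm_real,
      mul_one, Real.norm_of_nonneg Real.pi_pos.le, norm_circleMap_zero_of_pos h0]
    simp
  rw [e]
  calc (2 * Real.pi)⁻¹ * (2 / ‖1 - circleMap 0 ρ θ‖ ^ 2 * ρ)
      ≤ 1 * (2 / ‖1 - circleMap 0 ρ θ‖ ^ 2 * 1) := by
        gcongr
        exact inv_le_one_of_one_le₀ (by linarith)
    _ ≤ (2 / ‖1 - circleMap 0 ρ θ‖) ^ 2 := by
        rw [one_mul, mul_one, div_pow]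
        gcongr
        norm_num
    _ ≤ _ := by gcongr

theorem continuousAt_circleMap_radius (θ : ℝ) : ContinuousAt (fun ρ : ℝ => circleMap 0 ρ θ) 1 := by
  unfold circleMap
  fun_prop

theorem circleMap_one_ne_one {θ : ℝ} (hθ : θ ∈ Ioo 0 (2 * Real.pi)) : circleMap 0 1 θ ≠ 1 := by
  intro h
  have h1 : Real.cos θ = 1 := by
    have := congrArg Complex.re h
    simpa [circleMap, Complex.exp_ofReal_mul_I_re] using this
  rw [Real.cos_eq_one_iff_of_lt_of_lt (by linarith [hθ.1, Real.pi_pos]) hθ.2] at h1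
  exact ne_of_gt hθ.1 h1

/-- The integrals along the circles of Apollonius converge to the integral along the imaginary
axis, in the parametrization by the unit circle. -/
theorem tendsto_integral_cayley {g : ℂ → ℂ} {ρ₀ C : ℝ} (h0 : 0 < ρ₀) (h1 : ρ₀ < 1)
    (hgc : ∀ z : ℂ, 0 ≤ z.re → z ≠ 0 → ρ₀ * ‖z + 1‖ ≤ ‖z - 1‖ → ContinuousAt g z)
    (hgb : ∀ z : ℂ, 0 ≤ z.re → z ≠ 0 → ρ₀ * ‖z + 1‖ ≤ ‖z - 1‖ → ‖g z‖ ≤ C * sqrtDecay ‖z‖)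
    (hC : 0 ≤ C) :
    Tendsto (fun ρ => ∫ θ in (0 : ℝ)..2 * Real.pi, cayleyDensity ρ θ * g (cayleyContour ρ θ))
      (𝓝[<] 1) (𝓝 (∫ θ in (0 : ℝ)..2 * Real.pi, cayleyDensity 1 θ * g (cayleyContour 1 θ))) := by
  have hpi := Real.pi_pos
  have hρ : ∀ᶠ ρ in 𝓝[<] (1 : ℝ), ρ ∈ Ioo ρ₀ 1 := Ioo_mem_nhdsLT h1
  have hT : ∀ ρ ∈ Ioo ρ₀ 1, ∀ θ,
      0 < (cayleyContour ρ θ).re ∧ ρ₀ * ‖cayleyContour ρ θ + 1‖ ≤ ‖cayleyContour ρ θ - 1‖ :=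
    fun ρ hρ θ => ⟨re_cayleyContour_pos (h0.trans hρ.1) hρ.2 θ, by
      rw [norm_cayleyContour_sub_one (h0.trans hρ.1) hρ.2]
      gcongr
      exact hρ.1.le⟩
  have hne0 : ∀ z : ℂ, 0 < z.re → z ≠ 0 := by rintro z hz rfl; simp at hz
  have hae : ∀ᵐ θ : ℝ, θ ∈ uIoc 0 (2 * Real.pi) → θ ∈ Ioo 0 (2 * Real.pi) ∧ θ ≠ Real.pi := by
    filter_upwards [Measure.ae_ne volume (2 * Real.pi), Measure.ae_ne volume Real.pi]
      with θ hθ1 hθ2 hθ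
    rw [uIoc_of_le (by positivity)] at hθ
    exact ⟨⟨hθ.1, lt_of_le_of_ne hθ.2 hθ1⟩, hθ2⟩
  refine intervalIntegral.tendsto_integral_filter_of_dominated_convergence
    (fun θ => C * (1 + |θ - Real.pi| ^ (-(1 / 2) : ℝ) / (2 * Real.pi) ^ (-(1 / 2) : ℝ)))
      ?_ ?_ ?_ ?_
  · filter_upwards [hρ] with ρ hρ
    have hγc := continuous_cayleyContour (h0.trans hρ.1) hρ.2
    have hac := continuous_cayleyDensity (h0.trans hρ.1) hρ.2
    refine Continuous.aestronglyMeasurable (hac.mul (continuous_iff_continuousAt.2 fun θ => ?_))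
    obtain ⟨h2, h3⟩ := hT ρ hρ θ
    exact ContinuousAt.comp (hgc _ h2.le (hne0 _ h2) h3) hγc.continuousAt
  · filter_upwards [hρ] with ρ hρ
    filter_upwards [hae] with θ hθ hθ2
    obtain ⟨hθ3, hθ4⟩ := hθ hθ2
    obtain ⟨h2, h3⟩ := hT ρ hρ θ
    have hb := hgb _ h2.le (hne0 _ h2) h3
    have hz0 : 0 < ‖cayleyContour ρ θ‖ := norm_pos_iff.2 (hne0 _ h2)
    have hlow : |θ - Real.pi| / (2 * Real.pi) ≤ ‖cayleyContour ρ θ‖ := by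
      rw [cayleyContour, cayley, norm_div, le_div_iff₀ (norm_pos_iff.2
        (one_sub_circleMap_ne_zero (h0.trans hρ.1) hρ.2 θ))]
      have h4 : ‖1 - circleMap 0 ρ θ‖ ≤ 2 := (norm_sub_le _ _).trans (by
        rw [norm_circleMap_zero_of_pos (h0.trans hρ.1), norm_one]; linarith [hρ.2])
      calc |θ - Real.pi| / (2 * Real.pi) * ‖1 - circleMap 0 ρ θ‖
          ≤ |θ - Real.pi| / (2 * Real.pi) * 2 := by gcongr
        _ = |θ - Real.pi| / Real.pi := by field_simp
        _ ≤ _ := norm_one_add_circleMap (h0.trans hρ.1) hρ.2.le ⟨hθ3.1.le, hθ3.2.le⟩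
    have habs : 0 < |θ - Real.pi| := abs_pos.2 (sub_ne_zero.2 hθ4)
    have hr := Real.rpow_le_rpow_of_nonpos (div_pos habs (by positivity)) hlow
      (by norm_num : (-(1 / 2) : ℝ) ≤ 0)
    rw [Real.div_rpow (abs_nonneg _) (by positivity)] at hr
    rw [norm_mul]
    calc ‖cayleyDensity ρ θ‖ * ‖g (cayleyContour ρ θ)‖
        ≤ (1 + ‖cayleyContour ρ θ‖) ^ 2 * (C * sqrtDecay ‖cayleyContour ρ θ‖) := by
          gcongr
          exact norm_cayleyDensity (h0.trans hρ.1) hρ.2 θ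
      _ = C * (1 + ‖cayleyContour ρ θ‖ ^ (-(1 / 2) : ℝ)) := by
          unfold sqrtDecay
          field_simp
      _ ≤ _ := by gcongr
  · refine IntervalIntegrable.const_mul ?_ _
    refine IntervalIntegrable.add intervalIntegrable_const (IntervalIntegrable.div_const ?_ _)
    have := (intervalIntegrable_abs_rpow_neg_half (0 - Real.pi) (2 * Real.pi - Real.pi)).comp_sub_right
      Real.pi
    simpa using this
  · filter_upwards [hae] with θ hθ hθ2
    obtain ⟨hθ3, hθ4⟩ := hθ hθ2
    have hu := continuousAt_circleMap_radius θ
    have hu1 := sub_ne_zero.2 (circleMap_one_ne_one hθ3).symm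
    have hun : ‖circleMap 0 1 θ‖ = 1 := norm_circleMap_zero_of_pos one_pos θ
    have hγ : ContinuousAt (fun ρ => cayleyContour ρ θ) 1 :=
      (continuousAt_const.add hu).div (continuousAt_const.sub hu) hu1
    have ha : ContinuousAt (fun ρ => cayleyDensity ρ θ) 1 :=
      continuousAt_const.mul ((continuousAt_const.div ((continuousAt_const.sub hu).pow 2)
        (pow_ne_zero 2 hu1)).mul (hu.mul continuousAt_const))
    -- On the unit circle the image is equidistant from `1` and `-1`, hence on the imaginary axis,
    -- where `g` is still continuous away from `0`.
    have hnorm : ‖cayleyContour 1 θ - 1‖ = ‖cayleyContour 1 θ + 1‖ := by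
      rw [cayleyContour, norm_cayley_sub_one hu1, hun, one_mul]
    have hre : 0 ≤ (cayleyContour 1 θ).re := by
      by_contra! hlt
      have := RKMethod.norm_sub_one_lt_norm_add_one (z := -cayleyContour 1 θ) (by simpa using hlt)
      rw [← norm_neg, neg_sub, sub_neg_eq_add, ← norm_neg (-cayleyContour 1 θ + 1), neg_add,
        neg_neg, ← sub_eq_add_neg, hnorm, add_comm] at this
      exact lt_irrefl _ this
    have hz : cayleyContour 1 θ ≠ 0 := by
      have h5 := norm_one_add_circleMap one_pos le_rfl (θ := θ) ⟨hθ3.1.le, hθ3.2.le⟩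
      have habs : 0 < |θ - Real.pi| / Real.pi := div_pos (abs_pos.2 (sub_ne_zero.2 hθ4)) hpi
      exact div_ne_zero (norm_pos_iff.1 (habs.trans_le h5)) hu1
    have hg := hgc _ hre hz (by
      rw [hnorm]; exact mul_le_of_le_one_left (norm_nonneg _) h1.le)
    have hcomp : ContinuousAt (fun ρ => g (cayleyContour ρ θ)) 1 :=
      ContinuousAt.comp (f := fun ρ => cayleyContour ρ θ) hg hγ
    exact (ha.mul hcomp).tendsto.mono_left nhdsWithin_le_nhds

/-- The half-angle substitution `θ = 2t + π` gives `u = -e^{2it}` and `z = -i tan t`, so `y = tan t`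
runs over the line. The factor `-i` records that a counterclockwise contour in the right half-plane
descends along the imaginary axis. -/
theorem integral_cayley_one (g : ℂ → ℂ) :
    ∫ θ in (0 : ℝ)..2 * Real.pi, cayleyDensity 1 θ * g (cayleyContour 1 θ) =
      (2 * (Real.pi : ℂ) * Complex.I)⁻¹ *
        (-Complex.I * ∫ y : ℝ, g (-(Complex.I * (y : ℂ)))) := by
  have hpi := Real.pi_pos
  have h1 := intervalIntegral.integral_comp_mul_add (a := -(Real.pi / 2)) (b := Real.pi / 2)
    (fun θ => cayleyDensity 1 θ * g (cayleyContour 1 θ)) (two_ne_zero (α := ℝ)) Real.pi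
  have e1 : 2 * -(Real.pi / 2) + Real.pi = 0 := by ring
  have e2 : 2 * (Real.pi / 2) + Real.pi = 2 * Real.pi := by ring
  rw [e1, e2] at h1
  have h2 : ∫ θ in (0 : ℝ)..2 * Real.pi, cayleyDensity 1 θ * g (cayleyContour 1 θ) =
      (2 : ℝ) • ∫ t in (-(Real.pi / 2))..(Real.pi / 2),
        cayleyDensity 1 (2 * t + Real.pi) * g (cayleyContour 1 (2 * t + Real.pi)) := by
    rw [h1, smul_smul, mul_inv_cancel₀ two_ne_zero, one_smul]
  have h3 := integral_image_eq_integral_abs_deriv_smul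
    (measurableSet_Ioo (a := -(Real.pi / 2)) (b := Real.pi / 2))
    (fun x hx => (Real.hasDerivAt_tan (Real.cos_pos_of_mem_Ioo hx).ne').hasDerivWithinAt)
    Real.injOn_tan (fun y : ℝ => g (-(Complex.I * (y : ℂ))))
  rw [Real.image_tan_Ioo, Measure.restrict_univ] at h3
  rw [h2, h3, intervalIntegral.integral_of_le (by linarith), integral_Ioc_eq_integral_Ioo,
    Complex.real_smul, ← integral_const_mul, ← integral_const_mul, ← integral_const_mul]
  refine setIntegral_congr_fun measurableSet_Ioo fun t ht => ?_
  have hc : Complex.cos (t : ℂ) ≠ 0 := by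
    rw [← Complex.ofReal_cos]; exact_mod_cast (Real.cos_pos_of_mem_Ioo ht).ne'
  have hexp : Complex.exp (t * Complex.I) ≠ 0 := Complex.exp_ne_zero _
  have hu : circleMap 0 1 (2 * t + Real.pi) = -(Complex.exp (t * Complex.I)) ^ 2 := by
    rw [circleMap, ← Complex.exp_nat_mul]
    push_cast
    rw [add_mul, Complex.exp_add, Complex.exp_pi_mul_I]
    ring_nf
  have hcos : 1 + (Complex.exp (t * Complex.I)) ^ 2 =
      2 * Complex.cos t * Complex.exp (t * Complex.I) := by
    rw [Complex.cos, neg_mul, Complex.exp_neg]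
    field_simp
    ring
  have hsin : 1 - (Complex.exp (t * Complex.I)) ^ 2 =
      -(2 * Complex.I * Complex.sin t * Complex.exp (t * Complex.I)) := by
    rw [Complex.sin, neg_mul, Complex.exp_neg]
    field_simp
    rw [Complex.I_sq]
    ring
  have hγ : cayleyContour 1 (2 * t + Real.pi) = -(Complex.I * ((Real.tan t : ℝ) : ℂ)) := by
    rw [cayleyContour, cayley, hu, sub_neg_eq_add, hcos, ← sub_eq_add_neg, hsin, Complex.ofReal_tan,
      Complex.tan]
    field_simp
  have ha : cayleyDensity 1 (2 * t + Real.pi) =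
      (2 * (Real.pi : ℂ) * Complex.I)⁻¹ * (-Complex.I / (2 * Complex.cos t ^ 2)) := by
    rw [cayleyDensity, hu, sub_neg_eq_add, hcos]
    congr 1
    field_simp
  rw [hγ, ha, abs_of_pos (by have := Real.cos_pos_of_mem_Ioo ht; positivity), Complex.real_smul]
  push_cast
  field_simp


/-! ### The principal square root and its boundary values on the cut -/

theorem cpow_half_sq (z : ℂ) : (z ^ (1 / 2 : ℂ)) ^ 2 = z := by
  have := Complex.cpow_nat_inv_pow z (n := 2) two_ne_zero
  rwa [Nat.cast_ofNat, ← one_div] at this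

theorem re_cpow_half_nonneg (z : ℂ) : 0 ≤ (z ^ (1 / 2 : ℂ)).re := by
  rw [one_div, Complex.cpow_inv_two_re]
  exact Real.sqrt_nonneg _

theorem cpow_half_ne_zero {z : ℂ} (hz : z ≠ 0) : z ^ (1 / 2 : ℂ) ≠ 0 := by
  intro h
  have := cpow_half_sq z
  rw [h] at this
  simp at this
  exact hz this.symm

theorem inv_norm_cpow_half (z : ℂ) : ‖z ^ (1 / 2 : ℂ)‖⁻¹ = ‖z‖ ^ (-(1 / 2) : ℝ) := by
  have : (1 / 2 : ℂ) = ((1 / 2 : ℝ) : ℂ) := by push_cast; rfl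
  rw [this, Complex.norm_cpow_real, Real.rpow_neg (norm_nonneg _)]

theorem exp_half_log_add {lam : ℝ} (hlam : 0 < lam) (θ : ℝ) :
    Complex.exp (((Real.log lam : ℂ) + (θ : ℂ) * Complex.I) * (1 / 2 : ℂ)) =
      (Real.sqrt lam : ℂ) * Complex.exp ((θ / 2 : ℂ) * Complex.I) := by
  rw [Real.sqrt_eq_rpow, Real.rpow_def_of_pos hlam]
  push_cast
  rw [← Complex.exp_add]
  congr 1
  ring

theorem tendsto_cpow_half_upper {lam : ℝ} (hlam : 0 < lam) :
    Tendsto (fun y : ℝ => (((-lam : ℝ) : ℂ) + y * Complex.I) ^ (1 / 2 : ℂ)) (𝓝[>] 0)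
      (𝓝 ((Real.sqrt lam : ℂ) * Complex.exp ((Real.pi / 2 : ℂ) * Complex.I))) := by
  have hc : Continuous fun y : ℝ => ((-lam : ℝ) : ℂ) + y * Complex.I := by fun_prop
  have hp : Tendsto (fun y : ℝ => ((-lam : ℝ) : ℂ) + y * Complex.I) (𝓝[>] 0)
      (𝓝[{z : ℂ | 0 ≤ z.im}] ((-lam : ℝ) : ℂ)) := by
    refine tendsto_nhdsWithin_iff.2 ⟨?_, ?_⟩
    · have := hc.tendsto 0
      simp only [Complex.ofReal_zero, zero_mul, add_zero] at this
      exact this.mono_left nhdsWithin_le_nhds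
    · filter_upwards [self_mem_nhdsWithin] with y hy
      simpa using (mem_Ioi.1 hy).le
  have hl := (Complex.continuousWithinAt_log_of_re_neg_of_im_zero (z := ((-lam : ℝ) : ℂ))
    (by simpa using hlam) (by simp)).tendsto.comp hp
  have hlog : Complex.log ((-lam : ℝ) : ℂ) = (Real.log lam : ℂ) + (Real.pi : ℂ) * Complex.I := by
    rw [Complex.log, Complex.arg_ofReal_of_neg (by linarith), Complex.norm_real, norm_neg,
      Real.norm_of_nonneg hlam.le]
  rw [hlog] at hl
  rw [← exp_half_log_add hlam]
  refine ((Complex.continuous_exp.tendsto _).comp (hl.mul_const (1 / 2 : ℂ))).congr' ?_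
  filter_upwards [self_mem_nhdsWithin] with y hy
  have hne : ((-lam : ℝ) : ℂ) + y * Complex.I ≠ 0 := by
    intro h
    have := congrArg Complex.re h
    simp at this
    exact hlam.ne' this
  simp only [Function.comp_apply, Complex.cpow_def_of_ne_zero hne]

/-- On the negative axis the principal logarithm takes its limit from above. From below the argument
tends to `-π` instead, so the two limits of the square root are opposite points of the imaginary
axis. -/
theorem tendsto_cpow_half_lower {lam : ℝ} (hlam : 0 < lam) :
    Tendsto (fun y : ℝ => (((-lam : ℝ) : ℂ) - y * Complex.I) ^ (1 / 2 : ℂ)) (𝓝[>] 0)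
      (𝓝 ((Real.sqrt lam : ℂ) * Complex.exp (((-Real.pi : ℝ) / 2 : ℂ) * Complex.I))) := by
  have hc : Continuous fun y : ℝ => ((-lam : ℝ) : ℂ) - y * Complex.I := by fun_prop
  have hp : Tendsto (fun y : ℝ => ((-lam : ℝ) : ℂ) - y * Complex.I) (𝓝[>] 0)
      (𝓝[{z : ℂ | z.im < 0}] ((-lam : ℝ) : ℂ)) := by
    refine tendsto_nhdsWithin_iff.2 ⟨?_, ?_⟩
    · have := hc.tendsto 0
      simp only [Complex.ofReal_zero, zero_mul, sub_zero] at this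
      exact this.mono_left nhdsWithin_le_nhds
    · filter_upwards [self_mem_nhdsWithin] with y hy
      simpa using mem_Ioi.1 hy
  have hl := (Complex.tendsto_log_nhdsWithin_im_neg_of_re_neg_of_im_zero (z := ((-lam : ℝ) : ℂ))
    (by simpa using hlam) (by simp)).comp hp
  have hlog : (Real.log ‖((-lam : ℝ) : ℂ)‖ : ℂ) - (Real.pi : ℂ) * Complex.I =
      (Real.log lam : ℂ) + ((-Real.pi : ℝ) : ℂ) * Complex.I := by
    rw [Complex.norm_real, norm_neg, Real.norm_of_nonneg hlam.le]
    push_cast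
    ring
  rw [hlog] at hl
  rw [← exp_half_log_add hlam]
  refine ((Complex.continuous_exp.tendsto _).comp (hl.mul_const (1 / 2 : ℂ))).congr' ?_
  filter_upwards [self_mem_nhdsWithin] with y hy
  have hne : ((-lam : ℝ) : ℂ) - y * Complex.I ≠ 0 := by
    intro h
    have := congrArg Complex.re h
    simp at this
    exact hlam.ne' this
  simp only [Function.comp_apply, Complex.cpow_def_of_ne_zero hne]

/-- A point of the imaginary axis, as the boundary value of the square root. -/
theorem sqrt_mul_exp_pi_half (lam : ℝ) :
    (Real.sqrt lam : ℂ) * Complex.exp ((Real.pi / 2 : ℂ) * Complex.I) =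
      (Real.sqrt lam : ℂ) * Complex.I := by
  rw [Complex.exp_pi_div_two_mul_I]

theorem sqrt_mul_exp_neg_pi_half (lam : ℝ) :
    (Real.sqrt lam : ℂ) * Complex.exp (((-Real.pi : ℝ) / 2 : ℂ) * Complex.I) =
      -((Real.sqrt lam : ℂ) * Complex.I) := by
  have : ((-Real.pi : ℝ) / 2 : ℂ) * Complex.I = -(Real.pi / 2 * Complex.I) := by push_cast; ring
  rw [this, Complex.exp_neg, Complex.exp_pi_div_two_mul_I, Complex.inv_I]
  ring

/-! ### Deformation of the contour onto the cut -/

section Slit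

variable {k q : ℂ → ℂ} {ρ₀ ξ C C' : ℝ}

/-- The kernel is treated as `k ∘ √`: both sides of the cut become points `±i√λ` of the closed
half-plane `Re s ≥ 0`, where `k` is a single regular function apart from `s = 0`. Its singularity
`‖s‖⁻¹` turns into the integrable `‖z‖^(-1/2)`. -/
theorem norm_mul_le_sqrtDecay (hC : 0 ≤ C)
    (hkb : ∀ s : ℂ, 0 ≤ s.re → s ≠ 0 → -ξ ≤ (s ^ 2).re → ‖k s‖ ≤ C * (1 + ‖s‖⁻¹))
    {z : ℂ} (hz0 : z ≠ 0) (hz : -ξ ≤ z.re) (hq : ‖q z‖ ≤ C' / (1 + ‖z‖) ^ 2) :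
    ‖k (z ^ (1 / 2 : ℂ)) * q z‖ ≤ C * C' * sqrtDecay ‖z‖ := by
  have h1 := hkb (z ^ (1 / 2 : ℂ)) (re_cpow_half_nonneg z) (cpow_half_ne_zero hz0)
    (by rwa [cpow_half_sq])
  rw [inv_norm_cpow_half] at h1
  rw [norm_mul]
  calc _ ≤ (C * (1 + ‖z‖ ^ (-(1 / 2) : ℝ))) * (C' / (1 + ‖z‖) ^ 2) := by gcongr
    _ = _ := by unfold sqrtDecay; ring

theorem differentiableAt_mul_of_mem_slitPlane
    (hk : ∀ s : ℂ, 0 ≤ s.re → s ≠ 0 → DifferentiableAt ℂ k s)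
    {z : ℂ} (hz : z ∈ Complex.slitPlane) (hq : DifferentiableAt ℂ q z) :
    DifferentiableAt ℂ (fun z => k (z ^ (1 / 2 : ℂ)) * q z) z := by
  refine DifferentiableAt.mul ?_ hq
  have hs : DifferentiableAt ℂ (fun z : ℂ => z ^ (1 / 2 : ℂ)) z :=
    differentiableAt_id.cpow_const hz
  exact DifferentiableAt.comp (f := fun z : ℂ => z ^ (1 / 2 : ℂ)) z
    (hk _ (re_cpow_half_nonneg z) (cpow_half_ne_zero (Complex.slitPlane_ne_zero hz))) hs

theorem apollonius_of_re_nonpos {ρ : ℝ} (h1 : ρ < 1) {z : ℂ} (hz : z.re ≤ 0) :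
    ρ * ‖z + 1‖ ≤ ‖z - 1‖ := by
  have h2 : ‖z + 1‖ ≤ ‖z - 1‖ := by
    by_contra! h
    exact absurd (RKMethod.re_pos_of_norm_sub_one_lt h) (not_lt.2 hz)
  nlinarith [norm_nonneg (z + 1)]

theorem integrableOn_vertical {G : ℂ → ℂ} {x B σ : ℝ} (hB : 0 ≤ B) (hσ : |σ| = 1)
    (hG : ∀ y : ℝ, 0 < y → ContinuousAt G ((x : ℂ) + Complex.I * ((σ * y : ℝ) : ℂ)))
    (hGb : ∀ y : ℝ, 0 < y → ‖G ((x : ℂ) + Complex.I * ((σ * y : ℝ) : ℂ))‖ ≤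
      B * sqrtDecay ‖(x : ℂ) + Complex.I * ((σ * y : ℝ) : ℂ)‖) :
    IntegrableOn (fun y : ℝ => G ((x : ℂ) + Complex.I * ((σ * y : ℝ) : ℂ))) (Ioi 0) := by
  refine Integrable.mono' (integrable_sqrtDecay.integrableOn.const_mul B) ?_ ?_
  · refine ContinuousOn.aestronglyMeasurable (fun y hy => ?_) measurableSet_Ioi
    refine ContinuousAt.continuousWithinAt ?_
    exact ContinuousAt.comp (f := fun y : ℝ => (x : ℂ) + Complex.I * ((σ * y : ℝ) : ℂ))
      (hG y hy) (by fun_prop)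
  · rw [ae_restrict_iff' measurableSet_Ioi]
    refine Eventually.of_forall fun y hy => (hGb y hy).trans ?_
    refine mul_le_mul_of_nonneg_left (sqrtDecay_anti (abs_pos.2 (ne_of_gt hy)) ?_) hB
    have h1 := Complex.abs_im_le_norm ((x : ℂ) + Complex.I * ((σ * y : ℝ) : ℂ))
    have h2 : ((x : ℂ) + Complex.I * ((σ * y : ℝ) : ℂ)).im = σ * y := by simp
    rwa [h2, abs_mul, hσ, one_mul] at h1

theorem integrableOn_slit_vertical (hρ1 : ρ₀ < 1) (hC : 0 ≤ C) (hC' : 0 ≤ C')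
    (hk : ∀ s : ℂ, 0 ≤ s.re → s ≠ 0 → DifferentiableAt ℂ k s)
    (hkb : ∀ s : ℂ, 0 ≤ s.re → s ≠ 0 → -ξ ≤ (s ^ 2).re → ‖k s‖ ≤ C * (1 + ‖s‖⁻¹))
    (hq : ∀ z : ℂ, ρ₀ * ‖z + 1‖ ≤ ‖z - 1‖ → DifferentiableAt ℂ q z)
    (hqb : ∀ z : ℂ, ρ₀ * ‖z + 1‖ ≤ ‖z - 1‖ → ‖q z‖ ≤ C' / (1 + ‖z‖) ^ 2)
    {x σ : ℝ} (hx : x ∈ Icc (-ξ) 0) (hσ : |σ| = 1) :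
    IntegrableOn (fun y : ℝ => k (((x : ℂ) + Complex.I * ((σ * y : ℝ) : ℂ)) ^ (1 / 2 : ℂ)) *
      q ((x : ℂ) + Complex.I * ((σ * y : ℝ) : ℂ))) (Ioi 0) := by
  have hre : ∀ y : ℝ, ((x : ℂ) + Complex.I * ((σ * y : ℝ) : ℂ)).re = x := fun y => by simp
  have him : ∀ y : ℝ, ((x : ℂ) + Complex.I * ((σ * y : ℝ) : ℂ)).im = σ * y := fun y => by simp
  have hslit : ∀ y : ℝ, 0 < y → (x : ℂ) + Complex.I * ((σ * y : ℝ) : ℂ) ∈ Complex.slitPlane := by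
    intro y hy
    right
    rw [him]
    exact mul_ne_zero (by rintro rfl; simp at hσ) hy.ne'
  refine integrableOn_vertical (G := fun z => k (z ^ (1 / 2 : ℂ)) * q z) (mul_nonneg hC hC') hσ
    (fun y hy => ?_) (fun y hy => ?_)
  · refine (differentiableAt_mul_of_mem_slitPlane hk (hslit y hy) (hq _ ?_)).continuousAt
    exact apollonius_of_re_nonpos hρ1 (by rw [hre]; exact hx.2)
  · refine norm_mul_le_sqrtDecay hC hkb (Complex.slitPlane_ne_zero (hslit y hy))
      (by rw [hre]; exact hx.1) (hqb _ ?_)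
    exact apollonius_of_re_nonpos hρ1 (by rw [hre]; exact hx.2)

theorem intervalIntegrable_slit_edge (hρ1 : ρ₀ < 1) (hC : 0 ≤ C) (hC' : 0 ≤ C')
    (hk : ∀ s : ℂ, 0 ≤ s.re → s ≠ 0 → DifferentiableAt ℂ k s)
    (hkb : ∀ s : ℂ, 0 ≤ s.re → s ≠ 0 → -ξ ≤ (s ^ 2).re → ‖k s‖ ≤ C * (1 + ‖s‖⁻¹))
    (hξ : 0 < ξ) {σ : ℝ} (hσ : |σ| = 1)
    (hq : ∀ z : ℂ, ρ₀ * ‖z + 1‖ ≤ ‖z - 1‖ → DifferentiableAt ℂ q z)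
    (hqb : ∀ z : ℂ, ρ₀ * ‖z + 1‖ ≤ ‖z - 1‖ → ‖q z‖ ≤ C' / (1 + ‖z‖) ^ 2) :
    IntervalIntegrable (fun lam : ℝ => k (σ * ((Real.sqrt lam : ℂ) * Complex.I)) * q (-(lam : ℂ)))
      volume 0 ξ := by
  have hσ0 : (σ : ℂ) ≠ 0 := by
    have : σ ≠ 0 := by rintro rfl; simp at hσ
    exact_mod_cast this
  have hT : ∀ lam : ℝ, 0 < lam → ρ₀ * ‖-(lam : ℂ) + 1‖ ≤ ‖-(lam : ℂ) - 1‖ := fun lam hlam =>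
    apollonius_of_re_nonpos hρ1 (by simpa using hlam.le)
  have hre : ∀ lam : ℝ, (σ * ((Real.sqrt lam : ℂ) * Complex.I)).re = 0 := fun lam => by simp
  have hne : ∀ lam : ℝ, 0 < lam → σ * ((Real.sqrt lam : ℂ) * Complex.I) ≠ 0 := fun lam hlam =>
    mul_ne_zero hσ0 (mul_ne_zero (by exact_mod_cast (Real.sqrt_pos.2 hlam).ne') Complex.I_ne_zero)
  have hmaj : IntervalIntegrable (fun lam : ℝ => C * C' * (1 + |lam| ^ (-(1 / 2) : ℝ))) volume 0 ξ :=
    (intervalIntegrable_const.add (intervalIntegrable_abs_rpow_neg_half 0 ξ)).const_mul _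
  refine hmaj.mono_fun' ?_ ?_
  · rw [uIoc_of_le hξ.le]
    refine ContinuousOn.aestronglyMeasurable (fun lam hlam => ?_) measurableSet_Ioc
    refine ContinuousAt.continuousWithinAt (ContinuousAt.mul ?_ ?_)
    · exact ContinuousAt.comp (f := fun lam : ℝ => σ * ((Real.sqrt lam : ℂ) * Complex.I))
        (hk _ (hre lam).ge (hne lam hlam.1)).continuousAt (by fun_prop)
    · exact ContinuousAt.comp (f := fun lam : ℝ => -(lam : ℂ))
        (hq _ (hT lam hlam.1)).continuousAt (by fun_prop)
  · rw [uIoc_of_le hξ.le]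
    refine (ae_restrict_iff' measurableSet_Ioc).2 (Eventually.of_forall fun lam hlam => ?_)
    have hsq : ((σ * ((Real.sqrt lam : ℂ) * Complex.I)) ^ 2).re = -lam := by
      have h1 : (σ : ℂ) ^ 2 = 1 := by
        have : σ ^ 2 = 1 := by rw [← sq_abs, hσ, one_pow]
        exact_mod_cast this
      have h2 : (Real.sqrt lam : ℂ) ^ 2 = lam := by exact_mod_cast Real.sq_sqrt hlam.1.le
      rw [mul_pow, mul_pow, h1, h2, Complex.I_sq]
      simp
    have h1 := hkb _ (hre lam).ge (hne lam hlam.1) (by rw [hsq]; linarith [hlam.2])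
    have h2 := hqb _ (hT lam hlam.1)
    have hn : ‖σ * ((Real.sqrt lam : ℂ) * Complex.I)‖⁻¹ = |lam| ^ (-(1 / 2) : ℝ) := by
      rw [norm_mul, norm_mul, Complex.norm_I, mul_one, Complex.norm_real, Complex.norm_real,
        Real.norm_eq_abs, hσ, one_mul, Real.norm_of_nonneg (Real.sqrt_nonneg _),
        abs_of_pos hlam.1, Real.sqrt_eq_rpow, Real.rpow_neg hlam.1.le]
    rw [hn] at h1
    have h3 : ‖q (-(lam : ℂ))‖ ≤ C' := h2.trans (div_le_self hC' (by
      nlinarith [norm_nonneg (-(lam : ℂ))]))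
    beta_reduce
    rw [norm_mul]
    calc _ ≤ (C * (1 + |lam| ^ (-(1 / 2) : ℝ))) * C' := by gcongr
      _ = _ := by ring

/-- As `sqrtDecay` decreases, `‖z‖ ≥ |x|` provides the majorant for the base of the half-strip and
`‖z‖ ≥ |y|` the one for its vertical edges. -/
theorem integral_upper_strip (hρ1 : ρ₀ < 1) (hξ : 0 < ξ) (hC : 0 ≤ C) (hC' : 0 ≤ C')
    (hk : ∀ s : ℂ, 0 ≤ s.re → s ≠ 0 → DifferentiableAt ℂ k s)
    (hkb : ∀ s : ℂ, 0 ≤ s.re → s ≠ 0 → -ξ ≤ (s ^ 2).re → ‖k s‖ ≤ C * (1 + ‖s‖⁻¹))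
    (hq : ∀ z : ℂ, ρ₀ * ‖z + 1‖ ≤ ‖z - 1‖ → DifferentiableAt ℂ q z)
    (hqb : ∀ z : ℂ, ρ₀ * ‖z + 1‖ ≤ ‖z - 1‖ → ‖q z‖ ≤ C' / (1 + ‖z‖) ^ 2) :
    Complex.I * ∫ y in Ioi (0 : ℝ), k ((((-ξ : ℝ) : ℂ) + y * Complex.I) ^ (1 / 2 : ℂ)) *
        q (((-ξ : ℝ) : ℂ) + y * Complex.I) =
      Complex.I * (∫ y in Ioi (0 : ℝ), k ((((0 : ℝ) : ℂ) + y * Complex.I) ^ (1 / 2 : ℂ)) *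
        q (((0 : ℝ) : ℂ) + y * Complex.I)) +
      ∫ lam in (0 : ℝ)..ξ, k ((Real.sqrt lam : ℂ) * Complex.I) * q (-(lam : ℂ)) := by
  have hre : ∀ x y : ℝ, ((x : ℂ) + y * Complex.I).re = x := fun x y => by simp
  have him : ∀ x y : ℝ, ((x : ℂ) + y * Complex.I).im = y := fun x y => by simp
  have hslit : ∀ x y : ℝ, 0 < y → (x : ℂ) + y * Complex.I ∈ Complex.slitPlane := fun x y hy =>
    Or.inr (by rw [him]; exact hy.ne')
  have hT : ∀ x ∈ Icc (-ξ) 0, ∀ y : ℝ,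
      ρ₀ * ‖(x : ℂ) + y * Complex.I + 1‖ ≤ ‖(x : ℂ) + y * Complex.I - 1‖ := fun x hx y =>
    apollonius_of_re_nonpos hρ1 (by rw [hre]; exact hx.2)
  have hb : ∀ x ∈ Icc (-ξ) 0, ∀ y : ℝ, 0 < y → _ := fun x hx y hy =>
    norm_mul_le_sqrtDecay hC hkb (Complex.slitPlane_ne_zero (hslit x y hy))
      (by rw [hre]; exact hx.1) (hqb _ (hT x hx y))
  have key := integral_halfStrip (a := -ξ) (b := 0) (by linarith)
    (G := fun z => k (z ^ (1 / 2 : ℂ)) * q z)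
    (Gb := fun x => k ((Real.sqrt (-x) : ℂ) * Complex.I) * q x)
    (ux := fun x => C * C' * (1 + |x| ^ (-(1 / 2) : ℝ)))
    (uy := fun y => C * C' * sqrtDecay |y|)
    (fun x hx y hy => differentiableAt_mul_of_mem_slitPlane hk (hslit x y hy) (hq _ (hT x hx y)))
    (fun x hx y hy => by
      refine (hb x ⟨hx.1.le, hx.2.le⟩ y hy).trans ?_
      have h1 : |x| ≤ ‖(x : ℂ) + y * Complex.I‖ := by
        have := Complex.abs_re_le_norm ((x : ℂ) + y * Complex.I)
        rwa [hre] at this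
      exact mul_le_mul_of_nonneg_left ((sqrtDecay_anti (abs_pos.2 hx.2.ne) h1).trans
        (sqrtDecay_le (abs_nonneg x))) (mul_nonneg hC hC'))
    ((intervalIntegrable_const.add (intervalIntegrable_abs_rpow_neg_half _ _)).const_mul _)
    (fun x hx y hy => by
      refine (hb x hx y hy).trans ?_
      have h1 : |y| ≤ ‖(x : ℂ) + y * Complex.I‖ := by
        have := Complex.abs_im_le_norm ((x : ℂ) + y * Complex.I)
        rwa [him] at this
      exact mul_le_mul_of_nonneg_left (sqrtDecay_anti (abs_pos.2 hy.ne') h1) (mul_nonneg hC hC'))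
    (integrable_sqrtDecay.integrableOn.const_mul _)
    (by simpa using (tendsto_sqrtDecay.comp tendsto_abs_atTop_atTop).const_mul (C * C'))
    (fun x hx => by
      have hx0 : 0 < -x := by linarith [hx.2]
      refine Tendsto.mul ?_ ?_
      · have h1 := tendsto_cpow_half_upper hx0
        rw [sqrt_mul_exp_pi_half, neg_neg] at h1
        refine (hk _ (by simp) ?_).continuousAt.tendsto.comp h1
        exact mul_ne_zero (by exact_mod_cast (Real.sqrt_pos.2 hx0).ne') Complex.I_ne_zero
      · have h2 : ContinuousAt q (x : ℂ) := by
          have := (hq _ (hT x ⟨hx.1.le, hx.2.le⟩ 0)).continuousAt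
          simpa using this
        have h3 : Tendsto (fun y : ℝ => (x : ℂ) + y * Complex.I) (𝓝[>] 0) (𝓝 (x : ℂ)) := by
          have : Continuous fun y : ℝ => (x : ℂ) + y * Complex.I := by fun_prop
          have h4 := this.tendsto 0
          simp only [Complex.ofReal_zero, zero_mul, add_zero] at h4
          exact h4.mono_left nhdsWithin_le_nhds
        exact h2.tendsto.comp h3)
  rw [key]
  congr 1
  have := intervalIntegral.integral_comp_neg (a := 0) (b := ξ)
    (fun x : ℝ => k ((Real.sqrt (-x) : ℂ) * Complex.I) * q x)
  simp only [neg_neg, neg_zero, Complex.ofReal_neg] at this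
  exact this.symm

/-- The point reflection `z ↦ -ξ - z` carries the lower half-strip to the upper one and exchanges
the vertical edges, so `integral_halfStrip` applies again, now with the singularity at the left end
`x = -ξ`. -/
theorem integral_lower_strip (hρ1 : ρ₀ < 1) (hξ : 0 < ξ) (hC : 0 ≤ C) (hC' : 0 ≤ C')
    (hk : ∀ s : ℂ, 0 ≤ s.re → s ≠ 0 → DifferentiableAt ℂ k s)
    (hkb : ∀ s : ℂ, 0 ≤ s.re → s ≠ 0 → -ξ ≤ (s ^ 2).re → ‖k s‖ ≤ C * (1 + ‖s‖⁻¹))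
    (hq : ∀ z : ℂ, ρ₀ * ‖z + 1‖ ≤ ‖z - 1‖ → DifferentiableAt ℂ q z)
    (hqb : ∀ z : ℂ, ρ₀ * ‖z + 1‖ ≤ ‖z - 1‖ → ‖q z‖ ≤ C' / (1 + ‖z‖) ^ 2) :
    Complex.I * ∫ y in Ioi (0 : ℝ), k ((((0 : ℝ) : ℂ) - y * Complex.I) ^ (1 / 2 : ℂ)) *
        q (((0 : ℝ) : ℂ) - y * Complex.I) =
      Complex.I * (∫ y in Ioi (0 : ℝ), k ((((-ξ : ℝ) : ℂ) - y * Complex.I) ^ (1 / 2 : ℂ)) *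
        q (((-ξ : ℝ) : ℂ) - y * Complex.I)) +
      ∫ lam in (0 : ℝ)..ξ, k (-((Real.sqrt lam : ℂ) * Complex.I)) * q (-(lam : ℂ)) := by
  have hre : ∀ x y : ℝ, (((-ξ - x : ℝ) : ℂ) - y * Complex.I).re = -ξ - x := fun x y => by simp
  have him : ∀ x y : ℝ, (((-ξ - x : ℝ) : ℂ) - y * Complex.I).im = -y := fun x y => by simp
  have hrw : ∀ x y : ℝ, ((-ξ : ℝ) : ℂ) - ((x : ℂ) + y * Complex.I) =
      ((-ξ - x : ℝ) : ℂ) - y * Complex.I := fun x y => by push_cast; ring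
  have hslit : ∀ x y : ℝ, 0 < y → ((-ξ - x : ℝ) : ℂ) - y * Complex.I ∈ Complex.slitPlane :=
    fun x y hy => Or.inr (by rw [him]; linarith)
  have hT : ∀ x ∈ Icc (-ξ) 0, ∀ y : ℝ, ρ₀ * ‖((-ξ - x : ℝ) : ℂ) - y * Complex.I + 1‖ ≤
      ‖((-ξ - x : ℝ) : ℂ) - y * Complex.I - 1‖ := fun x hx y =>
    apollonius_of_re_nonpos hρ1 (by rw [hre]; linarith [hx.1])
  have hb : ∀ x ∈ Icc (-ξ) 0, ∀ y : ℝ, 0 < y → _ := fun x hx y hy =>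
    norm_mul_le_sqrtDecay hC hkb (Complex.slitPlane_ne_zero (hslit x y hy))
      (by rw [hre]; linarith [hx.2]) (hqb _ (hT x hx y))
  have hmaj : IntervalIntegrable (fun x : ℝ => C * C' * (1 + |-ξ - x| ^ (-(1 / 2) : ℝ)))
      volume (-ξ) 0 := by
    refine (intervalIntegrable_const.add ?_).const_mul _
    have := (intervalIntegrable_abs_rpow_neg_half (-ξ - -ξ) (-ξ - 0)).comp_sub_left (-ξ)
    simpa using this
  have key := integral_halfStrip (a := -ξ) (b := 0) (by linarith)
    (G := fun z => k ((((-ξ : ℝ) : ℂ) - z) ^ (1 / 2 : ℂ)) * q (((-ξ : ℝ) : ℂ) - z))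
    (Gb := fun x => k (-((Real.sqrt (ξ + x) : ℂ) * Complex.I)) * q ((-ξ - x : ℝ) : ℂ))
    (ux := fun x => C * C' * (1 + |-ξ - x| ^ (-(1 / 2) : ℝ)))
    (uy := fun y => C * C' * sqrtDecay |y|)
    (fun x hx y hy => by
      refine DifferentiableAt.comp (g := fun z => k (z ^ (1 / 2 : ℂ)) * q z)
        (f := fun z : ℂ => ((-ξ : ℝ) : ℂ) - z) _ ?_ (by fun_prop)
      rw [hrw]
      exact differentiableAt_mul_of_mem_slitPlane hk (hslit x y hy) (hq _ (hT x hx y)))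
    (fun x hx y hy => by
      rw [hrw]
      refine (hb x ⟨hx.1.le, hx.2.le⟩ y hy).trans ?_
      have h1 : |-ξ - x| ≤ ‖((-ξ - x : ℝ) : ℂ) - y * Complex.I‖ := by
        have := Complex.abs_re_le_norm (((-ξ - x : ℝ) : ℂ) - y * Complex.I)
        rwa [hre] at this
      have h2 : -ξ - x ≠ 0 := by linarith [hx.1]
      exact mul_le_mul_of_nonneg_left ((sqrtDecay_anti (abs_pos.2 h2) h1).trans
        (sqrtDecay_le (abs_nonneg _))) (mul_nonneg hC hC'))
    hmaj
    (fun x hx y hy => by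
      rw [hrw]
      refine (hb x hx y hy).trans ?_
      have h1 : |y| ≤ ‖((-ξ - x : ℝ) : ℂ) - y * Complex.I‖ := by
        have := Complex.abs_im_le_norm (((-ξ - x : ℝ) : ℂ) - y * Complex.I)
        rwa [him, abs_neg] at this
      exact mul_le_mul_of_nonneg_left (sqrtDecay_anti (abs_pos.2 hy.ne') h1) (mul_nonneg hC hC'))
    (integrable_sqrtDecay.integrableOn.const_mul _)
    (by simpa using (tendsto_sqrtDecay.comp tendsto_abs_atTop_atTop).const_mul (C * C'))
    (fun x hx => by
      have hx0 : 0 < ξ + x := by linarith [hx.1]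
      simp only [hrw]
      refine Tendsto.mul ?_ ?_
      · have h1 := tendsto_cpow_half_lower hx0
        rw [sqrt_mul_exp_neg_pi_half, neg_add'] at h1
        refine (hk _ (by simp) ?_).continuousAt.tendsto.comp h1
        exact neg_ne_zero.2
          (mul_ne_zero (by exact_mod_cast (Real.sqrt_pos.2 hx0).ne') Complex.I_ne_zero)
      · have h2 : ContinuousAt q ((-ξ - x : ℝ) : ℂ) := by
          have := (hq _ (hT x ⟨hx.1.le, hx.2.le⟩ 0)).continuousAt
          simpa using this
        have h3 : Tendsto (fun y : ℝ => ((-ξ - x : ℝ) : ℂ) - y * Complex.I) (𝓝[>] 0)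
            (𝓝 ((-ξ - x : ℝ) : ℂ)) := by
          have : Continuous fun y : ℝ => ((-ξ - x : ℝ) : ℂ) - y * Complex.I := by fun_prop
          have h4 := this.tendsto 0
          rw [Complex.ofReal_zero, zero_mul, sub_zero] at h4
          exact h4.mono_left nhdsWithin_le_nhds
        exact h2.tendsto.comp h3)
  simp only [hrw, sub_neg_eq_add, sub_zero, neg_add_cancel] at key
  rw [key]
  congr 1
  have := intervalIntegral.integral_comp_sub_left (a := -ξ) (b := 0)
    (fun lam : ℝ => k (-((Real.sqrt lam : ℂ) * Complex.I)) * q (-(lam : ℂ))) 0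
  have h2 := intervalIntegral.integral_comp_add_left (a := -ξ) (b := 0)
    (fun lam : ℝ => k (-((Real.sqrt lam : ℂ) * Complex.I)) * q (-(lam : ℂ))) ξ
  simp only [add_neg_cancel, add_zero] at h2
  rw [← h2]
  refine intervalIntegral.integral_congr fun x _ => ?_
  congr 2
  push_cast
  ring

/-- The contour integral along the circles of Apollonius, as an integral along the boundary of
the half-plane `Re z > -ξ` with a slit along the negative real axis. -/
theorem integral_cayley_eq_slit (hρ0 : 0 < ρ₀) (hρ1 : ρ₀ < 1) (hξ : 0 < ξ) (hC : 0 ≤ C)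
    (hC' : 0 ≤ C')
    (hk : ∀ s : ℂ, 0 ≤ s.re → s ≠ 0 → DifferentiableAt ℂ k s)
    (hkb : ∀ s : ℂ, 0 ≤ s.re → s ≠ 0 → -ξ ≤ (s ^ 2).re → ‖k s‖ ≤ C * (1 + ‖s‖⁻¹))
    (hq : ∀ z : ℂ, ρ₀ * ‖z + 1‖ ≤ ‖z - 1‖ → DifferentiableAt ℂ q z)
    (hqb : ∀ z : ℂ, ρ₀ * ‖z + 1‖ ≤ ‖z - 1‖ → ‖q z‖ ≤ C' / (1 + ‖z‖) ^ 2)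
    {c : ℂ}
    (hc : ∀ ρ ∈ Ico ρ₀ 1, ∫ θ in (0 : ℝ)..2 * Real.pi, cayleyDensity ρ θ *
      (k (cayleyContour ρ θ ^ (1 / 2 : ℂ)) * q (cayleyContour ρ θ)) = c) :
    c = -((2 * (Real.pi : ℂ) * Complex.I)⁻¹ *
      (verticalIntegral ξ (fun z => k (z ^ (1 / 2 : ℂ)) * q z) +
        ∫ lam in (0 : ℝ)..ξ, (k (-((Real.sqrt lam : ℂ) * Complex.I)) -
          k ((Real.sqrt lam : ℂ) * Complex.I)) * q (-(lam : ℂ)))) := by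
  have hslit : ∀ z : ℂ, 0 ≤ z.re → z ≠ 0 → z ∈ Complex.slitPlane := by
    intro z hz hz0
    rcases hz.lt_or_eq with h | h
    · exact Or.inl h
    · refine Or.inr fun him => hz0 (Complex.ext h.symm him)
  have hlim := tendsto_integral_cayley (g := fun z => k (z ^ (1 / 2 : ℂ)) * q z) hρ0 hρ1
    (fun z hz hz0 hT => (differentiableAt_mul_of_mem_slitPlane hk (hslit z hz hz0)
      (hq z hT)).continuousAt)
    (fun z hz hz0 hT => norm_mul_le_sqrtDecay hC hkb hz0 (by linarith) (hqb z hT))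
    (mul_nonneg hC hC')
  -- The integral is the same for every `ρ` in `[ρ₀, 1)`, so its value equals its limit.
  have hconst : Tendsto (fun ρ => ∫ θ in (0 : ℝ)..2 * Real.pi, cayleyDensity ρ θ *
      (k (cayleyContour ρ θ ^ (1 / 2 : ℂ)) * q (cayleyContour ρ θ))) (𝓝[<] 1) (𝓝 c) := by
    refine tendsto_const_nhds.congr' ?_
    filter_upwards [Ico_mem_nhdsLT hρ1] with ρ hρ using (hc ρ hρ).symm
  have h1 := (tendsto_nhds_unique hconst hlim).trans
    (integral_cayley_one fun z => k (z ^ (1 / 2 : ℂ)) * q z)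
  have h00 : (0 : ℝ) ∈ Icc (-ξ) 0 := ⟨by linarith, le_rfl⟩
  have hp := integrableOn_slit_vertical hρ1 hC hC' hk hkb hq hqb (σ := 1) h00 (by simp)
  have hm := integrableOn_slit_vertical hρ1 hC hC' hk hkb hq hqb (σ := -1) h00 (by simp)
  set g : ℂ → ℂ := fun z => k (z ^ (1 / 2 : ℂ)) * q z with hg
  have hm' : IntegrableOn (fun y : ℝ => g (-(Complex.I * (y : ℂ)))) (Ioi 0) := by
    refine hm.congr_fun (fun y _ => ?_) measurableSet_Ioi
    simp [hg]
  have hp' : IntegrableOn (fun y : ℝ => g (-(Complex.I * (y : ℂ)))) (Iic 0) := by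
    have h2 : IntegrableOn (fun y : ℝ => g (-(Complex.I * ((-y : ℝ) : ℂ)))) (Ioi 0) := by
      refine hp.congr_fun (fun y _ => ?_) measurableSet_Ioi
      simp [hg]
    have h3 := (integrableOn_Ici_iff_integrableOn_Ioi (b := (0 : ℝ))).2 h2
    have h4 := (Measure.measurePreserving_neg (volume : Measure ℝ)).integrableOn_comp_preimage
      (Homeomorph.neg ℝ).measurableEmbedding
      (f := fun y : ℝ => g (-(Complex.I * (y : ℂ)))) (s := Iic 0)
    refine h4.1 ?_
    have h5 : (Neg.neg : ℝ → ℝ) ⁻¹' Iic 0 = Ici 0 := by ext; simp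
    rw [h5]
    exact h3
  -- On `z = -iy`, the part `y ≤ 0` is the upper half of the imaginary axis and `y > 0` the lower
  -- half.
  have hsplit := intervalIntegral.integral_Iic_add_Ioi hp' hm'
  have hneg := integral_comp_neg_Ioi (0 : ℝ) (fun y : ℝ => g (-(Complex.I * (y : ℂ))))
  rw [neg_zero] at hneg
  rw [← hsplit, ← hneg] at h1
  have hU := integral_upper_strip hρ1 hξ hC hC' hk hkb hq hqb
  have hL := integral_lower_strip hρ1 hξ hC hC' hk hkb hq hqb
  have eU : ∫ y in Ioi (0 : ℝ), g (-(Complex.I * ((-y : ℝ) : ℂ))) =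
      ∫ y in Ioi (0 : ℝ), g (((0 : ℝ) : ℂ) + y * Complex.I) :=
    setIntegral_congr_fun measurableSet_Ioi fun y _ => by
      congr 1; push_cast; ring
  have eL : ∫ y in Ioi (0 : ℝ), g (-(Complex.I * (y : ℂ))) =
      ∫ y in Ioi (0 : ℝ), g (((0 : ℝ) : ℂ) - y * Complex.I) :=
    setIntegral_congr_fun measurableSet_Ioi fun y _ => by
      congr 1; push_cast; ring
  rw [eU, eL] at h1
  have eV : verticalIntegral ξ g =
      Complex.I * (∫ y in Ioi (0 : ℝ), g (((-ξ : ℝ) : ℂ) + y * Complex.I)) +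
      Complex.I * ∫ y in Ioi (0 : ℝ), g (((-ξ : ℝ) : ℂ) - y * Complex.I) := by
    rw [verticalIntegral, ← integral_const_mul, ← integral_const_mul]
    congr 1
    · refine setIntegral_congr_fun measurableSet_Ioi fun y _ => ?_
      rw [mul_comm]
      congr 2
      push_cast
      ring
    · refine setIntegral_congr_fun measurableSet_Ioi fun y _ => ?_
      rw [mul_comm]
      congr 2
      push_cast
      ring
  have eJ : ∫ lam in (0 : ℝ)..ξ, (k (-((Real.sqrt lam : ℂ) * Complex.I)) -
      k ((Real.sqrt lam : ℂ) * Complex.I)) * q (-(lam : ℂ)) =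
      (∫ lam in (0 : ℝ)..ξ, k (-((Real.sqrt lam : ℂ) * Complex.I)) * q (-(lam : ℂ))) -
      ∫ lam in (0 : ℝ)..ξ, k ((Real.sqrt lam : ℂ) * Complex.I) * q (-(lam : ℂ)) := by
    rw [← intervalIntegral.integral_sub]
    · refine intervalIntegral.integral_congr fun lam _ => ?_
      ring
    · have := intervalIntegrable_slit_edge hρ1 hC hC' hk hkb hξ (σ := -1) (by simp) hq hqb
      simpa using this
    · have := intervalIntegrable_slit_edge hρ1 hC hC' hk hkb hξ (σ := 1) (by simp) hq hqb
      simpa using this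
  rw [h1, eV, eJ]
  rw [hU]
  linear_combination (-(2 * (Real.pi : ℂ) * Complex.I)⁻¹) * hL

end Slit


/-! ### The series for `I₀` and `K₀` and their differential equation -/

section Series

variable {𝕜 : Type*} [RCLike 𝕜] {c : ℕ → 𝕜}

theorem summable_series (hc : ∀ k, ‖c k‖ ≤ 1 / (k ! : ℝ)) (q : 𝕜) :
    Summable fun k => c k * q ^ k := by
  refine Summable.of_norm_bounded (Real.summable_pow_div_factorial ‖q‖) fun k => ?_
  rw [norm_mul, norm_pow, div_eq_inv_mul, ← one_div]
  gcongr
  exact hc k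

theorem norm_succ_mul_le (hc : ∀ k, ‖c k‖ ≤ 1 / (k ! : ℝ)) (k : ℕ) :
    ‖((k : 𝕜) + 1) * c (k + 1)‖ ≤ 1 / (k ! : ℝ) := by
  rw [norm_mul]
  have h1 : ‖(k : 𝕜) + 1‖ = (k : ℝ) + 1 := by
    rw [← Nat.cast_add_one, RCLike.norm_natCast, Nat.cast_add_one]
  rw [h1]
  calc ((k : ℝ) + 1) * ‖c (k + 1)‖ ≤ ((k : ℝ) + 1) * (1 / ((k + 1)! : ℝ)) := by
        gcongr; exact hc (k + 1)
    _ = 1 / (k ! : ℝ) := by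
        rw [Nat.factorial_succ]; push_cast; field_simp

/-- The bound `‖c k‖ ≤ 1 / k!` is inherited by the derived coefficients (`norm_succ_mul_le`), so the
lemma can be iterated. -/
theorem hasDerivAt_series (hc : ∀ k, ‖c k‖ ≤ 1 / (k ! : ℝ)) (q : 𝕜) :
    HasDerivAt (fun q => ∑' k, c k * q ^ k) (∑' k : ℕ, (((k : 𝕜) + 1) * c (k + 1)) * q ^ k) q := by
  have hs := summable_series (norm_succ_mul_le hc) q
  have hu : Summable fun k : ℕ => ‖c k‖ * (k * (‖q‖ + 1) ^ (k - 1)) := by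
    rw [← summable_nat_add_iff 1]
    have hd : ∀ k : ℕ, ‖((‖((k : 𝕜) + 1) * c (k + 1)‖ : ℝ) : ℝ)‖ ≤ 1 / (k ! : ℝ) := fun k => by
      rw [norm_norm]; exact norm_succ_mul_le hc k
    refine (summable_series hd (‖q‖ + 1)).congr fun k => ?_
    have h1 : ‖(k : 𝕜) + 1‖ = (k : ℝ) + 1 := by
      rw [← Nat.cast_add_one, RCLike.norm_natCast, Nat.cast_add_one]
    rw [norm_mul, h1, Nat.add_sub_cancel]
    push_cast
    ring
  have key := hasDerivAt_tsum_of_isPreconnected (g := fun (k : ℕ) (q : 𝕜) => c k * q ^ k)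
    (g' := fun k q => c k * (k * q ^ (k - 1))) (t := Metric.ball (0 : 𝕜) (‖q‖ + 1)) (y₀ := q)
    (y := q) hu Metric.isOpen_ball ?_ (fun k y _ => (hasDerivAt_pow k y).const_mul (c k))
    (fun k y hy => ?_) (by simp) (summable_series hc q) (by simp)
  · refine key.congr_deriv ?_
    rw [Summable.tsum_eq_zero_add]
    · simp only [Nat.cast_zero, zero_mul, mul_zero, zero_add, Nat.add_sub_cancel]
      refine tsum_congr fun k => ?_
      push_cast
      ring
    · rw [← summable_nat_add_iff 1]
      refine hs.congr fun k => ?_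
      simp only [Nat.add_sub_cancel]
      push_cast
      ring
  · let _ : NormedSpace ℝ 𝕜 := NormedSpace.restrictScalars ℝ 𝕜 𝕜
    exact (convex_ball (0 : 𝕜) _).isPreconnected
  · rw [norm_mul, norm_mul, norm_pow, RCLike.norm_natCast]
    have : ‖y‖ ≤ ‖q‖ + 1 := (mem_ball_zero_iff.1 hy).le
    gcongr

/-- The derivative of `q ↦ q f(q)`, for a power series `f`. -/
theorem hasDerivAt_mul_series (hc : ∀ k, ‖c k‖ ≤ 1 / (k ! : ℝ)) (q : 𝕜) :
    HasDerivAt (fun q => q * ∑' k, c k * q ^ k) (∑' k : ℕ, (((k : 𝕜) + 1) * c k) * q ^ k) q := by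
  have h1 := (hasDerivAt_id q).fun_mul (hasDerivAt_series hc q)
  have hs := summable_series (norm_succ_mul_le hc) q
  refine h1.congr_deriv ?_
  simp only [one_mul, id_eq]
  have h2 : Summable fun k : ℕ => (k : 𝕜) * c k * q ^ k := by
    rw [← summable_nat_add_iff 1]
    refine (hs.mul_left q).congr fun k => ?_
    push_cast
    ring
  have h3 : q * ∑' k : ℕ, (((k : 𝕜) + 1) * c (k + 1)) * q ^ k = ∑' k : ℕ, (k : 𝕜) * c k * q ^ k := by
    rw [h2.tsum_eq_zero_add, ← tsum_mul_left]
    simp only [Nat.cast_zero, zero_mul, zero_add]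
    refine tsum_congr fun k => ?_
    push_cast
    ring
  rw [h3, ← (summable_series hc q).tsum_add h2]
  exact tsum_congr fun k => by ring

end Series

theorem inv_factorial_sq_le (k : ℕ) : 1 / (k ! : ℝ) ^ 2 ≤ 1 / (k ! : ℝ) := by
  have : (1 : ℝ) ≤ k ! := by exact_mod_cast Nat.one_le_iff_ne_zero.2 (Nat.factorial_ne_zero k)
  exact one_div_le_one_div_of_le (by positivity) (by nlinarith)

theorem harmonic_le_factorial (k : ℕ) : (harmonic k : ℚ) ≤ k ! := by
  have h1 : (harmonic k : ℚ) ≤ k := by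
    induction k with
    | zero => simp
    | succ k ih =>
      rw [harmonic_succ]
      push_cast
      have : ((k : ℚ) + 1)⁻¹ ≤ 1 := inv_le_one_of_one_le₀ (by
        have : (0 : ℚ) ≤ k := Nat.cast_nonneg k
        linarith)
      linarith
  exact h1.trans (by exact_mod_cast Nat.self_le_factorial k)

theorem harmonic_nonneg' (k : ℕ) : (0 : ℚ) ≤ harmonic k :=
  Finset.sum_nonneg fun i _ => by positivity

theorem harmonic_div_factorial_sq_le (k : ℕ) :
    ((harmonic k : ℚ) : ℝ) / (k ! : ℝ) ^ 2 ≤ 1 / (k ! : ℝ) := by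
  have h1 : ((harmonic k : ℚ) : ℝ) ≤ k ! := by exact_mod_cast harmonic_le_factorial k
  rw [div_le_div_iff₀ (by positivity) (by positivity)]
  nlinarith [(Nat.cast_nonneg (k !) : (0 : ℝ) ≤ k !)]

/-- The coefficients of `I₀` as a series in `z² / 4`. -/
noncomputable def coeffI (𝕜 : Type*) [RCLike 𝕜] (k : ℕ) : 𝕜 := 1 / (k ! : 𝕜) ^ 2

/-- The coefficients of the regular part of `K₀` as a series in `z² / 4`. -/
noncomputable def coeffH (𝕜 : Type*) [RCLike 𝕜] (k : ℕ) : 𝕜 :=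
  ((harmonic k : ℚ) : 𝕜) / (k ! : 𝕜) ^ 2

section Coeff

variable {𝕜 : Type*} [RCLike 𝕜]

theorem norm_coeffI_le (k : ℕ) : ‖coeffI 𝕜 k‖ ≤ 1 / (k ! : ℝ) := by
  rw [coeffI, norm_div, norm_one, norm_pow, RCLike.norm_natCast]
  exact inv_factorial_sq_le k

theorem norm_coeffH_le (k : ℕ) : ‖coeffH 𝕜 k‖ ≤ 1 / (k ! : ℝ) := by
  rw [coeffH, norm_div, norm_pow, RCLike.norm_natCast]
  have h : ((harmonic k : ℚ) : 𝕜) = ((((harmonic k : ℚ) : ℝ)) : 𝕜) := by norm_cast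
  have h0 : (0 : ℝ) ≤ ((harmonic k : ℚ) : ℝ) := by exact_mod_cast harmonic_nonneg' k
  rw [h, RCLike.norm_ofReal, abs_of_nonneg h0]
  exact harmonic_div_factorial_sq_le k

/-- Coefficientwise form of `(q y')' = y`, the equation of `I₀(2√q)`. -/
theorem succ_sq_mul_coeffI (k : ℕ) :
    ((k : 𝕜) + 1) * (((k : 𝕜) + 1) * coeffI 𝕜 (k + 1)) = coeffI 𝕜 k := by
  have h1 : (k : 𝕜) + 1 ≠ 0 := Nat.cast_add_one_ne_zero k
  have h2 : (k ! : 𝕜) ≠ 0 := Nat.cast_ne_zero.2 (Nat.factorial_ne_zero k)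
  rw [coeffI, coeffI, Nat.factorial_succ]
  push_cast
  field_simp

/-- The increment `1 / (k + 1)` of the harmonic numbers creates the inhomogeneity `seriesI'`, which
the derivatives of the logarithm cancel in `hasDerivAt_mul_seriesK'`. -/
theorem succ_sq_mul_coeffH (k : ℕ) :
    ((k : 𝕜) + 1) * (((k : 𝕜) + 1) * coeffH 𝕜 (k + 1)) =
      coeffH 𝕜 k + ((k : 𝕜) + 1) * coeffI 𝕜 (k + 1) := by
  have h1 : (k : 𝕜) + 1 ≠ 0 := Nat.cast_add_one_ne_zero k
  have h2 : (k ! : 𝕜) ≠ 0 := Nat.cast_ne_zero.2 (Nat.factorial_ne_zero k)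
  rw [coeffH, coeffH, coeffI, Nat.factorial_succ, harmonic_succ]
  push_cast
  field_simp

end Coeff

/-- `I₀` as a function of `q = x² / 4`. -/
noncomputable def seriesI (q : ℝ) : ℝ := ∑' k, coeffI ℝ k * q ^ k

/-- The derivative of `seriesI`. -/
noncomputable def seriesI' (q : ℝ) : ℝ := ∑' k : ℕ, (((k : ℝ) + 1) * coeffI ℝ (k + 1)) * q ^ k

/-- The regular part of `K₀` as a function of `q = x² / 4`. -/
noncomputable def seriesH (q : ℝ) : ℝ := ∑' k, coeffH ℝ k * q ^ k

/-- The derivative of `seriesH`. -/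
noncomputable def seriesH' (q : ℝ) : ℝ := ∑' k : ℕ, (((k : ℝ) + 1) * coeffH ℝ (k + 1)) * q ^ k

theorem hasDerivAt_seriesI (q : ℝ) : HasDerivAt seriesI (seriesI' q) q :=
  hasDerivAt_series norm_coeffI_le q

theorem hasDerivAt_seriesH (q : ℝ) : HasDerivAt seriesH (seriesH' q) q :=
  hasDerivAt_series norm_coeffH_le q

theorem hasDerivAt_mul_seriesI' (q : ℝ) :
    HasDerivAt (fun q => q * seriesI' q) (seriesI q) q := by
  have h := hasDerivAt_mul_series (norm_succ_mul_le (norm_coeffI_le (𝕜 := ℝ))) q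
  simp only [succ_sq_mul_coeffI] at h
  exact h

theorem hasDerivAt_mul_seriesH' (q : ℝ) :
    HasDerivAt (fun q => q * seriesH' q) (seriesH q + seriesI' q) q := by
  have h := hasDerivAt_mul_series (norm_succ_mul_le (norm_coeffH_le (𝕜 := ℝ))) q
  simp only [succ_sq_mul_coeffH] at h
  refine h.congr_deriv ?_
  simp only [add_mul (coeffH ℝ _)]
  exact ((summable_series norm_coeffH_le q).tsum_add
    (summable_series (norm_succ_mul_le norm_coeffI_le) q))

theorem continuous_seriesI' : Continuous seriesI' :=
  continuous_iff_continuousAt.2 fun q =>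
    (hasDerivAt_series (norm_succ_mul_le (norm_coeffI_le (𝕜 := ℝ))) q).continuousAt

theorem seriesI_zero : seriesI 0 = 1 := by
  rw [seriesI, tsum_eq_single 0]
  · simp [coeffI]
  · intro k hk; simp [hk]

theorem seriesH_zero : seriesH 0 = 0 := by
  rw [seriesH, tsum_eq_single 0]
  · simp [coeffH]
  · intro k hk; simp [hk]

theorem seriesI_pos {q : ℝ} (hq : 0 ≤ q) : 0 < seriesI q := by
  refine (summable_series norm_coeffI_le q).tsum_pos (fun k => ?_) 0 ?_
  · rw [coeffI]; positivity
  · simp [coeffI]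

/-- `K₀` as a function of `q = x² / 4`. -/
noncomputable def seriesK (q : ℝ) : ℝ :=
  -(1 / 2 * Real.log q + Real.eulerMascheroniConstant) * seriesI q + seriesH q

/-- The derivative of `seriesK`. -/
noncomputable def seriesK' (q : ℝ) : ℝ :=
  -(1 / 2 * q⁻¹) * seriesI q -
    (1 / 2 * Real.log q + Real.eulerMascheroniConstant) * seriesI' q + seriesH' q

theorem hasDerivAt_seriesK {q : ℝ} (hq : 0 < q) : HasDerivAt seriesK (seriesK' q) q := by
  have hl := (((Real.hasDerivAt_log hq.ne').const_mul (1 / 2)).add_const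
    Real.eulerMascheroniConstant).fun_neg
  have := (hl.fun_mul (hasDerivAt_seriesI q)).fun_add (hasDerivAt_seriesH q)
  refine this.congr_deriv ?_
  rw [seriesK']
  ring

theorem hasDerivAt_mul_seriesK' {q : ℝ} (hq : 0 < q) :
    HasDerivAt (fun q => q * seriesK' q) (seriesK q) q := by
  have hl := (((Real.hasDerivAt_log hq.ne').const_mul (1 / 2)).add_const
    Real.eulerMascheroniConstant).fun_neg
  have h1 := (((hasDerivAt_seriesI q).const_mul (-(1 / 2 : ℝ))).fun_add
    (hl.fun_mul (hasDerivAt_mul_seriesI' q))).fun_add (hasDerivAt_mul_seriesH' q)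
  have h2 : HasDerivAt (fun q => -(1 / 2) * seriesI q +
      -(1 / 2 * Real.log q + Real.eulerMascheroniConstant) * (q * seriesI' q) + q * seriesH' q)
      (seriesK q) q := by
    refine h1.congr_deriv ?_
    rw [seriesK]
    field_simp
    ring
  refine h2.congr_of_eventuallyEq ?_
  filter_upwards [lt_mem_nhds hq] with t ht
  rw [seriesK']
  field_simp
  ring

theorem tendsto_seriesK : Tendsto (fun q => seriesK q + 1 / 2 * Real.log q) (𝓝[>] 0)
    (𝓝 (-Real.eulerMascheroniConstant)) := by
  have hI : Tendsto seriesI (𝓝[>] 0) (𝓝 1) := by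
    have := (hasDerivAt_seriesI 0).continuousAt.tendsto
    rw [seriesI_zero] at this
    exact this.mono_left nhdsWithin_le_nhds
  have hH : Tendsto seriesH (𝓝[>] 0) (𝓝 0) := by
    have := (hasDerivAt_seriesH 0).continuousAt.tendsto
    rw [seriesH_zero] at this
    exact this.mono_left nhdsWithin_le_nhds
  have hslope : Tendsto (fun q => q⁻¹ * (seriesI q - 1)) (𝓝[>] 0) (𝓝 (seriesI' 0)) := by
    have := (hasDerivAt_iff_tendsto_slope.1 (hasDerivAt_seriesI 0))
    refine (this.mono_left (nhdsWithin_mono _ fun x hx => ne_of_gt hx)).congr fun q => ?_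
    rw [slope_def_field, seriesI_zero]
    field_simp
    ring
  have hlog : Tendsto (fun q : ℝ => q * Real.log q) (𝓝[>] 0) (𝓝 0) := by
    have := Real.continuous_mul_log.tendsto 0
    rw [zero_mul] at this
    exact this.mono_left nhdsWithin_le_nhds
  have hlog2 : Tendsto (fun q => Real.log q * (seriesI q - 1)) (𝓝[>] 0) (𝓝 0) := by
    have := hlog.mul hslope
    rw [zero_mul] at this
    refine this.congr' ?_
    filter_upwards [self_mem_nhdsWithin] with q hq
    have : q ≠ 0 := ne_of_gt hq
    field_simp
  have hall := ((hlog2.const_mul (-(1 / 2))).sub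
    (hI.const_mul Real.eulerMascheroniConstant)).add hH
  rw [mul_zero, mul_one, zero_sub, add_zero] at hall
  refine hall.congr fun q => ?_
  rw [seriesK]
  ring

/-- Two solutions of `(q y')' = y` on the half-line with the same asymptotics at `0` agree. -/
theorem eq_zero_of_bessel_ode {f f' : ℝ → ℝ} (hf : ∀ q, 0 < q → HasDerivAt f (f' q) q)
    (hf' : ∀ q, 0 < q → HasDerivAt (fun q => q * f' q) (f q) q)
    (h0 : Tendsto f (𝓝[>] 0) (𝓝 0)) {q : ℝ} (hq : 0 < q) : f q = 0 := by
  -- The Wronskian of `f` with the regular solution. It is constant; once the constant is shown to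
  -- be `0`, the quotient `f / seriesI` is constant and tends to `0`.
  set w : ℝ → ℝ := fun q => (q * f' q) * seriesI q - f q * (q * seriesI' q) with hw
  have hwd : ∀ t, 0 < t → HasDerivAt w 0 t := by
    intro t ht
    have := ((hf' t ht).fun_mul (hasDerivAt_seriesI t)).fun_sub
      ((hf t ht).fun_mul (hasDerivAt_mul_seriesI' t))
    refine this.congr_deriv ?_
    ring
  have hwc : ∀ s t, 0 < s → 0 < t → w s = w t := fun s t hs ht =>
    isOpen_Ioi.is_const_of_deriv_eq_zero (convex_Ioi (0 : ℝ)).isPreconnected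
      (fun r hr => (hwd r hr).differentiableAt.differentiableWithinAt)
      (fun r hr => (hwd r hr).deriv) hs ht
  obtain ⟨B, hB⟩ := isCompact_Icc.exists_bound_of_continuousOn (s := Icc (0 : ℝ) 2)
    (f := seriesI) fun t _ => (hasDerivAt_seriesI t).continuousAt.continuousWithinAt
  obtain ⟨B', hB'⟩ := isCompact_Icc.exists_bound_of_continuousOn (s := Icc (0 : ℝ) 2)
    (f := seriesI') continuous_seriesI'.continuousOn
  have hB0 : 0 ≤ B := (norm_nonneg _).trans (hB 0 ⟨le_rfl, by norm_num⟩)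
  have hB0' : 0 ≤ B' := (norm_nonneg _).trans (hB' 0 ⟨le_rfl, by norm_num⟩)
  have hw0 : w q = 0 := by
    by_contra hne
    have hpos : 0 < |w q| := abs_pos.2 hne
    set ε := |w q| / (2 * (4 * B + 2 * B' + 1)) with hε
    have hεpos : 0 < ε := by positivity
    have hev : ∀ᶠ t in 𝓝[>] (0 : ℝ), |f t| < ε := by
      have := h0.abs
      rw [abs_zero] at this
      exact this.eventually (gt_mem_nhds hεpos)
    obtain ⟨δ, hδ, hsub⟩ := mem_nhdsGT_iff_exists_Ioo_subset.1 hev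
    have hδ0 : 0 < δ := hδ
    set s := min δ 1 / 3 with hs
    have hs0 : 0 < s := by positivity
    have hs1 : 2 * s < δ := by
      have := min_le_left δ 1
      rw [hs]; linarith
    have hs2 : 2 * s ≤ 1 := by
      have := min_le_right δ 1
      rw [hs]; linarith
    -- Nothing is assumed about `f'` near `0`, but the mean value theorem on `[s, 2s]` supplies a
    -- point with `|c f'(c)| ≤ 2 |f(2s) - f(s)|`.
    obtain ⟨c, hc, hcs⟩ := exists_hasDerivAt_eq_slope f f' (a := s) (b := 2 * s) (by linarith)
      (fun t ht => (hf t (hs0.trans_le ht.1)).continuousAt.continuousWithinAt)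
      (fun t ht => hf t (hs0.trans ht.1))
    have hc0 : 0 < c := hs0.trans hc.1
    have e1 : f' c * s = f (2 * s) - f s := by
      rw [hcs]; field_simp; ring
    have f1 : |f s| < ε := hsub ⟨hs0, by linarith⟩
    have f2 : |f (2 * s)| < ε := hsub ⟨by linarith, hs1⟩
    have f3 : |f c| < ε := hsub ⟨hc0, hc.2.trans hs1⟩
    have h1 : |c * f' c| ≤ 4 * ε := by
      have h2 : |f' c| * s ≤ 2 * ε := by
        have e2 : |f' c| * s = |f' c * s| := by rw [abs_mul, abs_of_pos hs0]
        rw [e2, e1]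
        exact (abs_sub _ _).trans (by linarith)
      rw [abs_mul, abs_of_pos hc0]
      nlinarith [abs_nonneg (f' c), hc.2]
    have hcm : c ∈ Icc (0 : ℝ) 2 := ⟨hc0.le, by linarith [hc.2]⟩
    have h3 : |w q| ≤ 4 * ε * B + ε * (2 * B') := by
      rw [hwc q c hq hc0, hw]
      refine (abs_sub _ _).trans (add_le_add ?_ ?_)
      · rw [abs_mul]
        exact mul_le_mul h1 (hB c hcm) (abs_nonneg _) (by positivity)
      · rw [abs_mul, abs_mul c, abs_of_pos hc0]
        refine mul_le_mul f3.le ?_ (by positivity) hεpos.le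
        exact mul_le_mul hcm.2 (hB' c hcm) (abs_nonneg _) (by norm_num)
    have h4 : ε * (2 * (4 * B + 2 * B' + 1)) = |w q| := by rw [hε]; field_simp
    nlinarith
  have hHd : ∀ t, 0 < t → HasDerivAt (fun t => f t / seriesI t) 0 t := by
    intro t ht
    have := (hf t ht).fun_div (hasDerivAt_seriesI t) (seriesI_pos ht.le).ne'
    refine this.congr_deriv ?_
    have h2 : t * (f' t * seriesI t - f t * seriesI' t) = 0 := by
      rw [← hw0, hwc q t hq ht, hw]; ring
    rw [(mul_eq_zero.1 h2).resolve_left ht.ne', zero_div]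
  have hHc : ∀ t, 0 < t → f t / seriesI t = f q / seriesI q := fun t ht =>
    isOpen_Ioi.is_const_of_deriv_eq_zero (convex_Ioi (0 : ℝ)).isPreconnected
      (fun r hr => (hHd r hr).differentiableAt.differentiableWithinAt)
      (fun r hr => (hHd r hr).deriv) ht hq
  have hI : Tendsto seriesI (𝓝[>] 0) (𝓝 1) := by
    have := (hasDerivAt_seriesI 0).continuousAt.tendsto
    rw [seriesI_zero] at this
    exact this.mono_left nhdsWithin_le_nhds
  have hlim := h0.div hI one_ne_zero
  rw [zero_div] at hlim
  have hconst : Tendsto (f / seriesI) (𝓝[>] 0) (𝓝 (f q / seriesI q)) := by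
    refine tendsto_const_nhds.congr' ?_
    filter_upwards [self_mem_nhdsWithin] with t ht using (hHc t ht).symm
  have h5 := tendsto_nhds_unique hconst hlim
  exact (div_eq_zero_iff.1 h5).resolve_right (seriesI_pos hq.le).ne'


/-! ### The integral for `K₀` and its logarithmic behaviour at the origin -/

/-- The integrand of `besselMoment`. -/
noncomputable def besselKernel (m : ℕ) (q v : ℝ) : ℝ := Real.exp (-v - q / v) * (v ^ m)⁻¹

/-- The integrals `∫ exp (-v - q / v) v⁻ᵐ dv` over `(0, ∞)`; for `m = 1` this is `2 K₀(2 √q)`. -/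
noncomputable def besselMoment (m : ℕ) (q : ℝ) : ℝ := ∫ v in Ioi (0 : ℝ), besselKernel m q v

theorem besselKernel_nonneg (m : ℕ) (q : ℝ) {v : ℝ} (hv : 0 < v) : 0 ≤ besselKernel m q v := by
  rw [besselKernel]; positivity

/-- One term of the exponential series, `(q / v)^m / m! ≤ exp (q / v)`, lets the factor `exp (-q /
v)` absorb the pole `v⁻ᵐ`. -/
theorem besselKernel_le (m : ℕ) {q v : ℝ} (hq : 0 < q) (hv : 0 < v) :
    besselKernel m q v ≤ (m ! : ℝ) / q ^ m * Real.exp (-v) := by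
  have h1 := Real.pow_div_factorial_le_exp (q / v) (by positivity) m
  have h2 : (v ^ m)⁻¹ ≤ (m ! : ℝ) / q ^ m * Real.exp (q / v) := by
    calc (v ^ m)⁻¹ = (m ! : ℝ) / q ^ m * ((q / v) ^ m / (m ! : ℝ)) := by
          rw [div_pow]; field_simp
      _ ≤ _ := by gcongr
  calc besselKernel m q v ≤ Real.exp (-v - q / v) * ((m ! : ℝ) / q ^ m * Real.exp (q / v)) := by
        rw [besselKernel]; gcongr
    _ = (m ! : ℝ) / q ^ m * (Real.exp (-v - q / v) * Real.exp (q / v)) := by ring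
    _ = _ := by rw [← Real.exp_add, sub_add_cancel]

theorem continuousOn_besselKernel (m : ℕ) (q : ℝ) : ContinuousOn (besselKernel m q) (Ioi 0) := by
  have h0 : ∀ v ∈ Ioi (0 : ℝ), v ≠ 0 := fun v hv => ne_of_gt hv
  unfold besselKernel
  refine ContinuousOn.mul (ContinuousOn.rexp ?_) (ContinuousOn.inv₀ (by fun_prop) fun v hv => ?_)
  · exact (continuousOn_id.neg).sub (continuousOn_const.div continuousOn_id h0)
  · exact pow_ne_zero _ (h0 v hv)

theorem integrableOn_exp_neg : IntegrableOn (fun v : ℝ => Real.exp (-v)) (Ioi 0) := by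
  simpa using exp_neg_integrableOn_Ioi 0 one_pos

theorem integrableOn_besselKernel (m : ℕ) {q : ℝ} (hq : 0 < q) :
    IntegrableOn (besselKernel m q) (Ioi 0) := by
  refine Integrable.mono' (integrableOn_exp_neg.const_mul ((m ! : ℝ) / q ^ m))
    ((continuousOn_besselKernel m q).aestronglyMeasurable measurableSet_Ioi) ?_
  filter_upwards [ae_restrict_mem measurableSet_Ioi] with v hv
  rw [Real.norm_of_nonneg (besselKernel_nonneg m q hv)]
  exact besselKernel_le m hq hv

theorem hasDerivAt_besselMoment (m : ℕ) {q : ℝ} (hq : 0 < q) :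
    HasDerivAt (besselMoment m) (-besselMoment (m + 1) q) q := by
  have hb : IntegrableOn (fun v : ℝ => ((m + 1)! : ℝ) / (q / 2) ^ (m + 1) * Real.exp (-v))
      (Ioi 0) := integrableOn_exp_neg.const_mul _
  have key := hasDerivAt_integral_of_dominated_loc_of_deriv_le (μ := volume.restrict (Ioi (0 : ℝ)))
    (F := besselKernel m) (F' := fun q v => -besselKernel (m + 1) q v) (x₀ := q) (s := Ioi (q / 2))
    (bound := fun v => ((m + 1)! : ℝ) / (q / 2) ^ (m + 1) * Real.exp (-v))
    (Ioi_mem_nhds (by linarith))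
    (Eventually.of_forall fun p =>
      (continuousOn_besselKernel m p).aestronglyMeasurable measurableSet_Ioi)
    (integrableOn_besselKernel m hq)
    ((continuousOn_besselKernel (m + 1) q).neg.aestronglyMeasurable measurableSet_Ioi) ?_ hb ?_
  · refine key.2.congr_deriv ?_
    rw [integral_neg, besselMoment]
  · filter_upwards [ae_restrict_mem measurableSet_Ioi] with v hv p hp
    have hp' : q / 2 < p := hp
    have hv' : 0 < v := hv
    rw [norm_neg, Real.norm_of_nonneg (besselKernel_nonneg _ p hv)]
    refine (besselKernel_le (m + 1) (by linarith : 0 < p) hv).trans ?_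
    gcongr
  · filter_upwards [ae_restrict_mem measurableSet_Ioi] with v hv p hp
    have hv' : v ≠ 0 := ne_of_gt hv
    have h1 := ((((hasDerivAt_id p).div_const v).const_sub (-v)).exp).mul_const (v ^ m)⁻¹
    refine h1.congr_deriv ?_
    rw [besselKernel, pow_succ]
    simp only [id_eq]
    field_simp

/-- The difference of the integrands is the derivative of `exp (-v - q / v) / v`, which vanishes at
both ends. Since differentiation in `q` raises the index, this is again the equation `(q y')' = y`.
-/
theorem besselMoment_recurrence {q : ℝ} (hq : 0 < q) :
    q * besselMoment 3 q = besselMoment 1 q + besselMoment 2 q := by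
  have i1 := integrableOn_besselKernel 1 hq
  have i2 := integrableOn_besselKernel 2 hq
  have i3 := (integrableOn_besselKernel 3 hq).const_mul q
  have hle : ∀ v : ℝ, 0 < v → besselKernel 1 q v ≤ 2 / q ^ 2 * v := by
    intro v hv
    have h1 := besselKernel_le 2 hq hv
    have h2 : besselKernel 1 q v = besselKernel 2 q v * v := by
      rw [besselKernel, besselKernel]; field_simp
    rw [h2]
    gcongr
    refine h1.trans ?_
    have : Real.exp (-v) ≤ 1 := Real.exp_le_one_iff.2 (by linarith)
    have h3 : (0 : ℝ) ≤ 2 / q ^ 2 := by positivity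
    have h4 : ((2 ! : ℕ) : ℝ) = 2 := by norm_num [Nat.factorial]
    rw [h4]
    nlinarith
  -- By `0⁻¹ = 0` the value at `v = 0` agrees with the limit there, so the kernel is continuous up
  -- to the endpoint.
  have hzero : besselKernel 1 q 0 = 0 := by simp [besselKernel]
  have key := integral_Ioi_of_hasDerivAt_of_tendsto (a := (0 : ℝ)) (f := besselKernel 1 q)
    (f' := fun v => q * besselKernel 3 q v - besselKernel 1 q v - besselKernel 2 q v) (m := 0)
    ?_ ?_ ((i3.sub i1).sub i2) ?_
  · have h1 := integral_sub (i3.sub i1) i2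
    have h2 := integral_sub i3 i1
    simp only [Pi.sub_apply] at h1 h2
    rw [hzero, sub_zero, h1, h2, integral_const_mul] at key
    simp only [besselMoment]
    linarith
  · rw [ContinuousWithinAt, hzero]
    have hlim : Tendsto (fun v : ℝ => 2 / q ^ 2 * v) (𝓝[Ici 0] 0) (𝓝 0) := by
      have : Tendsto (fun v : ℝ => 2 / q ^ 2 * v) (𝓝 0) (𝓝 (2 / q ^ 2 * 0)) :=
        (continuous_const.mul continuous_id).tendsto 0
      rw [mul_zero] at this
      exact this.mono_left nhdsWithin_le_nhds
    refine tendsto_of_tendsto_of_tendsto_of_le_of_le' tendsto_const_nhds hlim ?_ ?_ <;>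
      filter_upwards [self_mem_nhdsWithin] with v hv
    · rcases (show (0 : ℝ) ≤ v from hv).eq_or_lt with rfl | hv
      · rw [hzero]
      · exact besselKernel_nonneg _ _ hv
    · rcases (show (0 : ℝ) ≤ v from hv).eq_or_lt with rfl | hv
      · rw [hzero, mul_zero]
      · exact hle v hv
  · intro v hv
    have hv' : v ≠ 0 := ne_of_gt hv
    have h1 := (((hasDerivAt_neg v).fun_sub ((hasDerivAt_const v q).fun_div (hasDerivAt_id v) hv')).exp).fun_mul
      ((hasDerivAt_pow 1 v).fun_inv (pow_ne_zero 1 hv'))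
    refine h1.congr_deriv ?_
    simp only [besselKernel, id_eq]
    field_simp
    ring
  · refine tendsto_of_tendsto_of_tendsto_of_le_of_le' tendsto_const_nhds tendsto_inv_atTop_zero ?_ ?_ <;>
      filter_upwards [eventually_gt_atTop 0] with v hv
    · exact besselKernel_nonneg _ _ hv
    · rw [besselKernel, pow_one]
      have h3 : Real.exp (-v - q / v) ≤ 1 := Real.exp_le_one_iff.2 (by
        have : 0 < q / v := by positivity
        linarith)
      exact mul_le_of_le_one_left (by positivity) h3

/-- The involution `v ↦ r² / v` swaps the two sides of `r` and preserves `exp (-v - r² / v) dv / v`.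
On the side `v > r` the quotient `r / v` is at most `1`, as the domination for `r → 0` requires. -/
theorem half_besselMoment_one {r : ℝ} (hr : 0 < r) :
    1 / 2 * besselMoment 1 (r ^ 2) = ∫ v in Ioi r, besselKernel 1 (r ^ 2) v := by
  have hint := integrableOn_besselKernel 1 (show 0 < r ^ 2 by positivity)
  have himg : (fun v => r ^ 2 / v) '' Ioi r = Ioo 0 r := by
    ext u
    constructor
    · rintro ⟨v, hv, rfl⟩
      have hv' : r < v := hv
      have hv0 : 0 < v := hr.trans hv'
      refine ⟨by positivity, ?_⟩
      rw [div_lt_iff₀ hv0]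
      nlinarith
    · rintro ⟨h0, h1⟩
      refine ⟨r ^ 2 / u, ?_, ?_⟩
      · change r < r ^ 2 / u
        rw [lt_div_iff₀ h0]
        nlinarith
      · field_simp
  have hcv := integral_image_eq_integral_abs_deriv_smul (s := Ioi r) (f := fun v => r ^ 2 / v)
    (f' := fun v => -(r ^ 2) / v ^ 2) measurableSet_Ioi (fun v hv => ?_) (fun u hu v hv huv => ?_)
    (besselKernel 1 (r ^ 2))
  · rw [himg] at hcv
    have h2 : ∫ v in Ioi r, |-(r ^ 2) / v ^ 2| • besselKernel 1 (r ^ 2) (r ^ 2 / v) =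
        ∫ v in Ioi r, besselKernel 1 (r ^ 2) v := by
      refine setIntegral_congr_fun measurableSet_Ioi fun v hv => ?_
      have hv0 : 0 < v := hr.trans hv
      have h3 : |-(r ^ 2) / v ^ 2| = r ^ 2 / v ^ 2 := by
        rw [neg_div, abs_neg, abs_of_nonneg (by positivity)]
      have h4 : -(r ^ 2 / v) - r ^ 2 / (r ^ 2 / v) = -v - r ^ 2 / v := by
        field_simp; ring
      rw [h3, smul_eq_mul, besselKernel, besselKernel, h4]
      field_simp
    have h5 : besselMoment 1 (r ^ 2) =
        (∫ v in Ioo 0 r, besselKernel 1 (r ^ 2) v) + ∫ v in Ioi r, besselKernel 1 (r ^ 2) v := by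
      rw [besselMoment, ← Ioc_union_Ioi_eq_Ioi hr.le, setIntegral_union
        (Ioc_disjoint_Ioi le_rfl) measurableSet_Ioi
        (hint.mono_set Ioc_subset_Ioi_self) (hint.mono_set (Ioi_subset_Ioi hr.le)),
        integral_Ioc_eq_integral_Ioo]
    rw [h5, hcv, h2]
    ring
  · have hv0 : v ≠ 0 := ne_of_gt (hr.trans hv)
    have := (hasDerivAt_const v (r ^ 2)).fun_div (hasDerivAt_id v) hv0
    refine (this.congr_deriv ?_).hasDerivWithinAt
    simp
  · have hu0 : u ≠ 0 := ne_of_gt (hr.trans hu)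
    have hv0 : v ≠ 0 := ne_of_gt (hr.trans hv)
    have hr2 : r ^ 2 ≠ 0 := by positivity
    have h1 : r ^ 2 / u = r ^ 2 / v := huv
    rw [div_eq_div_iff hu0 hv0] at h1
    exact (mul_left_cancel₀ hr2 h1).symm

theorem integrableOn_exp_neg_mul_log :
    IntegrableOn (fun v : ℝ => Real.exp (-v) * Real.log v) (Ioi 0) := by
  have h1 := Real.GammaIntegral_convergent (s := 2) (by norm_num)
  have h2 := (Real.GammaIntegral_convergent (s := 1 / 2) (by norm_num)).const_mul 2
  refine Integrable.mono' (h1.add h2) ?_ ?_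
  · refine ContinuousOn.aestronglyMeasurable ?_ measurableSet_Ioi
    exact (Continuous.continuousOn (by fun_prop)).mul
      (Real.continuousOn_log.mono fun v hv => ne_of_gt hv)
  · filter_upwards [ae_restrict_mem measurableSet_Ioi] with v hv
    have hv0 : 0 < v := hv
    have h3 : |Real.log v| ≤ v ^ ((2 : ℝ) - 1) + 2 * v ^ ((1 / 2 : ℝ) - 1) := by
      have hp : 0 ≤ v ^ ((1 / 2 : ℝ) - 1) := by positivity
      have hv1 : v ^ ((2 : ℝ) - 1) = v := by norm_num
      rw [hv1, abs_le]
      constructor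
      · have := Real.log_le_rpow_div (inv_nonneg.2 hv0.le) (show (0 : ℝ) < 1 / 2 by norm_num)
        rw [Real.log_inv, Real.inv_rpow hv0.le, ← Real.rpow_neg hv0.le] at this
        have h4 : (1 / 2 : ℝ) - 1 = -(1 / 2) := by norm_num
        rw [h4]
        linarith
      · have := Real.log_le_sub_one_of_pos hv0
        linarith
    rw [Real.norm_eq_abs, abs_mul, Real.abs_exp]
    calc Real.exp (-v) * |Real.log v| ≤
          Real.exp (-v) * (v ^ ((2 : ℝ) - 1) + 2 * v ^ ((1 / 2 : ℝ) - 1)) := by gcongr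
      _ = _ := by simp only [Pi.add_apply]; ring

/-- The integral is `Γ'(1)`, by differentiation of the Gamma integral. -/
theorem integral_exp_neg_mul_log :
    ∫ v in Ioi (0 : ℝ), Real.exp (-v) * Real.log v = -Real.eulerMascheroniConstant := by
  have h1 := Complex.hasDerivAt_GammaIntegral (s := 1) (by simp)
  have h2 : Complex.GammaIntegral =ᶠ[𝓝 1] Complex.Gamma := by
    have : {z : ℂ | 0 < z.re} ∈ 𝓝 (1 : ℂ) :=
      (isOpen_lt continuous_const Complex.continuous_re).mem_nhds (by simp)
    filter_upwards [this] with z hz using (Complex.Gamma_eq_integral hz).symm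
  have h3 := (Complex.hasDerivAt_Gamma_one.congr_of_eventuallyEq h2).unique h1
  have h4 : ∫ t : ℝ in Ioi 0, (t : ℂ) ^ ((1 : ℂ) - 1) * (Real.log t * Real.exp (-t)) =
      ((∫ v in Ioi (0 : ℝ), Real.exp (-v) * Real.log v : ℝ) : ℂ) := by
    rw [← integral_complex_ofReal]
    refine integral_congr_ae (Eventually.of_forall fun t => ?_)
    simp [mul_comm]
  rw [h4] at h3
  exact_mod_cast h3.symm

theorem abs_one_sub_mul_exp_mul_log_le {r v : ℝ} (hr : 0 < r) (hv : r < v) :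
    |(1 - r ^ 2 / v ^ 2) * Real.exp (-v - r ^ 2 / v) * Real.log v| ≤
      |Real.exp (-v) * Real.log v| := by
  have hv0 : 0 < v := hr.trans hv
  rw [abs_mul, abs_mul, abs_mul, Real.abs_exp, Real.abs_exp]
  have h1 : |1 - r ^ 2 / v ^ 2| ≤ 1 := by
    have h2 : r ^ 2 / v ^ 2 ≤ 1 := by
      rw [div_le_one (by positivity)]; gcongr
    have h3 : 0 ≤ r ^ 2 / v ^ 2 := by positivity
    rw [abs_le]; constructor <;> linarith
  have h2 : Real.exp (-v - r ^ 2 / v) ≤ Real.exp (-v) := by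
    apply Real.exp_le_exp.2
    have : 0 ≤ r ^ 2 / v := by positivity
    linarith
  gcongr
  calc |1 - r ^ 2 / v ^ 2| * Real.exp (-v - r ^ 2 / v) ≤ 1 * Real.exp (-v) := by gcongr
    _ = _ := one_mul _

theorem continuousOn_one_sub_mul_exp_mul_log (r : ℝ) :
    ContinuousOn (fun v : ℝ => (1 - r ^ 2 / v ^ 2) * Real.exp (-v - r ^ 2 / v) * Real.log v)
      (Ioi 0) := by
  have h0 : ∀ v ∈ Ioi (0 : ℝ), v ≠ 0 := fun v hv => ne_of_gt hv
  refine ContinuousOn.mul (ContinuousOn.mul ?_ (ContinuousOn.rexp ?_)) (Real.continuousOn_log.mono h0)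
  · exact continuousOn_const.sub (continuousOn_const.div (by fun_prop) fun v hv =>
      pow_ne_zero 2 (h0 v hv))
  · exact continuousOn_id.neg.sub (continuousOn_const.div continuousOn_id h0)

theorem integrableOn_one_sub_mul_exp_mul_log {r : ℝ} (hr : 0 < r) :
    IntegrableOn (fun v : ℝ => (1 - r ^ 2 / v ^ 2) * Real.exp (-v - r ^ 2 / v) * Real.log v)
      (Ioi r) := by
  refine Integrable.mono (integrableOn_exp_neg_mul_log.mono_set (Ioi_subset_Ioi hr.le))
    (((continuousOn_one_sub_mul_exp_mul_log r).mono
      (Ioi_subset_Ioi hr.le)).aestronglyMeasurable measurableSet_Ioi) ?_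
  filter_upwards [ae_restrict_mem measurableSet_Ioi] with v hv
  exact abs_one_sub_mul_exp_mul_log_le hr hv

/-- Integrating `1 / v = (log v)'` by parts puts the logarithmic singularity in the boundary term;
what remains converges to `-γ` as `r → 0`. -/
theorem integral_besselKernel_by_parts {r : ℝ} (hr : 0 < r) :
    ∫ v in Ioi r, besselKernel 1 (r ^ 2) v = -(Real.exp (-(2 * r)) * Real.log r) +
      ∫ v in Ioi r, (1 - r ^ 2 / v ^ 2) * Real.exp (-v - r ^ 2 / v) * Real.log v := by
  have hint := (integrableOn_besselKernel 1 (show 0 < r ^ 2 by positivity)).mono_set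
    (Ioi_subset_Ioi hr.le)
  have hder : ∀ v : ℝ, 0 < v → HasDerivAt (fun v => Real.exp (-v - r ^ 2 / v))
      (-((1 - r ^ 2 / v ^ 2) * Real.exp (-v - r ^ 2 / v))) v := by
    intro v hv
    have h1 := ((hasDerivAt_neg v).fun_sub
      ((hasDerivAt_const v (r ^ 2)).fun_div (hasDerivAt_id v) hv.ne')).exp
    refine h1.congr_deriv ?_
    simp only [id_eq]
    ring
  have key := integral_Ioi_mul_deriv_eq_deriv_mul (a := r) (u := fun v => Real.exp (-v - r ^ 2 / v))
    (u' := fun v => -((1 - r ^ 2 / v ^ 2) * Real.exp (-v - r ^ 2 / v))) (v := Real.log)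
    (v' := fun v => v⁻¹) (a' := Real.exp (-(2 * r)) * Real.log r) (b' := 0)
    (fun v hv => hder v (hr.trans hv)) (fun v hv => Real.hasDerivAt_log (ne_of_gt (hr.trans hv)))
    ?_ ?_ ?_ ?_
  · have h1 : ∀ v : ℝ, besselKernel 1 (r ^ 2) v = Real.exp (-v - r ^ 2 / v) * v⁻¹ := fun v => by
      rw [besselKernel, pow_one]
    simp only [h1, key, neg_mul, integral_neg]
    ring
  · refine hint.congr_fun (fun v _ => ?_) measurableSet_Ioi
    simp [besselKernel]
  · refine (integrableOn_one_sub_mul_exp_mul_log hr).neg.congr_fun (fun v _ => ?_) measurableSet_Ioi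
    simp
  · have h1 : ContinuousAt (fun v => Real.exp (-v - r ^ 2 / v) * Real.log v) r :=
      (hder r hr).continuousAt.mul (Real.continuousAt_log hr.ne')
    have h2 : Real.exp (-r - r ^ 2 / r) * Real.log r = Real.exp (-(2 * r)) * Real.log r := by
      congr 2
      field_simp
      ring
    have := h1.tendsto
    rw [h2] at this
    exact this.mono_left nhdsWithin_le_nhds
  · have h1 : Tendsto (fun v : ℝ => v ^ 1 * Real.exp (-v)) atTop (𝓝 0) :=
      Real.tendsto_pow_mul_exp_neg_atTop_nhds_zero 1
    refine squeeze_zero_norm' ?_ h1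
    filter_upwards [eventually_ge_atTop 1] with v hv
    have hv0 : 0 < v := by linarith
    have h2 : Real.log v ≤ v := (Real.log_le_sub_one_of_pos hv0).trans (by linarith)
    have h3 : Real.exp (-v - r ^ 2 / v) ≤ Real.exp (-v) := by
      apply Real.exp_le_exp.2
      have : 0 ≤ r ^ 2 / v := by positivity
      linarith
    rw [Pi.mul_apply, norm_mul, Real.norm_eq_abs, Real.norm_eq_abs, Real.abs_exp,
      abs_of_nonneg (Real.log_nonneg hv), pow_one, mul_comm v]
    exact mul_le_mul h3 h2 (Real.log_nonneg hv) (Real.exp_nonneg _)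

theorem tendsto_integral_one_sub_mul_exp_mul_log :
    Tendsto (fun r : ℝ => ∫ v in Ioi r, (1 - r ^ 2 / v ^ 2) * Real.exp (-v - r ^ 2 / v) * Real.log v)
      (𝓝[>] 0) (𝓝 (-Real.eulerMascheroniConstant)) := by
  have key := tendsto_integral_filter_of_dominated_convergence (μ := volume.restrict (Ioi (0 : ℝ)))
    (l := 𝓝[>] (0 : ℝ))
    (F := fun r v => (Ioi r).indicator
      (fun v => (1 - r ^ 2 / v ^ 2) * Real.exp (-v - r ^ 2 / v) * Real.log v) v)
    (f := fun v => Real.exp (-v) * Real.log v) (fun v => ‖Real.exp (-v) * Real.log v‖) ?_ ?_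
    integrableOn_exp_neg_mul_log.norm ?_
  · rw [integral_exp_neg_mul_log] at key
    refine key.congr' ?_
    filter_upwards [self_mem_nhdsWithin] with r hr
    rw [integral_indicator measurableSet_Ioi, Measure.restrict_restrict measurableSet_Ioi,
      inter_eq_left.2 (Ioi_subset_Ioi (le_of_lt hr))]
  · filter_upwards with r
    exact ((continuousOn_one_sub_mul_exp_mul_log r).aestronglyMeasurable measurableSet_Ioi).indicator
      measurableSet_Ioi
  · filter_upwards [self_mem_nhdsWithin] with r hr
    filter_upwards with v
    by_cases hv : v ∈ Ioi r
    · rw [indicator_of_mem hv]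
      exact abs_one_sub_mul_exp_mul_log_le hr hv
    · rw [indicator_of_notMem hv, norm_zero]
      exact norm_nonneg _
  · filter_upwards [ae_restrict_mem measurableSet_Ioi] with v hv
    have hv0 : 0 < v := hv
    have hc : Continuous fun r : ℝ =>
        (1 - r ^ 2 / v ^ 2) * Real.exp (-v - r ^ 2 / v) * Real.log v := by fun_prop
    have h1 := hc.tendsto 0
    simp only [ne_eq, OfNat.ofNat_ne_zero, not_false_eq_true, zero_pow, zero_div, sub_zero,
      one_mul] at h1
    refine (h1.mono_left nhdsWithin_le_nhds).congr' ?_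
    have h2 : ∀ᶠ r in 𝓝[>] (0 : ℝ), r < v := (gt_mem_nhds hv0).filter_mono nhdsWithin_le_nhds
    filter_upwards [h2] with r hr
    rw [indicator_of_mem (show v ∈ Ioi r from hr)]

theorem tendsto_half_besselMoment :
    Tendsto (fun q => 1 / 2 * besselMoment 1 q + 1 / 2 * Real.log q) (𝓝[>] 0)
      (𝓝 (-Real.eulerMascheroniConstant)) := by
  have hs : Tendsto Real.sqrt (𝓝[>] 0) (𝓝[>] 0) := by
    refine tendsto_nhdsWithin_iff.2 ⟨?_, ?_⟩
    · have := Real.continuous_sqrt.tendsto 0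
      rw [Real.sqrt_zero] at this
      exact this.mono_left nhdsWithin_le_nhds
    · filter_upwards [self_mem_nhdsWithin] with q hq using Real.sqrt_pos.2 hq
  have h1 : Tendsto (fun r : ℝ => (1 - Real.exp (-(2 * r))) * Real.log r) (𝓝[>] 0) (𝓝 0) := by
    have hlog : Tendsto (fun r : ℝ => 2 * |r * Real.log r|) (𝓝[>] 0) (𝓝 0) := by
      have := ((Real.continuous_mul_log.tendsto 0).abs).const_mul 2
      rw [zero_mul, abs_zero, mul_zero] at this
      exact this.mono_left nhdsWithin_le_nhds
    refine squeeze_zero_norm' ?_ hlog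
    filter_upwards [self_mem_nhdsWithin] with r hr
    have hr0 : 0 < r := hr
    have h2 := Real.add_one_le_exp (-(2 * r))
    have h3 : Real.exp (-(2 * r)) ≤ 1 := Real.exp_le_one_iff.2 (by linarith)
    rw [norm_mul, abs_mul, abs_of_pos hr0, Real.norm_eq_abs, Real.norm_eq_abs,
      abs_of_nonneg (by linarith : 0 ≤ 1 - Real.exp (-(2 * r))), ← mul_assoc]
    gcongr
    linarith
  have h2 := (h1.add tendsto_integral_one_sub_mul_exp_mul_log).comp hs
  rw [zero_add] at h2
  refine h2.congr' ?_
  filter_upwards [self_mem_nhdsWithin] with q hq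
  have hq0 : 0 < q := hq
  have h3 := half_besselMoment_one (Real.sqrt_pos.2 hq0)
  rw [integral_besselKernel_by_parts (Real.sqrt_pos.2 hq0)] at h3
  have h4 : Real.log (Real.sqrt q) = 1 / 2 * Real.log q := by
    rw [Real.log_sqrt hq0.le]; ring
  rw [h4] at h3
  rw [Function.comp_apply, h4]
  have h5 : besselMoment 1 q = besselMoment 1 (Real.sqrt q ^ 2) := by rw [Real.sq_sqrt hq0.le]
  rw [h5, h3]
  ring

/-- Both sides solve `(q y')' = y` and equal `-½ log q - γ + o(1)` at the origin. -/
theorem seriesK_eq_besselMoment {q : ℝ} (hq : 0 < q) : seriesK q = 1 / 2 * besselMoment 1 q := by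
  have h := eq_zero_of_bessel_ode (f := fun q => 1 / 2 * besselMoment 1 q - seriesK q)
    (f' := fun q => 1 / 2 * -besselMoment 2 q - seriesK' q)
    (fun p hp => ((hasDerivAt_besselMoment 1 hp).const_mul (1 / 2)).fun_sub (hasDerivAt_seriesK hp))
    (fun p hp => ?_) ?_ hq
  · linarith
  · have h1 := (((hasDerivAt_id p).fun_mul ((hasDerivAt_besselMoment 2 hp).fun_neg)).const_mul
      (1 / 2)).fun_sub (hasDerivAt_mul_seriesK' hp)
    have h2 := besselMoment_recurrence hp
    refine (h1.congr_deriv ?_).congr_of_eventuallyEq (Eventually.of_forall fun t => ?_)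
    · simp only [id_eq, one_mul, neg_neg]
      linarith
    · simp only [id_eq]
      ring
  · have := tendsto_half_besselMoment.sub tendsto_seriesK
    rw [sub_self] at this
    refine this.congr fun t => ?_
    ring


/-! ### The Laplace integral and the growth of `K₀` -/

/-- The weight `exp (-τ) τ ^ (-1 / 2)`. -/
noncomputable def gammaWeight (τ : ℝ) : ℝ := Real.exp (-τ) * τ ^ (-(1 / 2) : ℝ)

theorem gammaWeight_nonneg {τ : ℝ} (hτ : 0 < τ) : 0 ≤ gammaWeight τ := by
  rw [gammaWeight]; positivity

theorem integrableOn_gammaWeight : IntegrableOn gammaWeight (Ioi 0) := by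
  have h := Real.GammaIntegral_convergent (s := 1 / 2) (by norm_num)
  have h1 : (1 / 2 : ℝ) - 1 = -(1 / 2) := by norm_num
  rw [h1] at h
  exact h

/-- The Laplace-type integral for the modified Bessel function of the second kind. -/
noncomputable def besselLaplace (w : ℂ) : ℂ :=
  Complex.exp (-w) * ∫ τ in Ioi (0 : ℝ), (gammaWeight τ : ℂ) * ((τ : ℂ) + 2 * w) ^ (-(1 / 2) : ℂ)

theorem ofReal_add_mem_slitPlane {τ : ℝ} (hτ : 0 ≤ τ) {w : ℂ} (hw : w ∈ Complex.slitPlane) :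
    (τ : ℂ) + 2 * w ∈ Complex.slitPlane := by
  rw [Complex.mem_slitPlane_iff] at hw ⊢
  simp only [Complex.add_re, Complex.ofReal_re, Complex.mul_re, Complex.re_ofNat, Complex.im_ofNat,
    zero_mul, sub_zero, Complex.add_im, Complex.ofReal_im, Complex.mul_im, zero_add, add_zero]
  rcases hw with h | h
  · left; linarith
  · right; simpa using h

/-- The point `-τ / 2` is on the cut, hence at distance at least `2δ` from `w₀` and at least `δ`
from `w`. The bound is uniform in `τ`, which permits differentiation under the integral. -/
theorem norm_ofReal_add_ge {w₀ w : ℂ} {δ τ : ℝ} (hδ : Metric.ball w₀ (2 * δ) ⊆ Complex.slitPlane)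
    (hw : w ∈ Metric.ball w₀ δ) (hτ : 0 ≤ τ) : 2 * δ ≤ ‖(τ : ℂ) + 2 * w‖ := by
  have h1 : ((-(τ / 2) : ℝ) : ℂ) ∉ Metric.ball w₀ (2 * δ) := fun h => by
    have := Complex.ofReal_mem_slitPlane.1 (hδ h)
    linarith
  rw [Metric.mem_ball, dist_eq_norm, not_lt] at h1
  rw [Metric.mem_ball, dist_eq_norm] at hw
  have h2 : ((-(τ / 2) : ℝ) : ℂ) - w₀ = (w - w₀) - (1 / 2) * ((τ : ℂ) + 2 * w) := by
    push_cast; ring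
  have h3 : ‖(1 / 2 : ℂ) * ((τ : ℂ) + 2 * w)‖ = 1 / 2 * ‖(τ : ℂ) + 2 * w‖ := by
    rw [norm_mul]; norm_num
  have h4 := norm_sub_le (w - w₀) ((1 / 2) * ((τ : ℂ) + 2 * w))
  rw [← h2, h3] at h4
  linarith

theorem norm_cpow_neg_half (z : ℂ) : ‖z ^ (-(1 / 2) : ℂ)‖ = ‖z‖ ^ (-(1 / 2) : ℝ) := by
  have h : (-(1 / 2) : ℂ) = ((-(1 / 2) : ℝ) : ℂ) := by push_cast; ring
  rw [h, Complex.norm_cpow_real]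

theorem aestronglyMeasurable_laplace {w c : ℂ} (hw : w ∈ Complex.slitPlane) :
    AEStronglyMeasurable (fun τ : ℝ => (gammaWeight τ : ℂ) * ((τ : ℂ) + 2 * w) ^ c)
      (volume.restrict (Ioi 0)) := by
  refine ContinuousOn.aestronglyMeasurable ?_ measurableSet_Ioi
  refine ContinuousOn.mul ?_ ?_
  · refine Complex.continuous_ofReal.comp_continuousOn ?_
    unfold gammaWeight
    refine ContinuousOn.mul (by fun_prop) ?_
    exact continuousOn_id.rpow_const fun τ hτ => Or.inl (ne_of_gt hτ)
  · exact ContinuousOn.cpow_const (by fun_prop) fun τ hτ =>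
      ofReal_add_mem_slitPlane (le_of_lt hτ) hw

theorem differentiableAt_besselLaplace {w₀ : ℂ} (hw₀ : w₀ ∈ Complex.slitPlane) :
    DifferentiableAt ℂ besselLaplace w₀ := by
  obtain ⟨ε, hε, hball⟩ := Metric.isOpen_iff.1 Complex.isOpen_slitPlane w₀ hw₀
  set δ := ε / 2 with hδ
  have hδ0 : 0 < δ := by positivity
  have hsub : Metric.ball w₀ (2 * δ) ⊆ Complex.slitPlane := by
    have : 2 * δ = ε := by rw [hδ]; ring
    rwa [this]
  have hsub' : Metric.ball w₀ δ ⊆ Complex.slitPlane :=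
    (Metric.ball_subset_ball (by linarith)).trans hsub
  have hbd : ∀ {c : ℝ}, c ≤ 0 → ∀ w ∈ Metric.ball w₀ δ, ∀ τ : ℝ, 0 < τ →
      ‖((τ : ℂ) + 2 * w) ^ (c : ℂ)‖ ≤ (2 * δ) ^ c := fun {c} hc w hw τ hτ => by
    rw [Complex.norm_cpow_real]
    exact Real.rpow_le_rpow_of_nonpos (by positivity) (norm_ofReal_add_ge hsub hw hτ.le) hc
  have hint : IntegrableOn
      (fun τ : ℝ => (gammaWeight τ : ℂ) * ((τ : ℂ) + 2 * w₀) ^ (-(1 / 2) : ℂ)) (Ioi 0) := by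
    refine Integrable.mono' (integrableOn_gammaWeight.mul_const ((2 * δ) ^ (-(1 / 2) : ℝ)))
      (aestronglyMeasurable_laplace hw₀) ?_
    filter_upwards [ae_restrict_mem measurableSet_Ioi] with τ hτ
    have h1 := hbd (c := -(1 / 2)) (by norm_num) w₀ (Metric.mem_ball_self hδ0) τ hτ
    push_cast at h1
    rw [norm_mul, Complex.norm_real, Real.norm_of_nonneg (gammaWeight_nonneg hτ)]
    exact mul_le_mul_of_nonneg_left h1 (gammaWeight_nonneg hτ)
  have key := hasDerivAt_integral_of_dominated_loc_of_deriv_le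
    (μ := volume.restrict (Ioi (0 : ℝ))) (x₀ := w₀) (s := Metric.ball w₀ δ)
    (F := fun w (τ : ℝ) => (gammaWeight τ : ℂ) * ((τ : ℂ) + 2 * w) ^ (-(1 / 2) : ℂ))
    (F' := fun w (τ : ℝ) => -((gammaWeight τ : ℂ) * ((τ : ℂ) + 2 * w) ^ (-(3 / 2) : ℂ)))
    (bound := fun τ => gammaWeight τ * (2 * δ) ^ (-(3 / 2) : ℝ))
    (Metric.ball_mem_nhds w₀ hδ0) ?_ hint
    (aestronglyMeasurable_laplace hw₀).neg ?_
    (integrableOn_gammaWeight.mul_const _) ?_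
  · exact (differentiableAt_id.neg.cexp).mul key.2.differentiableAt
  · filter_upwards [Metric.ball_mem_nhds w₀ hδ0] with w hw
    exact aestronglyMeasurable_laplace (hsub' hw)
  · filter_upwards [ae_restrict_mem measurableSet_Ioi] with τ hτ w hw
    have h1 := hbd (c := -(3 / 2)) (by norm_num) w hw τ hτ
    push_cast at h1
    rw [norm_neg, norm_mul, Complex.norm_real, Real.norm_of_nonneg (gammaWeight_nonneg hτ)]
    exact mul_le_mul_of_nonneg_left h1 (gammaWeight_nonneg hτ)
  · filter_upwards [ae_restrict_mem measurableSet_Ioi] with τ hτ w hw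
    have h1 := ((((hasDerivAt_id w).const_mul 2).const_add (τ : ℂ)).cpow_const
      (c := (-(1 / 2) : ℂ)) (ofReal_add_mem_slitPlane (le_of_lt hτ) (hsub' hw))).const_mul
      (gammaWeight τ : ℂ)
    refine h1.congr_deriv ?_
    have h2 : (-(1 / 2) : ℂ) - 1 = -(3 / 2) := by norm_num
    rw [h2]
    simp only [id_eq]
    ring

theorem rpow_neg_half_sq {y : ℝ} (hy : 0 ≤ y) : (y ^ 2) ^ (-(1 / 2) : ℝ) = y⁻¹ := by
  rw [Real.rpow_neg (by positivity), ← Real.sqrt_eq_rpow, Real.sqrt_sq hy]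

/-- The substitution `τ = (v - r)² / v` in the integral `∫ exp (-v - r² / v) / v dv`. -/
theorem integral_besselKernel_eq_laplace {r : ℝ} (hr : 0 < r) :
    ∫ v in Ioi r, besselKernel 1 (r ^ 2) v =
      Real.exp (-(2 * r)) *
        ∫ τ in Ioi (0 : ℝ), gammaWeight τ * (τ + 4 * r) ^ (-(1 / 2) : ℝ) := by
  have himg : (fun v => (v - r) ^ 2 / v) '' Ioi r = Ioi 0 := by
    ext τ
    constructor
    · rintro ⟨v, hv, rfl⟩
      have hv' : r < v := hv
      have h1 : 0 < v - r := by linarith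
      have h2 : 0 < v := hr.trans hv'
      change 0 < (v - r) ^ 2 / v
      positivity
    · intro hτ
      have hτ0 : 0 < τ := hτ
      -- The equation `(v - r)² = τ v` is quadratic in `v` with discriminant `τ (τ + 4r)`; its
      -- larger root exceeds `r`.
      set d := Real.sqrt (τ * (τ + 4 * r)) with hd
      have hd2 : d ^ 2 = τ * (τ + 4 * r) := Real.sq_sqrt (by positivity)
      have hd0 : 0 ≤ d := Real.sqrt_nonneg _
      have hv : 0 < (2 * r + τ + d) / 2 := by positivity
      refine ⟨(2 * r + τ + d) / 2, ?_, ?_⟩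
      · change r < (2 * r + τ + d) / 2
        linarith
      · beta_reduce
        rw [div_eq_iff hv.ne']
        linear_combination (1 / 4) * hd2
  have hcv := integral_image_eq_integral_abs_deriv_smul (s := Ioi r)
    (f := fun v => (v - r) ^ 2 / v) (f' := fun v => (v ^ 2 - r ^ 2) / v ^ 2) measurableSet_Ioi
    (fun v hv => ?_) (fun u hu v hv huv => ?_)
    (fun τ => gammaWeight τ * (τ + 4 * r) ^ (-(1 / 2) : ℝ))
  · rw [himg] at hcv
    rw [hcv, ← integral_const_mul]
    refine setIntegral_congr_fun measurableSet_Ioi fun v hv => ?_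
    have hv' : r < v := hv
    have hv0 : 0 < v := hr.trans hv'
    have hvr : 0 < v - r := by linarith
    have h1 : |(v ^ 2 - r ^ 2) / v ^ 2| = (v ^ 2 - r ^ 2) / v ^ 2 :=
      abs_of_nonneg (div_nonneg (by nlinarith) (by positivity))
    have h2 : (v - r) ^ 2 / v + 4 * r = (v + r) ^ 2 / v := by field_simp; ring
    have h3 : ((v - r) ^ 2 / v) ^ (-(1 / 2) : ℝ) * ((v + r) ^ 2 / v) ^ (-(1 / 2) : ℝ) =
        ((v - r) * (v + r) / v)⁻¹ := by
      rw [← Real.mul_rpow (by positivity) (by positivity), ← rpow_neg_half_sq (by positivity)]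
      congr 1
      field_simp
    have h4 : Real.exp (-v - r ^ 2 / v) = Real.exp (-(2 * r)) * Real.exp (-((v - r) ^ 2 / v)) := by
      rw [← Real.exp_add]
      congr 1
      field_simp
      ring
    rw [besselKernel, h4, h1, smul_eq_mul, h2, gammaWeight]
    have h5 : Real.exp (-(2 * r)) * ((v ^ 2 - r ^ 2) / v ^ 2 *
        (Real.exp (-((v - r) ^ 2 / v)) * ((v - r) ^ 2 / v) ^ (-(1 / 2) : ℝ) *
          ((v + r) ^ 2 / v) ^ (-(1 / 2) : ℝ))) =
        Real.exp (-(2 * r)) * Real.exp (-((v - r) ^ 2 / v)) * ((v ^ 2 - r ^ 2) / v ^ 2 *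
        (((v - r) ^ 2 / v) ^ (-(1 / 2) : ℝ) * ((v + r) ^ 2 / v) ^ (-(1 / 2) : ℝ))) := by ring
    rw [h5, h3]
    congr 1
    have h6 : v + r ≠ 0 := by positivity
    field_simp
    ring
  · have hv0 : v ≠ 0 := ne_of_gt (hr.trans hv)
    have := (((hasDerivAt_id v).sub_const r).fun_pow 2).fun_div (hasDerivAt_id v) hv0
    refine (this.congr_deriv ?_).hasDerivWithinAt
    simp only [id_eq]
    congr 1
    push_cast
    ring
  · have hu' : r < u := hu
    have hv' : r < v := hv
    have hu0 : 0 < u := hr.trans hu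
    have hv0 : 0 < v := hr.trans hv
    have h1 : (u - r) ^ 2 / u = (v - r) ^ 2 / v := huv
    rw [div_eq_div_iff hu0.ne' hv0.ne'] at h1
    have h2 : (u - v) * (u * v - r ^ 2) = 0 := by linear_combination h1
    have h3 : u * v - r ^ 2 ≠ 0 := by nlinarith
    exact sub_eq_zero.1 ((mul_eq_zero.1 h2).resolve_right h3)

theorem besselI0_eq_tsum (z : ℂ) : besselI0 z = ∑' k, coeffI ℂ k * (z ^ 2 / 4) ^ k :=
  tsum_congr fun k => by rw [coeffI]; ring

theorem besselK0_eq (z : ℂ) : besselK0 z =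
    -(Complex.log (z / 2) + (Real.eulerMascheroniConstant : ℂ)) * besselI0 z +
      ∑' k, coeffH ℂ k * (z ^ 2 / 4) ^ k := by
  rw [besselK0]
  congr 1
  exact tsum_congr fun k => by rw [coeffH]; ring

theorem differentiable_besselI0 : Differentiable ℂ besselI0 := by
  have h : besselI0 = fun z => ∑' k, coeffI ℂ k * (z ^ 2 / 4) ^ k := funext besselI0_eq_tsum
  rw [h]
  intro z
  have hq : DifferentiableAt ℂ (fun z : ℂ => z ^ 2 / 4) z := by fun_prop
  exact (hasDerivAt_series norm_coeffI_le (z ^ 2 / 4)).differentiableAt.comp z hq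

theorem differentiableAt_besselK0 {z : ℂ} (hz : z ∈ Complex.slitPlane) :
    DifferentiableAt ℂ besselK0 z := by
  have h : besselK0 = fun z => -(Complex.log (z / 2) + (Real.eulerMascheroniConstant : ℂ)) *
      besselI0 z + ∑' k, coeffH ℂ k * (z ^ 2 / 4) ^ k := funext besselK0_eq
  rw [h]
  have h2 : z / 2 ∈ Complex.slitPlane := by
    rw [Complex.mem_slitPlane_iff] at hz ⊢
    rcases hz with h | h
    · left; simpa using h
    · right; simpa using h
  refine DifferentiableAt.fun_add (DifferentiableAt.fun_mul ?_ (differentiable_besselI0 z)) ?_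
  · exact (((differentiableAt_id.div_const 2).clog h2).add_const _).neg
  · have hq : DifferentiableAt ℂ (fun z : ℂ => z ^ 2 / 4) z := by fun_prop
    exact (hasDerivAt_series norm_coeffH_le (z ^ 2 / 4)).differentiableAt.comp z hq

theorem besselK0_ofReal {x : ℝ} (hx : 0 < x) : besselK0 x = (seriesK (x ^ 2 / 4) : ℂ) := by
  have hlog : Complex.log ((x : ℂ) / 2) = ((1 / 2 * Real.log (x ^ 2 / 4) : ℝ) : ℂ) := by
    have h1 : (x : ℂ) / 2 = ((x / 2 : ℝ) : ℂ) := by push_cast; ring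
    have h2 : x ^ 2 / 4 = (x / 2) ^ 2 := by ring
    rw [h1, ← Complex.ofReal_log (by positivity), h2, Real.log_pow]
    congr 1
    push_cast
    ring
  rw [besselK0_eq, besselI0_eq_tsum, hlog, seriesK, seriesI, seriesH]
  push_cast
  congr 2
  · refine tsum_congr fun k => ?_
    simp [coeffI]
  · funext k
    simp [coeffH]

theorem besselLaplace_ofReal {x : ℝ} (hx : 0 < x) : besselLaplace x = besselK0 x := by
  have hr : 0 < x / 2 := by positivity
  have h1 := half_besselMoment_one hr
  have h2 : (x / 2) ^ 2 = x ^ 2 / 4 := by ring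
  rw [integral_besselKernel_eq_laplace hr, h2, ← seriesK_eq_besselMoment (by positivity)] at h1
  rw [besselK0_ofReal hx, h1, besselLaplace]
  push_cast
  rw [← integral_complex_ofReal]
  congr 1
  · congr 1; ring
  · refine setIntegral_congr_fun measurableSet_Ioi fun τ hτ => ?_
    have hτ0 : 0 < τ := hτ
    have h3 : (τ : ℂ) + 2 * x = ((τ + 4 * (x / 2) : ℝ) : ℂ) := by push_cast; ring
    have h4 : (-(1 / 2) : ℂ) = ((-(1 / 2) : ℝ) : ℂ) := by push_cast; ring
    rw [h3, h4, ← Complex.ofReal_cpow (by positivity)]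
    push_cast
    rfl

/-- Both functions are analytic on the slit plane, star-shaped about `1`, and agree on the positive
axis. The series gives the jump of `K₀`, the Laplace integral its growth. -/
theorem besselLaplace_eq_besselK0 {w : ℂ} (hw : w ∈ Complex.slitPlane) :
    besselLaplace w = besselK0 w := by
  have hpre : IsPreconnected Complex.slitPlane :=
    (Complex.starConvex_one_slitPlane.isPathConnected
      Complex.one_mem_slitPlane).isConnected.isPreconnected
  refine AnalyticOnNhd.eqOn_of_preconnected_of_frequently_eq
    (DifferentiableOn.analyticOnNhd (fun z hz =>
      (differentiableAt_besselLaplace hz).differentiableWithinAt) Complex.isOpen_slitPlane)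
    (DifferentiableOn.analyticOnNhd (fun z hz =>
      (differentiableAt_besselK0 hz).differentiableWithinAt) Complex.isOpen_slitPlane)
    hpre Complex.one_mem_slitPlane ?_ hw
  have ht : Tendsto (fun x : ℝ => (x : ℂ)) (𝓝[>] 1) (𝓝[≠] 1) := by
    refine tendsto_nhdsWithin_iff.2 ⟨?_, ?_⟩
    · have := Complex.continuous_ofReal.tendsto 1
      rw [Complex.ofReal_one] at this
      exact this.mono_left nhdsWithin_le_nhds
    · filter_upwards [self_mem_nhdsWithin] with x hx
      have hx1 : x ≠ 1 := ne_of_gt hx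
      exact fun h => hx1 (Complex.ofReal_eq_one.1 h)
  refine ht.frequently (Eventually.frequently ?_)
  filter_upwards [self_mem_nhdsWithin] with x hx
  exact besselLaplace_ofReal (one_pos.trans hx)

theorem mem_slitPlane_of_im_le_re {w : ℂ} (hw : w ≠ 0) (h : w.im ≤ w.re) :
    w ∈ Complex.slitPlane := by
  rw [Complex.mem_slitPlane_iff]
  by_contra hcon
  push Not at hcon
  rw [hcon.2] at h
  exact hw (Complex.ext (le_antisymm hcon.1 h) hcon.2)

/-- If `Re w ≥ 0`, adding `τ` only helps. Otherwise `|Im w| ≥ |Re w|`, and the imaginary part `2 Im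
w` alone is large enough. -/
theorem norm_le_norm_ofReal_add {w : ℂ} (h : w.im ≤ w.re) {τ : ℝ} (hτ : 0 ≤ τ) :
    ‖w‖ ≤ ‖(τ : ℂ) + 2 * w‖ := by
  rw [← sq_le_sq₀ (norm_nonneg _) (norm_nonneg _), ← Complex.normSq_eq_norm_sq,
    ← Complex.normSq_eq_norm_sq, Complex.normSq_apply, Complex.normSq_apply]
  have h1 : ((τ : ℂ) + 2 * w).re = τ + 2 * w.re := by simp
  have h2 : ((τ : ℂ) + 2 * w).im = 2 * w.im := by simp
  rw [h1, h2]
  rcases le_total 0 w.re with h0 | h0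
  · nlinarith [mul_nonneg hτ h0]
  · nlinarith [sq_nonneg (τ + 2 * w.re)]

/-- A bound for `K₀` in the half-plane `Im w ≤ Re w`. -/
theorem exists_norm_besselK0_le : ∃ C, 0 ≤ C ∧ ∀ w : ℂ, w ≠ 0 → w.im ≤ w.re →
    ‖besselK0 w‖ ≤ C * (Real.exp (-w.re) * ‖w‖ ^ (-(1 / 2) : ℝ)) := by
  refine ⟨∫ τ in Ioi (0 : ℝ), gammaWeight τ,
    setIntegral_nonneg measurableSet_Ioi fun τ hτ => gammaWeight_nonneg hτ, fun w hw h => ?_⟩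
  rw [← besselLaplace_eq_besselK0 (mem_slitPlane_of_im_le_re hw h), besselLaplace, norm_mul,
    Complex.norm_exp, Complex.neg_re]
  have h1 : ‖∫ τ in Ioi (0 : ℝ), (gammaWeight τ : ℂ) * ((τ : ℂ) + 2 * w) ^ (-(1 / 2) : ℂ)‖ ≤
      ∫ τ in Ioi (0 : ℝ), gammaWeight τ * ‖w‖ ^ (-(1 / 2) : ℝ) := by
    refine norm_integral_le_of_norm_le (integrableOn_gammaWeight.mul_const _) ?_
    filter_upwards [ae_restrict_mem measurableSet_Ioi] with τ hτ
    rw [norm_mul, Complex.norm_real, Real.norm_of_nonneg (gammaWeight_nonneg hτ),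
      norm_cpow_neg_half]
    exact mul_le_mul_of_nonneg_left (Real.rpow_le_rpow_of_nonpos (norm_pos_iff.2 hw)
      (norm_le_norm_ofReal_add h (le_of_lt hτ)) (by norm_num)) (gammaWeight_nonneg hτ)
  rw [integral_mul_const] at h1
  calc _ ≤ Real.exp (-w.re) * ((∫ τ in Ioi (0 : ℝ), gammaWeight τ) * ‖w‖ ^ (-(1 / 2) : ℝ)) := by
        gcongr
    _ = _ := by ring


/-! ### Properties of the transfer operator -/

theorem exp_neg_pi_div_four_mul_I : Complex.exp (-(Real.pi / 4 : ℂ) * Complex.I) =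
    ((Real.sqrt 2 / 2 : ℝ) : ℂ) - ((Real.sqrt 2 / 2 : ℝ) : ℂ) * Complex.I := by
  have h : (-(Real.pi / 4 : ℂ)) = ((-(Real.pi / 4) : ℝ) : ℂ) := by push_cast; ring
  rw [h, Complex.exp_mul_I, ← Complex.ofReal_cos, ← Complex.ofReal_sin, Real.cos_neg, Real.sin_neg,
    Real.cos_pi_div_four, Real.sin_pi_div_four]
  push_cast
  ring

theorem rotate_re (s : ℂ) : (Complex.exp (-(Real.pi / 4 : ℂ) * Complex.I) * s).re =
    Real.sqrt 2 / 2 * (s.re + s.im) := by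
  rw [exp_neg_pi_div_four_mul_I]
  simp
  ring

theorem rotate_im (s : ℂ) : (Complex.exp (-(Real.pi / 4 : ℂ) * Complex.I) * s).im =
    Real.sqrt 2 / 2 * (s.im - s.re) := by
  rw [exp_neg_pi_div_four_mul_I]
  simp
  ring

theorem norm_rotate (s : ℂ) : ‖Complex.exp (-(Real.pi / 4 : ℂ) * Complex.I) * s‖ = ‖s‖ := by
  have h : (-(Real.pi / 4 : ℂ)) = ((-(Real.pi / 4) : ℝ) : ℂ) := by push_cast; ring
  rw [h, norm_mul, Complex.norm_exp_ofReal_mul_I, one_mul]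

/-- Rotation by `-π/4` takes `Re s ≥ 0` to the half-plane `Im w ≤ Re w`. Apart from `0` it avoids
the cut of `K₀`, so the principal branch covers both sides of the cut in `z`. -/
theorem rotate_im_le_re {s : ℂ} (hs : 0 ≤ s.re) :
    (Complex.exp (-(Real.pi / 4 : ℂ) * Complex.I) * s).im ≤
      (Complex.exp (-(Real.pi / 4 : ℂ) * Complex.I) * s).re := by
  rw [rotate_re, rotate_im]
  gcongr
  linarith

/-- If `a = Re s ≥ 0` and `a + Im s ≤ 0`, then with `b = |Im s| ≥ a` one has `(b - a)² ≤ (b - a)(b +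
a) = -Re s² ≤ ξ`. Thus the exponentials stay bounded for `Re z ≥ -ξ`. -/
theorem neg_sqrt_le_rotate_re {s : ℂ} (hs : 0 ≤ s.re) {ξ : ℝ} (hξ : -ξ ≤ (s ^ 2).re) :
    -Real.sqrt ξ ≤ (Complex.exp (-(Real.pi / 4 : ℂ) * Complex.I) * s).re := by
  have h2 : Real.sqrt 2 / 2 ≤ 1 := by
    have := Real.sqrt_two_lt_three_halves
    linarith
  have h0 : 0 ≤ Real.sqrt 2 / 2 := by positivity
  have hsq : (s ^ 2).re = s.re ^ 2 - s.im ^ 2 := by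
    rw [sq, Complex.mul_re]; ring
  rw [hsq] at hξ
  rw [rotate_re]
  rcases le_total 0 (s.re + s.im) with h | h
  · have := mul_nonneg h0 h
    linarith [Real.sqrt_nonneg ξ]
  · have h3 : -(s.re + s.im) ≤ Real.sqrt ξ := Real.le_sqrt_of_sq_le (by nlinarith)
    nlinarith

theorem rpow_neg_half_le {t : ℝ} (ht : 0 < t) : t ^ (-(1 / 2) : ℝ) ≤ 1 + t⁻¹ := by
  rw [Real.rpow_neg ht.le, ← Real.inv_rpow ht.le, ← Real.sqrt_eq_rpow]
  have : 0 < t⁻¹ := inv_pos.2 ht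
  exact Real.sqrt_le_iff.2 ⟨by positivity, by nlinarith⟩

/-- The singularity `‖s‖⁻¹` is that of `D = 1`; the milder `‖s‖^(-1/2)` obtained for `D = 2` is
weakened to the same form, so that one argument serves all dimensions. -/
theorem exists_norm_transferOfRoot_le (D : ℕ) (hD : D = 1 ∨ D = 2 ∨ D = 3) {d : ℝ} (hd : 0 ≤ d)
    (hd' : D = 1 ∨ 0 < d) (ξ : ℝ) : ∃ C, 0 ≤ C ∧ ∀ s : ℂ, 0 ≤ s.re → s ≠ 0 → -ξ ≤ (s ^ 2).re →
      ‖transferOfRoot D d s‖ ≤ C * (1 + ‖s‖⁻¹) := by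
  have hexp : ∀ s : ℂ, 0 ≤ s.re → -ξ ≤ (s ^ 2).re →
      Real.exp (-(d * (Complex.exp (-(Real.pi / 4 : ℂ) * Complex.I) * s).re)) ≤
        Real.exp (d * Real.sqrt ξ) := fun s hs hξ => by
    apply Real.exp_le_exp.2
    have := mul_le_mul_of_nonneg_left (neg_sqrt_le_rotate_re hs hξ) hd
    linarith
  have hnorm : ∀ s : ℂ, 0 ≤ s.re → -ξ ≤ (s ^ 2).re →
      ‖Complex.exp (-(d : ℂ) * (Complex.exp (-(Real.pi / 4 : ℂ) * Complex.I) * s))‖ ≤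
        Real.exp (d * Real.sqrt ξ) := fun s hs hξ => by
    rw [Complex.norm_exp, ← Complex.ofReal_neg, Complex.re_ofReal_mul, neg_mul]
    exact hexp s hs hξ
  rcases hD with rfl | rfl | rfl
  · refine ⟨Real.exp (d * Real.sqrt ξ), by positivity, fun s hs h0 hξ => ?_⟩
    change ‖1 / (2 * (Complex.exp (-(Real.pi / 4 : ℂ) * Complex.I) * s)) *
      Complex.exp (-(d : ℂ) * (Complex.exp (-(Real.pi / 4 : ℂ) * Complex.I) * s))‖ ≤ _
    rw [norm_mul, norm_div, norm_mul (2 : ℂ), norm_rotate, norm_one, Complex.norm_ofNat, mul_comm]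
    have h1 : 0 ≤ ‖s‖⁻¹ := by positivity
    have h2 : 1 / (2 * ‖s‖) = 1 / 2 * ‖s‖⁻¹ := by rw [one_div, mul_inv, one_div]
    rw [h2]
    exact mul_le_mul (hnorm s hs hξ) (by linarith) (by positivity) (by positivity)
  · have hd0 : 0 < d := hd'.resolve_left (by norm_num)
    obtain ⟨C, hC, hK⟩ := exists_norm_besselK0_le
    refine ⟨1 / (2 * Real.pi) * (C * (Real.exp (d * Real.sqrt ξ) * (1 + d⁻¹))), by positivity,
      fun s hs h0 hξ => ?_⟩
    set w := Complex.exp (-(Real.pi / 4 : ℂ) * Complex.I) * s with hw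
    change ‖1 / (2 * (Real.pi : ℂ)) * besselK0 ((d : ℂ) * w)‖ ≤ _
    have hw0 : w ≠ 0 := mul_ne_zero (Complex.exp_ne_zero _) h0
    have hdw : (d : ℂ) * w ≠ 0 := mul_ne_zero (by exact_mod_cast hd0.ne') hw0
    have hK1 := hK (d * w) hdw (by
      rw [Complex.re_ofReal_mul, Complex.im_ofReal_mul]
      exact mul_le_mul_of_nonneg_left (rotate_im_le_re hs) hd)
    rw [Complex.re_ofReal_mul, norm_mul, Complex.norm_real, Real.norm_of_nonneg hd, hw,
      norm_rotate] at hK1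
    have hs0 : 0 < ‖s‖ := norm_pos_iff.2 h0
    have h1 : (d * ‖s‖) ^ (-(1 / 2) : ℝ) ≤ (1 + d⁻¹) * (1 + ‖s‖⁻¹) := by
      refine (rpow_neg_half_le (by positivity)).trans ?_
      rw [mul_inv]
      have : 0 < d⁻¹ := inv_pos.2 hd0
      have : 0 < ‖s‖⁻¹ := inv_pos.2 hs0
      nlinarith
    have h2 : ‖(1 / (2 * (Real.pi : ℂ)) : ℂ)‖ = 1 / (2 * Real.pi) := by
      rw [norm_div, norm_mul, norm_one, Complex.norm_ofNat, Complex.norm_real,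
        Real.norm_of_nonneg Real.pi_pos.le]
    rw [norm_mul, h2, mul_assoc, mul_assoc, mul_assoc]
    have h3 := hexp s hs hξ
    gcongr
    refine hK1.trans ?_
    gcongr
  · have hd0 : 0 < d := hd'.resolve_left (by norm_num)
    refine ⟨1 / (4 * Real.pi * d) * Real.exp (d * Real.sqrt ξ), by positivity,
      fun s hs h0 hξ => ?_⟩
    change ‖1 / (4 * (Real.pi : ℂ) * (d : ℂ)) *
      Complex.exp (-(d : ℂ) * (Complex.exp (-(Real.pi / 4 : ℂ) * Complex.I) * s))‖ ≤ _
    have h2 : ‖(1 / (4 * (Real.pi : ℂ) * (d : ℂ)) : ℂ)‖ = 1 / (4 * Real.pi * d) := by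
      rw [norm_div, norm_mul, norm_mul, norm_one, Complex.norm_ofNat, Complex.norm_real,
        Complex.norm_real, Real.norm_of_nonneg Real.pi_pos.le, Real.norm_of_nonneg hd]
    rw [norm_mul, h2]
    have h1 : 1 ≤ 1 + ‖s‖⁻¹ := by
      have : 0 ≤ ‖s‖⁻¹ := by positivity
      linarith
    exact (mul_le_mul_of_nonneg_left (hnorm s hs hξ) (by positivity)).trans
      (le_mul_of_one_le_right (by positivity) h1)

theorem differentiableAt_transferOfRoot (D : ℕ) (hD : D = 1 ∨ D = 2 ∨ D = 3) {d : ℝ} (hd : 0 ≤ d)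
    (hd' : D = 1 ∨ 0 < d) {s : ℂ} (hs : 0 ≤ s.re) (h0 : s ≠ 0) :
    DifferentiableAt ℂ (transferOfRoot D d) s := by
  rcases hD with rfl | rfl | rfl
  · change DifferentiableAt ℂ (fun s =>
      1 / (2 * (Complex.exp (-(Real.pi / 4 : ℂ) * Complex.I) * s)) *
      Complex.exp (-(d : ℂ) * (Complex.exp (-(Real.pi / 4 : ℂ) * Complex.I) * s))) s
    have : 2 * (Complex.exp (-(Real.pi / 4 : ℂ) * Complex.I) * s) ≠ 0 :=
      mul_ne_zero two_ne_zero (mul_ne_zero (Complex.exp_ne_zero _) h0)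
    fun_prop (disch := assumption)
  · have hd0 : 0 < d := hd'.resolve_left (by norm_num)
    change DifferentiableAt ℂ (fun s => 1 / (2 * (Real.pi : ℂ)) *
      besselK0 ((d : ℂ) * (Complex.exp (-(Real.pi / 4 : ℂ) * Complex.I) * s))) s
    have hw0 : (d : ℂ) * (Complex.exp (-(Real.pi / 4 : ℂ) * Complex.I) * s) ≠ 0 :=
      mul_ne_zero (by exact_mod_cast hd0.ne') (mul_ne_zero (Complex.exp_ne_zero _) h0)
    have hm := mem_slitPlane_of_im_le_re hw0 (by
      rw [Complex.re_ofReal_mul, Complex.im_ofReal_mul]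
      exact mul_le_mul_of_nonneg_left (rotate_im_le_re hs) hd)
    have hl : DifferentiableAt ℂ
        (fun s => (d : ℂ) * (Complex.exp (-(Real.pi / 4 : ℂ) * Complex.I) * s)) s := by fun_prop
    exact ((differentiableAt_besselK0 hm).comp s hl).const_mul _
  · change DifferentiableAt ℂ (fun s => 1 / (4 * (Real.pi : ℂ) * (d : ℂ)) *
      Complex.exp (-(d : ℂ) * (Complex.exp (-(Real.pi / 4 : ℂ) * Complex.I) * s))) s
    fun_prop

theorem analyticAt_transferK (D : ℕ) (hD : D = 1 ∨ D = 2 ∨ D = 3) {d : ℝ} (hd : 0 ≤ d)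
    (hd' : D = 1 ∨ 0 < d) {z : ℂ} (hz : 0 < z.re) : AnalyticAt ℂ (transferK D d) z := by
  have ho : IsOpen {z : ℂ | 0 < z.re} := isOpen_lt continuous_const Complex.continuous_re
  refine DifferentiableOn.analyticAt (s := {z : ℂ | 0 < z.re}) (fun w hw => ?_) (ho.mem_nhds hz)
  have hw0 : w ≠ 0 := by rintro rfl; simp at hw
  have h1 : DifferentiableAt ℂ (fun w : ℂ => w ^ (1 / 2 : ℂ)) w :=
    differentiableAt_id.cpow_const (Or.inl hw)
  exact ((differentiableAt_transferOfRoot D hD hd hd' (re_cpow_half_nonneg w)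
    (cpow_half_ne_zero hw0)).comp w h1).differentiableWithinAt

/-! ### The jump across the cut -/

theorem jumpG_eq (D : ℕ) (d lam : ℝ) : jumpG D d lam =
    transferOfRoot D d (-((Real.sqrt lam : ℂ) * Complex.I)) -
      transferOfRoot D d ((Real.sqrt lam : ℂ) * Complex.I) := by
  rw [jumpG, transferPolar, transferPolar, sqrt_mul_exp_pi_half, sqrt_mul_exp_neg_pi_half]

theorem rotate_mul_I (u : ℂ) :
    Complex.exp (-(Real.pi / 4 : ℂ) * Complex.I) * (u * Complex.I) =
      Complex.exp (Complex.I * (Real.pi / 4 : ℂ)) * u := by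
  have h2 : Complex.exp (-(Real.pi / 4 : ℂ) * Complex.I) * Complex.I =
      Complex.exp (Complex.I * (Real.pi / 4 : ℂ)) := by
    have h : Complex.exp (Complex.I * (Real.pi / 4 : ℂ)) =
        Complex.exp (-(Real.pi / 4 : ℂ) * Complex.I) * Complex.exp ((Real.pi / 2 : ℂ) * Complex.I) := by
      rw [← Complex.exp_add]
      congr 1
      ring
    rw [h, Complex.exp_pi_div_two_mul_I]
  rw [← h2]
  ring

theorem exp_I_mul_pi_div_four_sq : Complex.exp (Complex.I * (Real.pi / 4 : ℂ)) ^ 2 = Complex.I := by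
  rw [← Complex.exp_nat_mul]
  refine Eq.trans ?_ Complex.exp_pi_div_two_mul_I
  congr 1
  push_cast
  ring

/-- The prefactor `1 / (2w)` is odd in `w`, so the difference of the two exponentials becomes a sum;
the constant uses `-1 / E = i E` for `E = e^{iπ/4}`. -/
theorem jumpG_one (d : ℝ) {lam : ℝ} (hlam : 0 < lam) : jumpG 1 d lam =
    Complex.I * Complex.exp (Complex.I * (Real.pi / 4 : ℂ)) / (Real.sqrt lam : ℂ) *
      Complex.cosh ((d : ℂ) * Complex.exp (Complex.I * (Real.pi / 4 : ℂ)) *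
        (Real.sqrt lam : ℂ)) := by
  have hs : (Real.sqrt lam : ℂ) ≠ 0 := by exact_mod_cast (Real.sqrt_pos.2 hlam).ne'
  have hE := exp_I_mul_pi_div_four_sq
  have hE0 := Complex.exp_ne_zero (Complex.I * (Real.pi / 4 : ℂ))
  have hI := Complex.I_sq
  rw [jumpG_eq]
  simp only [transferOfRoot, mul_neg, rotate_mul_I]
  set E := Complex.exp (Complex.I * (Real.pi / 4 : ℂ)) with hEdef
  rw [Complex.cosh]
  have h1 : -(d : ℂ) * (E * (Real.sqrt lam : ℂ)) = -((d : ℂ) * E * (Real.sqrt lam : ℂ)) := by ring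
  rw [h1, neg_neg]
  have h2 : (1 : ℂ) / (2 * (E * (Real.sqrt lam : ℂ))) = -(Complex.I * E / (2 * Real.sqrt lam)) := by
    field_simp
    rw [hE]
    linear_combination hI
  have h3 : (1 : ℂ) / -(2 * (E * (Real.sqrt lam : ℂ))) = Complex.I * E / (2 * Real.sqrt lam) := by
    rw [div_neg, h2, neg_neg]
  rw [h2, h3]
  ring

/-- Here the prefactor is the same on both sides of the cut, so the difference of exponentials is a
hyperbolic sine. -/
theorem jumpG_three (d lam : ℝ) : jumpG 3 d lam =
    1 / (2 * (Real.pi : ℂ) * (d : ℂ)) *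
      Complex.sinh ((d : ℂ) * Complex.exp (Complex.I * (Real.pi / 4 : ℂ)) *
        (Real.sqrt lam : ℂ)) := by
  rw [jumpG_eq]
  simp only [transferOfRoot, mul_neg, rotate_mul_I]
  rw [Complex.sinh]
  have h1 : -(d : ℂ) * (Complex.exp (Complex.I * (Real.pi / 4 : ℂ)) * (Real.sqrt lam : ℂ)) =
      -((d : ℂ) * Complex.exp (Complex.I * (Real.pi / 4 : ℂ)) * (Real.sqrt lam : ℂ)) := by ring
  rw [h1, neg_neg]
  ring

theorem log_ofReal_mul_exp {r θ : ℝ} (hr : 0 < r) (h1 : -Real.pi < θ) (h2 : θ ≤ Real.pi) :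
    Complex.log ((r : ℂ) * Complex.exp ((θ : ℂ) * Complex.I)) =
      (Real.log r : ℂ) + (θ : ℂ) * Complex.I := by
  rw [Complex.log_ofReal_mul hr (Complex.exp_ne_zero _), Complex.log_exp]
  · simpa using h1
  · simpa using h2

/-- The jump of the principal branch of `K₀` along the ray through `e^{iπ/4}`. -/
theorem besselK0_neg_sub {r : ℝ} (hr : 0 < r) :
    besselK0 (-((r : ℂ) * Complex.exp (Complex.I * (Real.pi / 4 : ℂ)))) -
      besselK0 ((r : ℂ) * Complex.exp (Complex.I * (Real.pi / 4 : ℂ))) =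
      Real.pi * Complex.I * besselI0 ((r : ℂ) * Complex.exp (Complex.I * (Real.pi / 4 : ℂ))) := by
  have hpi := Real.pi_pos
  have l1 : Complex.log ((r : ℂ) * Complex.exp (Complex.I * (Real.pi / 4 : ℂ)) / 2) =
      (Real.log (r / 2) : ℂ) + ((Real.pi / 4 : ℝ) : ℂ) * Complex.I := by
    rw [← log_ofReal_mul_exp (by positivity) (by linarith) (by linarith)]
    congr 1
    push_cast
    rw [mul_comm Complex.I]
    ring
  -- The point opposite to argument `π/4` has principal argument `-3π/4`, so the two logarithms
  -- differ by exactly `iπ`.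
  have l2 : Complex.log (-((r : ℂ) * Complex.exp (Complex.I * (Real.pi / 4 : ℂ))) / 2) =
      (Real.log (r / 2) : ℂ) + ((-(3 * Real.pi / 4) : ℝ) : ℂ) * Complex.I := by
    rw [← log_ofReal_mul_exp (by positivity) (by linarith) (by linarith)]
    congr 1
    have h1 : Complex.exp (((-(3 * Real.pi / 4) : ℝ) : ℂ) * Complex.I) =
        -Complex.exp (Complex.I * (Real.pi / 4 : ℂ)) := by
      have h2 : ((-(3 * Real.pi / 4) : ℝ) : ℂ) * Complex.I =
          Complex.I * (Real.pi / 4 : ℂ) - Real.pi * Complex.I := by push_cast; ring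
      rw [h2, Complex.exp_sub, Complex.exp_pi_mul_I, div_neg, div_one]
    rw [h1]
    push_cast
    ring
  rw [besselK0, besselK0, l1, l2, besselI0, besselI0, neg_sq]
  push_cast
  ring

/-- The series parts of `K₀` are even and cancel; only the jump of the logarithm, times `I₀`,
survives. The arguments of `I₀` and `J₀` have opposite squares, which matches the sign `(-1)^k`. -/
theorem jumpG_two {d lam : ℝ} (hd : 0 < d) (hlam : 0 < lam) : jumpG 2 d lam =
    Complex.I / 2 * besselJ0 (Complex.exp (-(Complex.I * (Real.pi / 4 : ℂ))) *
      (Real.sqrt lam : ℂ) * (d : ℂ)) := by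
  have hr : 0 < d * Real.sqrt lam := mul_pos hd (Real.sqrt_pos.2 hlam)
  have h1 : (d : ℂ) * (Complex.exp (Complex.I * (Real.pi / 4 : ℂ)) * (Real.sqrt lam : ℂ)) =
      ((d * Real.sqrt lam : ℝ) : ℂ) * Complex.exp (Complex.I * (Real.pi / 4 : ℂ)) := by
    push_cast; ring
  have hJ : besselJ0 (Complex.exp (-(Complex.I * (Real.pi / 4 : ℂ))) * (Real.sqrt lam : ℂ) * (d : ℂ)) =
      besselI0 (((d * Real.sqrt lam : ℝ) : ℂ) * Complex.exp (Complex.I * (Real.pi / 4 : ℂ))) := by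
    rw [besselJ0, besselI0]
    refine tsum_congr fun k => ?_
    rw [← mul_pow]
    congr 2
    have hE := exp_I_mul_pi_div_four_sq
    have hE' : Complex.exp (-(Complex.I * (Real.pi / 4 : ℂ))) ^ 2 = -Complex.I := by
      rw [Complex.exp_neg, inv_pow, hE, Complex.inv_I]
    rw [mul_pow, mul_pow, mul_pow, hE, hE']
    push_cast
    ring
  have hpi : (Real.pi : ℂ) ≠ 0 := by exact_mod_cast Real.pi_ne_zero
  rw [jumpG_eq]
  simp only [transferOfRoot, mul_neg, rotate_mul_I]
  rw [h1, ← mul_sub, besselK0_neg_sub hr, hJ]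
  field_simp

/-! ### The integral representation of the weights -/

namespace RKMethod

variable {m : ℕ} {M : RKMethod m}

theorem differentiableAt_stab_pow_mul_res {h : ℝ} {z : ℂ}
    (hz : IsUnit (M.invA - ((h : ℂ) * z) • (1 : Matrix (Fin (m + 1)) (Fin (m + 1)) ℂ))) (n : ℕ)
    (i : Fin (m + 1)) : DifferentiableAt ℂ
      (fun z => M.stab ((h : ℂ) * z) ^ n * M.res ((h : ℂ) * z) (Fin.last m) i) z := by
  have hl : DifferentiableAt ℂ (fun z : ℂ => (h : ℂ) * z) z := by fun_prop
  have h1 := (differentiableAt_stab hz).comp z hl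
  have h2 := (differentiableAt_res hz (Fin.last m) i).comp z hl
  exact (h1.pow n).mul h2

/-- One factor `stab` contributes one power of decay and the resolvent the other; this is what `n ≥
1` provides. -/
theorem exists_norm_stab_pow_mul_res_le {h : ℝ} (hh : 0 < h) {T : Set ℂ} (hT : IsClosed T)
    (hunit : ∀ z ∈ T,
      IsUnit (M.invA - ((h : ℂ) * z) • (1 : Matrix (Fin (m + 1)) (Fin (m + 1)) ℂ)))
    {n : ℕ} (hn : 1 ≤ n) (i : Fin (m + 1)) : ∃ C, 0 ≤ C ∧ ∀ z ∈ T,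
      ‖M.stab ((h : ℂ) * z) ^ n * M.res ((h : ℂ) * z) (Fin.last m) i‖ ≤ C / (1 + ‖z‖) ^ 2 := by
  obtain ⟨C, hC, hres⟩ := exists_norm_res_le hh hT hunit
  obtain ⟨C', hC', hstab⟩ := exists_norm_stab_le hres
  refine ⟨(C' * C) ^ n * C, by positivity, fun z hz => ?_⟩
  have h1 : 1 ≤ 1 + ‖z‖ := by linarith [norm_nonneg z]
  have h0 : 0 < 1 + ‖z‖ := by linarith
  have h2 : ‖M.stab ((h : ℂ) * z)‖ ^ n ≤ (C' * C) ^ n / (1 + ‖z‖) := by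
    calc ‖M.stab ((h : ℂ) * z)‖ ^ n ≤ (C' * (C / (1 + ‖z‖))) ^ n := by
          gcongr; exact hstab z hz
      _ = (C' * C) ^ n / (1 + ‖z‖) ^ n := by rw [← mul_div_assoc, div_pow]
      _ ≤ (C' * C) ^ n / (1 + ‖z‖) := by
          gcongr
          exact le_self_pow₀ h1 (by omega)
  rw [norm_mul, norm_pow]
  calc ‖M.stab ((h : ℂ) * z)‖ ^ n * ‖M.res ((h : ℂ) * z) (Fin.last m) i‖ ≤
        (C' * C) ^ n / (1 + ‖z‖) * (C / (1 + ‖z‖)) :=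
      mul_le_mul h2 (hres z hz _ _) (norm_nonneg _) (by positivity)
    _ = _ := by field_simp

/-- The representation of the weights by integrals over the vertical half-lines and the cut, for a
transfer operator `z ↦ k (√z)`. -/
theorem Admissible.omega_eq (hM : M.Admissible) {k : ℂ → ℂ} {h ξ C : ℝ} (hh : 0 < h) (hξ : 0 < ξ)
    (hC : 0 ≤ C) (hk : ∀ s : ℂ, 0 ≤ s.re → s ≠ 0 → DifferentiableAt ℂ k s)
    (hkb : ∀ s : ℂ, 0 ≤ s.re → s ≠ 0 → -ξ ≤ (s ^ 2).re → ‖k s‖ ≤ C * (1 + ‖s‖⁻¹))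
    (hf : ∀ z : ℂ, 0 < z.re → AnalyticAt ℂ (fun z => k (z ^ (1 / 2 : ℂ))) z)
    {n : ℕ} (hn : 1 ≤ n) (i : Fin (m + 1)) :
    IntegrableOn (fun y : ℝ => k ((-(ξ : ℂ) + Complex.I * (y : ℂ)) ^ (1 / 2 : ℂ)) *
      M.e n ((h : ℂ) * (-(ξ : ℂ) + Complex.I * (y : ℂ))) i) (Ioi 0) ∧
    IntegrableOn (fun y : ℝ => k ((-(ξ : ℂ) - Complex.I * (y : ℂ)) ^ (1 / 2 : ℂ)) *
      M.e n ((h : ℂ) * (-(ξ : ℂ) - Complex.I * (y : ℂ))) i) (Ioi 0) ∧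
    IntervalIntegrable (fun lam : ℝ =>
      (k (-((Real.sqrt lam : ℂ) * Complex.I)) - k ((Real.sqrt lam : ℂ) * Complex.I)) *
        M.e n (-(h : ℂ) * (lam : ℂ)) i) volume 0 ξ ∧
    M.omega (fun z => k (z ^ (1 / 2 : ℂ))) h n i =
      (h : ℂ) / (2 * (Real.pi : ℂ) * Complex.I) *
        verticalIntegral ξ (fun z => k (z ^ (1 / 2 : ℂ)) * M.e n ((h : ℂ) * z) i) +
      (h : ℂ) / (2 * (Real.pi : ℂ) * Complex.I) * ∫ lam in (0 : ℝ)..ξ,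
        (k (-((Real.sqrt lam : ℂ) * Complex.I)) - k ((Real.sqrt lam : ℂ) * Complex.I)) *
          M.e n (-(h : ℂ) * (lam : ℂ)) i := by
  obtain ⟨ρ₀, hρ0, hρ1, hunit⟩ := hM.exists_apollonius hh
  set q : ℂ → ℂ := fun z => M.stab ((h : ℂ) * z) ^ n * M.res ((h : ℂ) * z) (Fin.last m) i with hq_def
  have hq : ∀ z : ℂ, ρ₀ * ‖z + 1‖ ≤ ‖z - 1‖ → DifferentiableAt ℂ q z := fun z hz =>
    differentiableAt_stab_pow_mul_res (hunit z hz) n i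
  obtain ⟨C', hC', hqb⟩ := exists_norm_stab_pow_mul_res_le (M := M) hh
    (T := {z : ℂ | ρ₀ * ‖z + 1‖ ≤ ‖z - 1‖})
    (isClosed_le (by fun_prop) (by fun_prop)) hunit hn i
  have hqb' : ∀ z : ℂ, ρ₀ * ‖z + 1‖ ≤ ‖z - 1‖ → ‖q z‖ ≤ C' / (1 + ‖z‖) ^ 2 := hqb
  have he : ∀ z : ℂ, z.re ≤ 0 → M.e n ((h : ℂ) * z) i = q z := fun z hz =>
    hM.e_eq (hunit z (apollonius_of_re_nonpos hρ1 hz)) hn i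
  have he1 : ∀ y : ℝ, M.e n ((h : ℂ) * (-(ξ : ℂ) + Complex.I * (y : ℂ))) i =
      q (-(ξ : ℂ) + Complex.I * (y : ℂ)) := fun y => he _ (by simp [hξ.le])
  have he2 : ∀ y : ℝ, M.e n ((h : ℂ) * (-(ξ : ℂ) - Complex.I * (y : ℂ))) i =
      q (-(ξ : ℂ) - Complex.I * (y : ℂ)) := fun y => he _ (by simp [hξ.le])
  have he3 : ∀ lam ∈ uIcc 0 ξ, M.e n (-(h : ℂ) * (lam : ℂ)) i = q (-(lam : ℂ)) := fun lam hlam => by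
    rw [uIcc_of_le hξ.le] at hlam
    have h1 : -(h : ℂ) * (lam : ℂ) = (h : ℂ) * (-(lam : ℂ)) := by ring
    rw [h1, he _ (by simpa using hlam.1)]
  have iv : ∀ {σ : ℝ}, |σ| = 1 → _ := fun {σ} hσ =>
    integrableOn_slit_vertical (x := -ξ) (σ := σ) hρ1 hC hC' hk hkb hq hqb'
      ⟨le_rfl, by linarith⟩ hσ
  have ie : ∀ {σ : ℝ}, |σ| = 1 → _ := fun {σ} hσ =>
    intervalIntegrable_slit_edge (σ := σ) hρ1 hC hC' hk hkb hξ hσ hq hqb'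
  refine ⟨?_, ?_, ?_, ?_⟩
  · refine (iv (σ := 1) abs_one).congr_fun (fun y _ => ?_) measurableSet_Ioi
    beta_reduce
    rw [he1]
    push_cast
    rw [one_mul]
  · refine (iv (σ := -1) (by norm_num)).congr_fun (fun y _ => ?_) measurableSet_Ioi
    beta_reduce
    rw [he2]
    push_cast
    rw [neg_one_mul, mul_neg, ← sub_eq_add_neg]
  · refine ((ie (σ := -1) (by norm_num)).sub (ie (σ := 1) abs_one)).congr fun lam hlam => ?_
    rw [he3 lam (uIoc_subset_uIcc hlam)]
    push_cast
    rw [neg_one_mul, one_mul, sub_mul]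
  · have hunit' : ∀ ρ ∈ Ico ρ₀ 1, ∀ z : ℂ, ρ * ‖z + 1‖ ≤ ‖z - 1‖ →
        IsUnit (M.invA - ((h : ℂ) * z) • (1 : Matrix (Fin (m + 1)) (Fin (m + 1)) ℂ)) :=
      fun ρ hρ z hz => hunit z ((mul_le_mul_of_nonneg_right hρ.1 (norm_nonneg _)).trans hz)
    -- The left-hand side does not involve `ρ`; comparing two radii below shows that the contour
    -- integral is independent of `ρ`, with no deformation of contours.
    have hW : ∀ ρ ∈ Ico ρ₀ 1, M.omega (fun z => k (z ^ (1 / 2 : ℂ))) h n i =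
        -(h : ℂ) * ∫ θ in (0 : ℝ)..2 * Real.pi, cayleyDensity ρ θ *
          (k (cayleyContour ρ θ ^ (1 / 2 : ℂ)) * q (cayleyContour ρ θ)) := fun ρ hρ => by
      rw [omega, hM.W_eq hf hh (hρ0.trans_le hρ.1) hρ.2 (hunit' ρ hρ)]
      simp only [Matrix.of_apply, resCoeff_last hn, hq_def]
    have hh' : -(h : ℂ) ≠ 0 := neg_ne_zero.2 (by exact_mod_cast hh.ne')
    have hc := integral_cayley_eq_slit hρ0 hρ1 hξ hC hC' hk hkb hq hqb'
      (c := ∫ θ in (0 : ℝ)..2 * Real.pi, cayleyDensity ρ₀ θ *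
          (k (cayleyContour ρ₀ θ ^ (1 / 2 : ℂ)) * q (cayleyContour ρ₀ θ)))
      fun ρ hρ => mul_left_cancel₀ hh' ((hW ρ hρ).symm.trans (hW ρ₀ ⟨le_rfl, hρ1⟩))
    have hV : verticalIntegral ξ (fun z => k (z ^ (1 / 2 : ℂ)) * M.e n ((h : ℂ) * z) i) =
        verticalIntegral ξ (fun z => k (z ^ (1 / 2 : ℂ)) * q z) := by
      simp only [verticalIntegral, he1, he2]
    have hJ : ∫ lam in (0 : ℝ)..ξ,
        (k (-((Real.sqrt lam : ℂ) * Complex.I)) - k ((Real.sqrt lam : ℂ) * Complex.I)) *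
          M.e n (-(h : ℂ) * (lam : ℂ)) i = ∫ lam in (0 : ℝ)..ξ,
        (k (-((Real.sqrt lam : ℂ) * Complex.I)) - k ((Real.sqrt lam : ℂ) * Complex.I)) *
          q (-(lam : ℂ)) :=
      intervalIntegral.integral_congr fun lam hlam => by
        rw [he3 lam hlam]
    rw [hW ρ₀ ⟨le_rfl, hρ1⟩, hc, hV, hJ]
    ring

end RKMethod

end SchrodingerCQ

theorem theorem3p3 {m : ℕ} (M : SchrodingerCQ.RKMethod m) (hM : M.Admissible)
    (D : ℕ) (hD : D = 1 ∨ D = 2 ∨ D = 3)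
    (x : EuclideanSpace ℝ (Fin D)) (hx : D = 1 ∨ x ≠ 0)
    (h ξ : ℝ) (hh : 0 < h) (hξ : 0 < ξ) :
    -- the expansions that define the weights and the vectors `e_n` are meaningful
    (∀ᶠ ζ in 𝓝 (0 : ℂ),
      SchrodingerCQ.IsMatrixFunction (SchrodingerCQ.transferK D ‖x‖)
        ((h : ℂ)⁻¹ • M.symbol ζ) (M.cqMatrix (SchrodingerCQ.transferK D ‖x‖) h ζ) ∧
      HasSum (fun n : ℕ => ζ ^ n • M.W (SchrodingerCQ.transferK D ‖x‖) h n)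
        (M.cqMatrix (SchrodingerCQ.transferK D ‖x‖) h ζ)) ∧
    (∀ z : ℂ, z.re ≤ 0 → ∀ᶠ ζ in 𝓝 (0 : ℂ),
      IsUnit (M.symbol ζ - z • (1 : Matrix (Fin (m + 1)) (Fin (m + 1)) ℂ)) ∧
      HasSum (fun n : ℕ => ζ ^ n • M.E n z) (M.resolvent z ζ)) ∧
    -- the integral representation of the weights, with absolutely convergent integrals
    (∀ n : ℕ, 1 ≤ n → ∀ i : Fin (m + 1),
      IntegrableOn (fun y : ℝ =>
        SchrodingerCQ.transferK D ‖x‖ (-(ξ : ℂ) + Complex.I * (y : ℂ)) *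
          M.e n ((h : ℂ) * (-(ξ : ℂ) + Complex.I * (y : ℂ))) i) (Ioi 0) ∧
      IntegrableOn (fun y : ℝ =>
        SchrodingerCQ.transferK D ‖x‖ (-(ξ : ℂ) - Complex.I * (y : ℂ)) *
          M.e n ((h : ℂ) * (-(ξ : ℂ) - Complex.I * (y : ℂ))) i) (Ioi 0) ∧
      IntervalIntegrable (fun lam : ℝ =>
        SchrodingerCQ.jumpG D ‖x‖ lam * M.e n (-(h : ℂ) * (lam : ℂ)) i) volume 0 ξ ∧
      M.omega (SchrodingerCQ.transferK D ‖x‖) h n i =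
        (h : ℂ) / (2 * (Real.pi : ℂ) * Complex.I) *
          SchrodingerCQ.verticalIntegral ξ
            (fun z => SchrodingerCQ.transferK D ‖x‖ z * M.e n ((h : ℂ) * z) i) +
        (h : ℂ) / (2 * (Real.pi : ℂ) * Complex.I) *
          ∫ lam in (0 : ℝ)..ξ,
            SchrodingerCQ.jumpG D ‖x‖ lam * M.e n (-(h : ℂ) * (lam : ℂ)) i) ∧
    -- the explicit form of the jump
    (∀ lam : ℝ, 0 < lam →
      (D = 1 → SchrodingerCQ.jumpG D ‖x‖ lam =
        Complex.I * Complex.exp (Complex.I * (Real.pi / 4 : ℂ)) / (Real.sqrt lam : ℂ) *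
          Complex.cosh ((‖x‖ : ℂ) * Complex.exp (Complex.I * (Real.pi / 4 : ℂ)) *
            (Real.sqrt lam : ℂ))) ∧
      (D = 2 → SchrodingerCQ.jumpG D ‖x‖ lam =
        Complex.I / 2 *
          SchrodingerCQ.besselJ0 (Complex.exp (-(Complex.I * (Real.pi / 4 : ℂ))) *
            (Real.sqrt lam : ℂ) * (‖x‖ : ℂ))) ∧
      (D = 3 → SchrodingerCQ.jumpG D ‖x‖ lam =
        1 / (2 * (Real.pi : ℂ) * (‖x‖ : ℂ)) *
          Complex.sinh ((‖x‖ : ℂ) * Complex.exp (Complex.I * (Real.pi / 4 : ℂ)) *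
            (Real.sqrt lam : ℂ)))) := by
  have hd : 0 ≤ ‖x‖ := norm_nonneg x
  have hd' : D = 1 ∨ 0 < ‖x‖ := hx.imp_right norm_pos_iff.2
  have hf : ∀ z : ℂ, 0 < z.re → AnalyticAt ℂ (SchrodingerCQ.transferK D ‖x‖) z := fun z hz =>
    SchrodingerCQ.analyticAt_transferK D hD hd hd' hz
  obtain ⟨C, hC, hkb⟩ := SchrodingerCQ.exists_norm_transferOfRoot_le D hD hd hd' ξ
  refine ⟨?_, fun z hz => ?_, fun n hn i => ?_, fun lam hlam => ⟨?_, ?_, ?_⟩⟩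
  · obtain ⟨ρ, h0, h1, hunit⟩ := hM.exists_apollonius hh
    rw [hM.W_eq hf hh h0 h1 hunit]
    exact hM.cqMatrix_hasSum hf hh h0 h1 hunit
  · have hu := hM.isUnit_of_re_nonpos hz
    simp only [hM.E_eq hu]
    exact hM.eventually_resolvent_hasSum hu
  · simp only [SchrodingerCQ.jumpG_eq]
    exact hM.omega_eq hh hξ hC (fun s hs h0 =>
      SchrodingerCQ.differentiableAt_transferOfRoot D hD hd hd' hs h0) hkb hf hn i
  · rintro rfl
    exact SchrodingerCQ.jumpG_one _ hlam
  · rintro rfl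
    exact SchrodingerCQ.jumpG_two (hd'.resolve_left (by norm_num)) hlam
  · rintro rfl
    exact SchrodingerCQ.jumpG_three _ _
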